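/- **Square ice.** Consider the $n\times n$ square grid of tetravalent vertices (rows numbered from top to bottom, columns from left to right) together with its $4n$ univalent boundary vertices. A state of square ice with domain wall boundary is an orientation of all edges such that two edges enter and two edges leave every tetravalent vertex, the left and right boundary edges are oriented inwards and the upper and lower boundary edges are oriented outwards. The alternating-sign matrix of a state has at a vertex the entry $1$ if both horizontal edges enter it, $-1$ if both horizontal edges leave it, and $0$ otherwise; this is a bijection between states and $n\times n$ alternating-sign matrices. Write $\bar z=z^{-1}$ and $\sigma(z)=z-\bar z$. A vertex with spectral parameter $z$ has weight $\sigma(a^2)$ if its entry is $\pm1$; if its entry is $0$, it has weight $\sigma(az)$ when its arrows go right and up or left and down, and $\sigma(a\bar z)$ when they go left and up or right and down. Let $F$ be a field of characteristic $0$, let $a\in F$ with $a\neq0$, $a^4\ne1$, let $m\ge0$, and let $\mathbf x=(x_1,\dots,x_{m+1})$, $\mathbf y=(y_1,\dots,y_{m+1})$ be independent variables over $F$. Put $\mathbf x'=(x_1,\dots,x_m)$ and $\mathbf y'=(y_1,\dots,y_m)$. * $Z(n;\mathbf x,\mathbf y)$ is the sum over all states of the $n\times n$ grid of the product of the weights of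 all vertices, the vertex in row $i$ and column $j$ having spectral parameter $x_i\bar y_j$. * $Z_{\mathrm{HT}}(2n;\mathbf x,\mathbf y)$ is the sum over the states of the $2n\times2n$ grid that are invariant under rotation by $180^\circ$ of the product of the weights of the vertices in the first $n$ columns; rows $i$ and $2n+1-i$ carry the parameter $x_i$ and column $j\le n$ carries $y_j$. * $Z^{(2)}_{\mathrm{HT}}(2n;\mathbf x,\mathbf y)=Z_{\mathrm{HT}}(2n;\mathbf x,\mathbf y)/Z(n;\mathbf x,\mathbf y)$. * $Z_{\mathrm{HT}}(2m+1;\mathbf x,\mathbf y)$ is the sum over the states of the $(2m+1)\times(2m+1)$ grid that are invariant under rotation by $180^\circ$ of the product of the weights of the vertices in the first $m$ columns and of those vertices of column $m+1$ that lie below the centre; rows $i$ and $2m+2-i$ carry $x_i$, column $j\le m+1$ carries $y_j$. * $Z^{(+)}_{\mathrm{HT}}(2m+1;\mathbf x,\mathbf y)$ and $Z^{(-)}_{\mathrm{HT}}(2m+1;\mathbf x,\mathbf y)$ are the contributions to $Z_{\mathrm{HT}}(2m+1;\mathbf x,\mathbf y)$ of the states whose alternating-sign matrix has central entry $1$ and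 $-1$ respectively. **Theorem.** The rational functions $Z(m;\mathbf x',\mathbf y')$ and $Z(m+1;\mathbf x,\mathbf y)$ do not vanish identically, $Z_{\mathrm{HT}}(2m+1;\mathbf x,\mathbf y)=Z^{(+)}_{\mathrm{HT}}(2m+1;\mathbf x,\mathbf y)+Z^{(-)}_{\mathrm{HT}}(2m+1;\mathbf x,\mathbf y)$, and in $F(\mathbf x,\mathbf y)$ $$Z^{(+)}_{\mathrm{HT}}(2m+1;\mathbf x,\mathbf y)=\frac{(a+\bar a)\,Z(m+1;\mathbf x,\mathbf y)\,Z^{(2)}_{\mathrm{HT}}(2m;\mathbf x',\mathbf y')-(x_{m+1}\bar y_{m+1}+\bar x_{m+1}y_{m+1})\,Z(m;\mathbf x',\mathbf y')\,Z^{(2)}_{\mathrm{HT}}(2m+2;\mathbf x,\mathbf y)}{\sigma(a)\,\sigma(a\,x_{m+1}\bar y_{m+1})\,\sigma(a\,\bar x_{m+1}y_{m+1})},$$ $$Z^{(-)}_{\mathrm{HT}}(2m+1;\mathbf x,\mathbf y)=\frac{-(x_{m+1}\bar y_{m+1}+\bar x_{m+1}y_{m+1})\,Z(m+1;\mathbf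 x,\mathbf y)\,Z^{(2)}_{\mathrm{HT}}(2m;\mathbf x',\mathbf y')+(a+\bar a)\,Z(m;\mathbf x',\mathbf y')\,Z^{(2)}_{\mathrm{HT}}(2m+2;\mathbf x,\mathbf y)}{\sigma(a)\,\sigma(a\,x_{m+1}\bar y_{m+1})\,\sigma(a\,\bar x_{m+1}y_{m+1})}.$$ -/

import Mathlib

/-! ### Square ice on the `n × n` grid with domain wall boundary -/

/-- An orientation of all edges of the `n × n` square grid with univalent boundary vertices.
Rows are numbered from top to bottom and columns from left to right, starting from `0`.
`c.1 i j` is the `j`-th horizontal edge (from the left) of row `i`; it is `true` if it is oriented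
to the right. `c.2 i j` is the `i`-th vertical edge (from the top) of column `j`; it is `true` if
it is oriented upwards. -/
abbrev IceConfig (n : ℕ) : Type :=
  (Fin n → Fin (n + 1) → Bool) × (Fin (n + 1) → Fin n → Bool)

namespace IceConfig

variable {n : ℕ} (c : IceConfig n)

/-- The edge to the left of the vertex `(i, j)`; `true` means oriented to the right. -/
def left (i j : Fin n) : Bool := c.1 i j.castSucc

/-- The edge to the right of the vertex `(i, j)`; `true` means oriented to the right. -/
def right (i j : Fin n) : Bool := c.1 i j.succ

/-- The edge above the vertex `(i, j)`; `true` means oriented upwards. -/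
def top (i j : Fin n) : Bool := c.2 i.castSucc j

/-- The edge below the vertex `(i, j)`; `true` means oriented upwards. -/
def bottom (i j : Fin n) : Bool := c.2 i.succ j

/-- The number of edges that enter the vertex `(i, j)`. -/
def inDegree (i j : Fin n) : ℕ :=
  (c.left i j).toNat + (!(c.right i j)).toNat + (!(c.top i j)).toNat + (c.bottom i j).toNat

/-- A state of square ice with domain wall boundary: at every tetravalent vertex two edges
enter and two leave; the left and right boundary edges are oriented inwards, the upper and lower
boundary edges outwards. -/
def IsState : Prop :=
  (∀ i j, c.inDegree i j = 2) ∧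
  (∀ i, c.1 i 0 = true) ∧ (∀ i, c.1 i (Fin.last n) = false) ∧
  (∀ j, c.2 0 j = true) ∧ (∀ j, c.2 (Fin.last n) j = false)

/-- The state is invariant under the rotation of the grid by `180°` (which reverses the direction
of every arrow). -/
def IsHalfTurn : Prop :=
  (∀ i j, c.1 i.rev j.rev = !(c.1 i j)) ∧ (∀ i j, c.2 i.rev j.rev = !(c.2 i j))

/-- The alternating-sign matrix corresponding to a state: the entry is `1` if both horizontal
edges enter the vertex, `-1` if both horizontal edges leave it, and `0` otherwise. -/
def toMatrix : Matrix (Fin n) (Fin n) ℤ := fun i j =>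
  if c.left i j = true ∧ c.right i j = false then 1
  else if c.left i j = false ∧ c.right i j = true then -1
  else 0

end IceConfig

/-- Kuperberg's abbreviation `σ(z) = z - z⁻¹`. -/
def iceSigma {K : Type*} [Field K] (z : K) : K := z - z⁻¹

/-- The weight of the vertex `(i, j)` with spectral parameter `z`: `σ(a²)` if the entry of the
alternating-sign matrix is `1` or `-1`; for an entry `0` it is `σ(a z)` if the arrows go right and
up or left and down, and `σ(a z⁻¹)` if they go left and up or right and down. -/
def IceConfig.vertexWeight {n : ℕ} (c : IceConfig n) {K : Type*} [Field K] (a z : K)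
    (i j : Fin n) : K :=
  if c.left i j ≠ c.right i j then iceSigma (a ^ 2)
  else if c.left i j = c.top i j then iceSigma (a * z)
  else iceSigma (a * z⁻¹)

section PartitionFunctions

open scoped Classical

variable {K : Type*} [Field K] (a : K)

/-- The product of the weights of the vertices in `D`, where row `i` carries the
spectral parameter `x i` and column `j` carries `y j`. -/
noncomputable def IceConfig.weight {n : ℕ} (c : IceConfig n) (x y : Fin n → K)
    (D : Finset (Fin n × Fin n)) : K :=
  ∏ p ∈ D, c.vertexWeight a (x p.1 * (y p.2)⁻¹) p.1 p.2

/-- The partition function `Z(n; x, y)` of square ice with domain wall boundary. -/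
noncomputable def zDW (n : ℕ) (x y : Fin n → K) : K :=
  ∑ c : IceConfig n with c.IsState, c.weight a x y Finset.univ

/-- The rows (or columns) `r` and `r.rev` of an `n × n` half-turn symmetric state carry the same
spectral parameter, with number `min r r.rev` (counted from `0`). -/
def foldIndex {n k : ℕ} (h : n ≤ 2 * k) (r : Fin n) : Fin k :=
  ⟨min r.val r.rev.val, by simp only [Fin.val_rev]; omega⟩

/-- The vertices of the model for half-turn symmetric matrices of order `2m`: the left half. -/
def evenDomain (m : ℕ) : Finset (Fin (2 * m) × Fin (2 * m)) :=
  Finset.univ.filter fun p => p.2.val < m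

/-- The vertices of the model for half-turn symmetric matrices of order `2m+1`: all vertices of
the first `m` columns and those of the central column below the centre. -/
def oddDomain (m : ℕ) : Finset (Fin (2 * m + 1) × Fin (2 * m + 1)) :=
  Finset.univ.filter fun p => p.2.val < m ∨ (p.2.val = m ∧ m < p.1.val)

/-- The partition function `Z_HT(2m; x, y)`. -/
noncomputable def zHTEven (m : ℕ) (x y : Fin m → K) : K :=
  ∑ c : IceConfig (2 * m) with c.IsState ∧ c.IsHalfTurn,
    c.weight a (fun r => x (foldIndex le_rfl r)) (fun r => y (foldIndex le_rfl r)) (evenDomain m)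

/-- The second factor `Z_HT^{(2)}(2m; x, y)` of `Z_HT(2m; x, y) = Z(m; x, y) Z_HT^{(2)}(2m; x, y)`.
It is used only where `Z(m; x, y)` does not vanish. -/
noncomputable def zHTTwo (m : ℕ) (x y : Fin m → K) : K :=
  zHTEven a m x y / zDW a m x y

/-- The weight of a half-turn symmetric state of order `2m+1`. -/
noncomputable def oddWeight (m : ℕ) (x y : Fin (m + 1) → K) (c : IceConfig (2 * m + 1)) : K :=
  c.weight a (fun r => x (foldIndex (by omega) r)) (fun r => y (foldIndex (by omega) r))
    (oddDomain m)

/-- The partition function `Z_HT(2m+1; x, y)`. -/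
noncomputable def zHTOdd (m : ℕ) (x y : Fin (m + 1) → K) : K :=
  ∑ c : IceConfig (2 * m + 1) with c.IsState ∧ c.IsHalfTurn, oddWeight a m x y c

/-- The position of the centre in a row or column of length `2m+1`. -/
def centre (m : ℕ) : Fin (2 * m + 1) := ⟨m, by omega⟩

/-- The contribution to `Z_HT(2m+1; x, y)` of the states whose alternating-sign matrix has the
central entry `ε`. -/
noncomputable def zHTOddCentral (ε : ℤ) (m : ℕ) (x y : Fin (m + 1) → K) : K :=
  ∑ c : IceConfig (2 * m + 1) with
    c.IsState ∧ c.IsHalfTurn ∧ c.toMatrix (centre m) (centre m) = ε, oddWeight a m x y c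

end PartitionFunctions

section Generic

variable (F : Type*) [Field F]

/-- The field of rational functions over `F` in the `2k` independent spectral parameters
`x_1, …, x_k, y_1, …, y_k`. -/
abbrev SpectralField (k : ℕ) : Type _ := FractionRing (MvPolynomial (Fin k ⊕ Fin k) F)

/-- The indeterminates `x_1, …, x_k`. -/
noncomputable def xVar (k : ℕ) (i : Fin k) : SpectralField F k :=
  algebraMap (MvPolynomial (Fin k ⊕ Fin k) F) _ (MvPolynomial.X (Sum.inl i))

/-- The indeterminates `y_1, …, y_k`. -/
noncomputable def yVar (k : ℕ) (j : Fin k) : SpectralField F k :=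
  algebraMap (MvPolynomial (Fin k ⊕ Fin k) F) _ (MvPolynomial.X (Sum.inr j))

variable {F} in
/-- The parameter `a ∈ F`, regarded as a constant rational function. -/
noncomputable def constParam (k : ℕ) (a : F) : SpectralField F k :=
  algebraMap (MvPolynomial (Fin k ⊕ Fin k) F) _ (MvPolynomial.C a)

end Generic

/-! Write u, v for the last row and column parameters and Z⁺, Z⁻ for the contributions of the
central entries 1 and -1. They are obtained from two linear equations, σ(a) ((a + a⁻¹) Z⁺ + (u/v +
v/u) Z⁻) = Z(m+1; x, y) Z_HT^(2)(2m; x', y'), σ(a) ((u/v + v/u) Z⁺ + (a + a⁻¹) Z⁻) = Z(m; x', y')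
Z_HT^(2)(2m+2; x, y). The determinant (a + a⁻¹)² - (u/v + v/u)² of the system is σ(a u/v) σ(a v/u),
so the theorem is Cramer's rule. The equations are `oddDefect_eq_zero` and `oddDefect'_eq_zero`.
There Z_HT^(2) appears as `htDet` divided by `sigmaVandermonde`, Kuperberg's determinant of the
entries 1/σ(a z) + 1/σ(a z⁻¹) with the denominators of each row cleared;
`zHTEven_mul_sigmaVandermonde` justifies this.

All three identities are proved by interpolation. Multiplying about half of the parameters by t
makes the difference of the two sides a Laurent polynomial in t of bounded width, and it vanishes at
more points than this width allows (`eq_zero_of_laurent_of_zeros`). The zeros have three sources.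

Corner: if x_1 = ± a⁻¹ y_1, the corner vertex must have the entry 1, its row and column (with their
images under the half-turn) freeze, and every term becomes an explicit product times the same term
with one pair of parameters fewer; induction applies. The Yang–Baxter equation makes the partition
functions symmetric in the row parameters, transposition gives the same for the columns, and
reflection gives invariance under inversion of all parameters; so one corner yields all x_i = ±
a^{±1} y_j.

Central line: in odd order the left half of the central row is a line that turns up into the central
column, with the value of the edge at the turn recording the central entry. If u = a v, the crossing
of a row with the central column is itself the intertwiner of the row and the line, so by
Yang–Baxter the line slides out through the top and leaves Z_HT(2m) (`zHTOddTurn_of_eq_mul`). For u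
= -a v the contribution of Z⁻ changes sign relative to Z⁺. The coefficients a + a⁻¹ and u/v + v/u
agree up to exactly this sign on these lines, so both combinations can be evaluated there.

Coincidence: for x_i = ± u or y_j = ± v the determinant and the Vandermonde product in the second
equation vanish.

In the odd identities the scale multiplies x_1, …, x_m and v, but neither u nor the other y_j. This
keeps x_i/v and u/y_j constant, and the number of zeros then exceeds the width by one. -/

/-! ### The six-vertex weight and the Yang–Baxter equation -/

section RowTransfer

variable {K : Type*} [Field K]

/-- The weight of a vertex with spectral parameter `z` whose left, right, top and bottom edges
are `l`, `r`, `t`, `b`; it is `0` unless two edges enter and two leave. -/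
def iceWeight (a z : K) (l r t b : Bool) : K :=
  if l.toNat + (!r).toNat + (!t).toNat + b.toNat = 2 then
    if l ≠ r then iceSigma (a ^ 2)
    else if l = t then iceSigma (a * z) else iceSigma (a * z⁻¹)
  else 0

theorem iceWeight_eq (a z : K) (l r t b : Bool) : iceWeight a z l r t b =
    match l, r, t, b with
    | true, false, true, false => iceSigma (a ^ 2)
    | false, true, false, true => iceSigma (a ^ 2)
    | true, true, true, true => iceSigma (a * z)
    | false, false, false, false => iceSigma (a * z)
    | true, true, false, false => iceSigma (a * z⁻¹)
    | false, false, true, true => iceSigma (a * z⁻¹)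
    | _, _, _, _ => 0 := by
  cases l <;> cases r <;> cases t <;> cases b <;> simp [iceWeight]

/-- The intertwiner is an ice weight again: the lines with parameters x and u enter it from the left
and from below. Its parameter `a * x * u⁻¹` does not involve y, so it can be carried through any
number of columns. For each choice of the six outer edges this is an identity of rational functions.
-/
theorem ice_yang_baxter {a x u y : K} (ha : a ≠ 0) (hx : x ≠ 0) (hu : u ≠ 0) (hy : y ≠ 0)
    (l l' t b' p g : Bool) :
    ∑ f : Bool, ∑ e : Bool, ∑ b : Bool,
      iceWeight a (x * y⁻¹) l f t b * iceWeight a (u * y⁻¹) l' e b b' *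
        iceWeight a (a * x * u⁻¹) f g p e =
    ∑ k : Bool, ∑ k' : Bool, ∑ b : Bool,
      iceWeight a (a * x * u⁻¹) l k' k l' * (iceWeight a (u * y⁻¹) k p t b *
        iceWeight a (x * y⁻¹) k' g b b') := by
  cases l <;> cases l' <;> cases t <;> cases b' <;> cases p <;> cases g <;>
    simp only [iceWeight_eq, Fintype.sum_bool, mul_zero, zero_mul, add_zero, zero_add] <;>
    simp only [iceSigma] <;> field_simp <;> ring

/-- The row transfer operator. Its matrix element between the bit strings `t` (the vertical edges
above the row) and `s` (those below) is the weight of a row with spectral parameter `x`, column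
parameters `Y`, left edge `l` and right edge `r`, summed over the inner horizontal edges. -/
def rowAct (a x : K) : Bool → Bool → List K → (List Bool → K) → List Bool → K
  | l, r, [], Ψ, [] => if l = r then Ψ [] else 0
  | l, r, y :: Y, Ψ, t :: ts => ∑ f : Bool, ∑ b : Bool,
      iceWeight a (x * y⁻¹) l f t b * rowAct a x f r Y (fun s => Ψ (b :: s)) ts
  | _, _, [], _, _ :: _ => 0
  | _, _, _ :: _, _, [] => 0

/-- The transfer operator of a line with spectral parameter `u` that crosses the columns `Y`
from the left and then turns up; the turn has weight `κ`. -/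
def lineAct (a u : K) (κ : Bool → K) : Bool → List K → (List Bool → K) → List Bool → K
  | l, [], χ, c :: s => if l = c then κ c * χ s else 0
  | l, y :: Y, χ, t :: ts => ∑ f : Bool, ∑ b : Bool,
      iceWeight a (u * y⁻¹) l f t b * lineAct a u κ f Y (fun s => χ (b :: s)) ts
  | _, _, _, [] => 0

theorem rowAct_add (a x : K) (l r : Bool) (Y : List K) (Φ Ψ : List Bool → K) (t : List Bool) :
    rowAct a x l r Y (fun s => Φ s + Ψ s) t = rowAct a x l r Y Φ t + rowAct a x l r Y Ψ t := by
  induction Y generalizing l Φ Ψ t with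
  | nil => cases t <;> simp only [rowAct] <;> (try split_ifs) <;> simp
  | cons y Y ih =>
    cases t with
    | nil => simp [rowAct]
    | cons t ts => simp only [rowAct, ih, Fintype.sum_bool]; ring

theorem rowAct_smul (a x : K) (l r : Bool) (Y : List K) (c : K) (Ψ : List Bool → K)
    (t : List Bool) :
    rowAct a x l r Y (fun s => c * Ψ s) t = c * rowAct a x l r Y Ψ t := by
  induction Y generalizing l Ψ t with
  | nil => cases t <;> simp only [rowAct] <;> (try split_ifs) <;> simp
  | cons y Y ih =>
    cases t with
    | nil => simp [rowAct]
    | cons t ts => simp only [rowAct, ih, Fintype.sum_bool]; ring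

theorem lineAct_add (a u : K) (κ : Bool → K) (l : Bool) (Y : List K) (Φ Ψ : List Bool → K)
    (t : List Bool) :
    lineAct a u κ l Y (fun s => Φ s + Ψ s) t = lineAct a u κ l Y Φ t + lineAct a u κ l Y Ψ t := by
  induction Y generalizing l Φ Ψ t with
  | nil => cases t <;> simp only [lineAct] <;> (try split_ifs) <;> simp [mul_add]
  | cons y Y ih =>
    cases t with
    | nil => simp [lineAct]
    | cons t ts => simp only [lineAct, ih, Fintype.sum_bool]; ring

theorem lineAct_smul (a u : K) (κ : Bool → K) (l : Bool) (Y : List K) (c : K)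
    (Ψ : List Bool → K) (t : List Bool) :
    lineAct a u κ l Y (fun s => c * Ψ s) t = c * lineAct a u κ l Y Ψ t := by
  induction Y generalizing l Ψ t with
  | nil => cases t <;> simp only [lineAct] <;> (try split_ifs) <;> simp [mul_left_comm]
  | cons y Y ih =>
    cases t with
    | nil => simp [lineAct]
    | cons t ts => simp only [lineAct, ih, Fintype.sum_bool]; ring

/-- The Yang–Baxter equation for two rows. -/
theorem rowAct_rowAct {a x u : K} (ha : a ≠ 0) (hx : x ≠ 0) (hu : u ≠ 0) (Y : List K)
    (hY : ∀ y ∈ Y, y ≠ 0) (l l' p g : Bool) (Ψ : List Bool → K) (t : List Bool) :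
    ∑ f : Bool, ∑ e : Bool, iceWeight a (a * x * u⁻¹) f g p e *
        rowAct a x l f Y (rowAct a u l' e Y Ψ) t =
    ∑ k : Bool, ∑ k' : Bool, iceWeight a (a * x * u⁻¹) l k' k l' *
        rowAct a u k p Y (rowAct a x k' g Y Ψ) t := by
  induction Y generalizing l l' Ψ t with
  | nil =>
    cases t with
    | nil => simp only [rowAct]; cases l <;> cases l' <;> cases p <;> cases g <;> simp
    | cons t ts => simp [rowAct]
  | cons y Y ih =>
    cases t with
    | nil => simp [rowAct]
    | cons t ts =>
      have hy : y ≠ 0 := hY y (by simp)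
      have ih' := fun l l' Ψ => ih (fun z hz => hY z (by simp [hz])) l l' Ψ ts
      calc _ = ∑ f₁ : Bool, ∑ e₁ : Bool, ∑ b : Bool, ∑ b' : Bool,
                iceWeight a (x * y⁻¹) l f₁ t b * iceWeight a (u * y⁻¹) l' e₁ b b' *
                ∑ f : Bool, ∑ e : Bool, iceWeight a (a * x * u⁻¹) f g p e *
                  rowAct a x f₁ f Y (rowAct a u e₁ e Y (fun s => Ψ (b' :: s))) ts := by
              simp only [rowAct, rowAct_add, rowAct_smul, Fintype.sum_bool]; ring
        _ = ∑ b' : Bool, ∑ k : Bool, ∑ k' : Bool,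
              (∑ f : Bool, ∑ e : Bool, ∑ b : Bool,
                iceWeight a (x * y⁻¹) l f t b * iceWeight a (u * y⁻¹) l' e b b' *
                  iceWeight a (a * x * u⁻¹) f k' k e) *
              rowAct a u k p Y (rowAct a x k' g Y (fun s => Ψ (b' :: s))) ts := by
              simp only [ih']; simp only [Fintype.sum_bool]; ring
        _ = _ := by
              simp only [ice_yang_baxter ha hx hu hy]
              simp only [rowAct, rowAct_add, rowAct_smul, Fintype.sum_bool]; ring

/-- The Yang–Baxter equation for a row and a turning line. -/
theorem rowAct_lineAct {a x u v : K} (ha : a ≠ 0) (hx : x ≠ 0) (hu : u ≠ 0)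
    (huv : u = a * v) (Y Y' : List K) (hY : ∀ y ∈ Y, y ≠ 0) (l l' r : Bool)
    (χ : List Bool → K) (t : List Bool) :
    rowAct a x l r (Y ++ v :: Y') (lineAct a u 1 l' Y χ) t =
    ∑ k : Bool, ∑ k' : Bool, iceWeight a (a * x * u⁻¹) l k' k l' *
        lineAct a u 1 k Y (rowAct a x k' r (Y ++ Y') χ) t := by
  -- This is the only use of u = a v: the vertex where the row crosses the column v, which is the
  -- vertical part of the turned line, has the parameter of the intertwiner. The case of no columns
  -- is therefore immediate, and Yang–Baxter moves the crossing to the left end.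
  have hxv : x * v⁻¹ = a * x * u⁻¹ := by subst huv; field_simp
  induction Y generalizing l l' χ t with
  | nil =>
    cases t with
    | nil => simp [rowAct, lineAct]
    | cons t ts =>
      have h0 : ∀ f : Bool, rowAct a x f r Y' (fun _ => 0) ts = 0 := fun f => by
        simpa using rowAct_smul a x f r Y' 0 (fun _ => 0) ts
      simp only [List.nil_append, rowAct, lineAct, hxv]
      cases l' <;> cases t <;> simp [h0]
  | cons y Y ih =>
    cases t with
    | nil => simp [rowAct, lineAct]
    | cons t ts =>
      have hy : y ≠ 0 := hY y (by simp)
      have ih' := fun l l' Ψ => ih (fun z hz => hY z (by simp [hz])) l l' Ψ ts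
      calc _ = ∑ f₁ : Bool, ∑ e₁ : Bool, ∑ b : Bool, ∑ b' : Bool,
                iceWeight a (x * y⁻¹) l f₁ t b * iceWeight a (u * y⁻¹) l' e₁ b b' *
                  rowAct a x f₁ r (Y ++ v :: Y')
                    (lineAct a u 1 e₁ Y (fun s => χ (b' :: s))) ts := by
              simp only [List.cons_append, rowAct, lineAct, rowAct_add, rowAct_smul,
                Fintype.sum_bool]; ring
        _ = ∑ b' : Bool, ∑ k : Bool, ∑ k' : Bool,
              (∑ f : Bool, ∑ e : Bool, ∑ b : Bool,
                iceWeight a (x * y⁻¹) l f t b * iceWeight a (u * y⁻¹) l' e b b' *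
                  iceWeight a (a * x * u⁻¹) f k' k e) *
              lineAct a u 1 k Y (rowAct a x k' r (Y ++ Y') (fun s => χ (b' :: s))) ts := by
              simp only [ih']; simp only [Fintype.sum_bool]; ring
        _ = _ := by
              simp only [ice_yang_baxter ha hx hu hy]
              simp only [List.cons_append, rowAct, lineAct, lineAct_add, lineAct_smul,
                Fintype.sum_bool]; ring

end RowTransfer

/-! ### Products of row operators and their commutation -/

section RowProducts

variable {K : Type*} [Field K]

theorem rowAct_congr (a x : K) (l r : Bool) (Y : List K) {Φ Ψ : List Bool → K}
    (h : ∀ s, s.length = Y.length → Φ s = Ψ s) (t : List Bool) :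
    rowAct a x l r Y Φ t = rowAct a x l r Y Ψ t := by
  induction Y generalizing l Φ Ψ t with
  | nil => cases t <;> simp [rowAct, h]
  | cons y Y ih =>
    cases t with
    | nil => simp [rowAct]
    | cons t ts =>
      simp only [rowAct]
      refine Finset.sum_congr rfl fun f _ => Finset.sum_congr rfl fun b _ => ?_
      rw [ih f (Φ := fun s => Φ (b :: s)) (Ψ := fun s => Ψ (b :: s))]
      exact fun s hs => h _ (by simp [hs])

theorem lineAct_zero (a u : K) (κ : Bool → K) (l : Bool) (Y : List K) (t : List Bool) :
    lineAct a u κ l Y (fun _ => 0) t = 0 := by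
  simpa using lineAct_smul a u κ l Y 0 (fun _ => 0) t

/-- The product of the transfer operators of rows with parameters `xs` and the boundary
conditions `true`, `false` at the left and at the right. -/
def rowFold (a : K) (xs Y : List K) (Ψ : List Bool → K) : List Bool → K :=
  xs.foldr (fun x Φ => rowAct a x true false Y Φ) Ψ

@[simp] theorem rowFold_nil (a : K) (Y : List K) (Ψ : List Bool → K) :
    rowFold a [] Y Ψ = Ψ := rfl

@[simp] theorem rowFold_cons (a x : K) (xs Y : List K) (Ψ : List Bool → K) :
    rowFold a (x :: xs) Y Ψ = rowAct a x true false Y (rowFold a xs Y Ψ) := rfl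

theorem rowFold_congr (a : K) (xs Y : List K) {Φ Ψ : List Bool → K}
    (h : ∀ s, s.length = Y.length → Φ s = Ψ s) (t : List Bool) (ht : t.length = Y.length) :
    rowFold a xs Y Φ t = rowFold a xs Y Ψ t := by
  induction xs generalizing t with
  | nil => exact h t ht
  | cons x xs ih => exact rowAct_congr _ _ _ _ _ (fun s hs => ih s hs) t

theorem rowFold_smul (a : K) (xs Y : List K) (c : K) (Ψ : List Bool → K) (t : List Bool) :
    rowFold a xs Y (fun s => c * Ψ s) t = c * rowFold a xs Y Ψ t := by
  induction xs generalizing t with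
  | nil => rfl
  | cons x xs ih =>
    rw [rowFold_cons, rowFold_cons, ← rowAct_smul]
    exact rowAct_congr _ _ _ _ _ (fun s _ => ih s) t

/-- When both left edges are `true` and both right edges `false`, the ice rule leaves one
configuration of the intertwiner at either end, with the same weight σ(a · (a x u⁻¹)) on both sides,
and this factor cancels if it is not zero. -/
theorem rowAct_comm {a x u : K} (ha : a ≠ 0) (hx : x ≠ 0) (hu : u ≠ 0) (Y : List K)
    (hY : ∀ y ∈ Y, y ≠ 0) (h : iceSigma (a * (a * x * u⁻¹)) ≠ 0) (Ψ : List Bool → K) :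
    rowAct a x true false Y (rowAct a u true false Y Ψ) =
      rowAct a u true false Y (rowAct a x true false Y Ψ) := by
  funext t
  have := rowAct_rowAct ha hx hu Y hY true true false false Ψ t
  simp only [Fintype.sum_bool, iceWeight_eq, zero_mul, zero_add, add_zero] at this
  exact mul_left_cancel₀ h this

theorem rowFold_perm {a : K} (ha : a ≠ 0) (Y : List K) (hY : ∀ y ∈ Y, y ≠ 0) {xs xs' : List K}
    (hxs : ∀ x ∈ xs, x ≠ 0)
    (h : xs.Pairwise fun x u => iceSigma (a * (a * x * u⁻¹)) ≠ 0) (hp : xs.Perm xs')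
    (Ψ : List Bool → K) : rowFold a xs Y Ψ = rowFold a xs' Y Ψ := by
  -- In the monoid of endomorphisms the fold is a product of pairwise commuting factors, which may
  -- be permuted.
  have key : ∀ zs : List K, ((zs.map fun x =>
      (show Function.End (List Bool → K) from rowAct a x true false Y)).prod) Ψ =
      rowFold a zs Y Ψ := by
    intro zs
    induction zs with
    | nil => rfl
    | cons z zs ih => rw [List.map_cons, List.prod_cons, rowFold_cons, ← ih]; rfl
  rw [← key, ← key]
  refine congrFun (List.Perm.prod_eq' (M := Function.End (List Bool → K)) (hp.map _)
    (List.pairwise_map.2 ?_)) Ψ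
  refine List.Pairwise.imp_of_mem (fun {x u} hx hu hxu => ?_) h
  funext Φ
  exact rowAct_comm ha (hxs x hx) (hxs u hu) Y hY hxu Φ

/-! ### Frozen rows and columns -/

/-- A left edge `false` and a top edge `true` leave only the vertex whose right edge is `false` and
whose bottom edge is `true`, so both lines go straight through along the whole row. -/
theorem rowAct_false_replicate (a x : K) (Y : List K) (Ψ : List Bool → K) :
    rowAct a x false false Y Ψ (List.replicate Y.length true) =
      (Y.map fun y => iceSigma (a * (x * y⁻¹)⁻¹)).prod * Ψ (List.replicate Y.length true) := by
  induction Y generalizing Ψ with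
  | nil => simp [rowAct]
  | cons y Y ih =>
    simp only [List.length_cons, List.replicate_succ, rowAct, Fintype.sum_bool, iceWeight_eq, ih,
      List.map_cons, List.prod_cons]
    ring

/-- A left edge `true` and a top edge `false` likewise leave only one vertex, and both lines pass
straight through it. -/
theorem rowAct_true_cons_false (a x y : K) (r : Bool) (Y : List K) (Ψ : List Bool → K)
    (t : List Bool) : rowAct a x true r (y :: Y) Ψ (false :: t) =
      iceSigma (a * (x * y⁻¹)⁻¹) * rowAct a x true r Y (fun s => Ψ (false :: s)) t := by
  simp only [rowAct, Fintype.sum_bool, iceWeight_eq]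
  ring

theorem lineAct_true_cons_false (a u y : K) (κ : Bool → K) (Y : List K) (χ : List Bool → K)
    (t : List Bool) : lineAct a u κ true (y :: Y) χ (false :: t) =
      iceSigma (a * (u * y⁻¹)⁻¹) * lineAct a u κ true Y (fun s => χ (false :: s)) t := by
  simp only [lineAct, Fintype.sum_bool, iceWeight_eq]
  ring

theorem rowFold_cons_false (a y : K) (xs Y : List K) (Ψ : List Bool → K) (t : List Bool) :
    rowFold a xs (y :: Y) Ψ (false :: t) =
      (xs.map fun x => iceSigma (a * (x * y⁻¹)⁻¹)).prod *
        rowFold a xs Y (fun s => Ψ (false :: s)) t := by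
  induction xs generalizing t with
  | nil => simp
  | cons x xs ih =>
    rw [rowFold_cons, rowAct_true_cons_false]
    simp only [ih, rowAct_smul, rowFold_cons, List.map_cons, List.prod_cons]
    ring

/-- With left and top edges `true` the corner either lets both lines pass, with weight σ(a z) = 0,
or has the entry 1. Hence it has the entry 1; the rest of its row then starts with `false` under
edges `true`, the rest of its column has edges `false` and left edges `true`, and both are frozen.
-/
theorem rowFold_freeze_left (a x y : K) (xs Y : List K) (Ψ : List Bool → K)
    (h : iceSigma (a * (x * y⁻¹)) = 0) :
    rowFold a (x :: xs) (y :: Y) Ψ (List.replicate (Y.length + 1) true) =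
      iceSigma (a ^ 2) * (Y.map fun z => iceSigma (a * (x * z⁻¹)⁻¹)).prod *
        (xs.map fun z => iceSigma (a * (z * y⁻¹)⁻¹)).prod *
        rowFold a xs Y (fun s => Ψ (false :: s)) (List.replicate Y.length true) := by
  rw [rowFold_cons, List.replicate_succ, rowAct]
  simp only [Fintype.sum_bool, iceWeight_eq, h, rowAct_false_replicate, rowFold_cons_false]
  ring

/-- The hypothesis forces the lower edge of the last column to be `true`, and the right boundary
edge is `false`. The only such vertex has left edge `false` and top edge `true`. This is how the
last column freezes when the half-turn pairs it with a frozen first column. -/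
theorem rowAct_append_singleton (a x y : K) (l : Bool) (Y : List K) (Ψ : List Bool → K)
    (hΨ : ∀ s, s.length = Y.length → Ψ (s ++ [false]) = 0) (t : List Bool) (c : Bool)
    (ht : t.length = Y.length) :
    rowAct a x l false (Y ++ [y]) Ψ (t ++ [c]) =
      if c = true then iceSigma (a * (x * y⁻¹)⁻¹) *
        rowAct a x l false Y (fun s => Ψ (s ++ [true])) t else 0 := by
  induction Y generalizing l Ψ t with
  | nil =>
    obtain rfl := List.length_eq_zero_iff.1 ht
    have h0 : Ψ [false] = 0 := by simpa using hΨ [] rfl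
    cases l <;> cases c <;> simp [rowAct, iceWeight_eq, h0]
  | cons z Y ih =>
    cases t with
    | nil => simp at ht
    | cons t ts =>
      have hts : ts.length = Y.length := by simpa using ht
      have hb : ∀ b s, s.length = Y.length → Ψ (b :: (s ++ [false])) = 0 := fun b s hs =>
        hΨ (b :: s) (by simp [hs])
      simp only [List.cons_append, rowAct]
      have := fun f b => ih f (fun s => Ψ (b :: s)) (hb b) ts hts
      simp only [this]
      split_ifs
      · simp only [Fintype.sum_bool]; ring
      · simp

theorem rowFold_append_singleton (a y : K) (xs Y : List K) (Ψ : List Bool → K)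
    (hΨ : ∀ s, s.length = Y.length → Ψ (s ++ [false]) = 0) (t : List Bool) (c : Bool)
    (ht : t.length = Y.length) :
    rowFold a xs (Y ++ [y]) Ψ (t ++ [c]) =
      if c = true then (xs.map fun x => iceSigma (a * (x * y⁻¹)⁻¹)).prod *
        rowFold a xs Y (fun s => Ψ (s ++ [true])) t else 0 := by
  induction xs generalizing t c with
  | nil => cases c <;> simp [hΨ t ht]
  | cons x xs ih =>
    rw [rowFold_cons, rowAct_append_singleton _ _ _ _ _ _ _ _ _ ht]
    · split_ifs
      · rw [List.map_cons, List.prod_cons, rowFold_cons, mul_assoc]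
        congr 1
        rw [← rowAct_smul]
        exact rowAct_congr _ _ _ _ _ (fun s hs => by rw [ih s true hs, if_pos rfl]) t
      · rfl
    · intro s hs
      rw [ih s false hs]; simp

theorem lineAct_append (a u : K) (κ : Bool → K) (l : Bool) (Y : List K) (χ : List Bool → K)
    (t s : List Bool) (ht : Y.length < t.length) :
    lineAct a u κ l Y χ (t ++ s) = lineAct a u κ l Y (fun r => χ (r ++ s)) t := by
  induction Y generalizing l χ t with
  | nil =>
    cases t with
    | nil => simp at ht
    | cons c t => simp [lineAct]
  | cons y Y ih =>
    cases t with
    | nil => simp at ht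
    | cons c t =>
      simp only [List.cons_append, lineAct]
      have := fun f b => ih f (fun s => χ (b :: s)) t (by simpa using ht)
      simp only [this]

/-! ### The turning line -/

/-- Each row is pulled past the turning line. Afterwards they cross at the left boundary, where the
incoming edges of both are `true`; this crossing is frozen and contributes σ(a x v⁻¹). -/
theorem rowFold_lineAct {a u v : K} (ha : a ≠ 0) (hu : u ≠ 0) (huv : u = a * v)
    (xs Y Y' : List K) (hxs : ∀ x ∈ xs, x ≠ 0) (hY : ∀ y ∈ Y, y ≠ 0) (χ : List Bool → K)
    (t : List Bool) :
    rowFold a xs (Y ++ v :: Y') (lineAct a u 1 true Y χ) t =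
      (xs.map fun x => iceSigma (a * (x * v⁻¹))).prod *
        lineAct a u 1 true Y (rowFold a xs (Y ++ Y') χ) t := by
  induction xs generalizing t with
  | nil => simp
  | cons x xs ih =>
    have hx : x ≠ 0 := hxs x (by simp)
    have ih' := ih (fun z hz => hxs z (by simp [hz]))
    rw [rowFold_cons, funext ih', rowAct_smul, rowAct_lineAct ha hx hu huv _ _ hY,
      List.map_cons, List.prod_cons, rowFold_cons,
      show x * v⁻¹ = a * x * u⁻¹ by subst huv; field_simp]
    simp only [Fintype.sum_bool, iceWeight_eq]
    ring

theorem lineAct_false_replicate (a u : K) (κ : Bool → K) (Y : List K) (χ : List Bool → K)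
    (s : List Bool) :
    lineAct a u κ false Y χ (List.replicate (Y.length + 1) true ++ s) = 0 := by
  induction Y generalizing χ with
  | nil => simp [lineAct]
  | cons y Y ih =>
    rw [List.length_cons, List.replicate_succ, List.cons_append, lineAct]
    simp [iceWeight_eq, ih]

/-- Under edges `true`, a line that has become `false` stays `false` and cannot turn into the edge
`true` at its end. So the line stays `true` throughout. -/
theorem lineAct_true_replicate (a u : K) (κ : Bool → K) (Y : List K) (χ : List Bool → K)
    (s : List Bool) :
    lineAct a u κ true Y χ (List.replicate (Y.length + 1) true ++ s) =
      κ true * (Y.map fun y => iceSigma (a * (u * y⁻¹))).prod *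
        χ (List.replicate Y.length true ++ s) := by
  induction Y generalizing χ with
  | nil => simp [lineAct]
  | cons y Y ih =>
    rw [List.length_cons, List.replicate_succ, List.cons_append, lineAct]
    simp only [Fintype.sum_bool, ih, lineAct_false_replicate]
    simp only [iceWeight_eq, List.map_cons, List.prod_cons, List.replicate_succ, List.cons_append]
    ring

theorem iceSigma_neg (z : K) : iceSigma (-z) = -iceSigma z := by
  simp [iceSigma, inv_neg]; ring

/-- The weights of entries 0 are odd in u, those of entries ± 1 do not contain u. The latter sit
exactly where the line changes its value, so the parity of their number is read off from the first
edge and the edge at the turn; the sign of the last edge is absorbed in the turn weight. -/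
theorem lineAct_neg (a u : K) (κ : Bool → K) (l : Bool) (Y : List K) (χ : List Bool → K)
    (t : List Bool) :
    lineAct a (-u) κ l Y χ t = (-1) ^ Y.length * (if l = true then 1 else -1) *
      lineAct a u (fun c => (if c = true then 1 else -1) * κ c) l Y χ t := by
  induction Y generalizing l χ t with
  | nil =>
    cases t with
    | nil => simp [lineAct]
    | cons c t => cases l <;> cases c <;> simp [lineAct]
  | cons y Y ih =>
    cases t with
    | nil => simp [lineAct]
    | cons c t =>
      simp only [lineAct, ih, Fintype.sum_bool, List.length_cons, pow_succ]
      cases l <;> cases c <;>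
        simp [iceWeight_eq, neg_mul, mul_neg, inv_neg, iceSigma_neg] <;> ring

end RowProducts

namespace IceConfig

variable {n : ℕ}

/-! ### Half-turn symmetric states -/

section HalfTurn

variable {c : IceConfig n}

theorem IsHalfTurn.left_rev (h : c.IsHalfTurn) (i j : Fin n) :
    c.left i.rev j.rev = !(c.right i j) := by
  rw [left, right, ← Fin.rev_succ, h.1]

theorem IsHalfTurn.right_rev (h : c.IsHalfTurn) (i j : Fin n) :
    c.right i.rev j.rev = !(c.left i j) := by
  rw [left, right, ← Fin.rev_castSucc, h.1]

theorem IsHalfTurn.top_rev (h : c.IsHalfTurn) (i j : Fin n) :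
    c.top i.rev j.rev = !(c.bottom i j) := by
  rw [top, bottom, ← Fin.rev_succ, h.2]

theorem IsHalfTurn.bottom_rev (h : c.IsHalfTurn) (i j : Fin n) :
    c.bottom i.rev j.rev = !(c.top i j) := by
  rw [top, bottom, ← Fin.rev_castSucc, h.2]

theorem IsHalfTurn.inDegree_rev (h : c.IsHalfTurn) (i j : Fin n) :
    c.inDegree i.rev j.rev = c.inDegree i j := by
  rw [inDegree, inDegree, h.left_rev, h.right_rev, h.top_rev, h.bottom_rev]
  simp only [Bool.not_not]
  omega

theorem left_eq_top_iff {i j : Fin n} (h : c.inDegree i j = 2) (hlr : c.left i j = c.right i j) :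
    (c.left i j = c.top i j) ↔ (c.right i j = c.bottom i j) := by
  rw [inDegree] at h
  revert h hlr
  cases c.left i j <;> cases c.right i j <;> cases c.top i j <;> cases c.bottom i j <;> decide

theorem IsHalfTurn.vertexWeight_rev {K : Type*} [Field K] (h : c.IsHalfTurn) (a z : K)
    {i j : Fin n} (hc : c.inDegree i j = 2) :
    c.vertexWeight a z i.rev j.rev = c.vertexWeight a z i j := by
  have := left_eq_top_iff hc
  rw [vertexWeight, vertexWeight, h.left_rev, h.right_rev, h.top_rev]
  revert this
  cases c.left i j <;> cases c.right i j <;> cases c.top i j <;> cases c.bottom i j <;> simp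

/-- Two fundamental domains of the half-turn give the same weight. -/
theorem IsHalfTurn.weight_eq {K : Type*} [Field K] (h : c.IsHalfTurn) (hc : c.IsState) (a : K)
    {x y : Fin n → K} (hx : ∀ i, x i.rev = x i) (hy : ∀ j, y j.rev = y j)
    {D D' : Finset (Fin n × Fin n)} (hD : ∀ i j, (i, j) ∈ D → (i.rev, j.rev) ∉ D)
    (hD' : ∀ i j, (i, j) ∈ D' → (i.rev, j.rev) ∉ D')
    (hDD' : ∀ i j, (i, j) ∈ D ∨ (i.rev, j.rev) ∈ D ↔ (i, j) ∈ D' ∨ (i.rev, j.rev) ∈ D') :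
    c.weight a x y D = c.weight a x y D' := by
  -- An orbit of the half-turn that meets one domain meets both, each in a single vertex: a vertex
  -- is kept if it lies in the other domain and rotated otherwise. The hypotheses exclude a fixed
  -- vertex from both.
  refine Finset.prod_bij' (fun p _ => if p ∈ D' then p else (p.1.rev, p.2.rev))
    (fun p _ => if p ∈ D then p else (p.1.rev, p.2.rev)) ?_ ?_ ?_ ?_ ?_
  · rintro ⟨i, j⟩ hp
    split_ifs with h1
    · exact h1
    · exact ((hDD' i j).1 (Or.inl hp)).resolve_left h1
  · rintro ⟨i, j⟩ hp
    split_ifs with h1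
    · exact h1
    · exact ((hDD' i j).2 (Or.inl hp)).resolve_left h1
  · rintro ⟨i, j⟩ hp
    dsimp only
    by_cases h1 : (i, j) ∈ D'
    · simp [h1, hp]
    · simp [h1, hD i j hp]
  · rintro ⟨i, j⟩ hp
    dsimp only
    by_cases h1 : (i, j) ∈ D
    · simp [h1, hp]
    · simp [h1, hD' i j hp]
  · rintro ⟨i, j⟩ hp
    split_ifs
    · rfl
    · dsimp only
      rw [h.vertexWeight_rev _ _ (hc.1 i j), hx, hy]

/-- A half-turn symmetric configuration is a state if the conditions hold on one half. -/
theorem IsHalfTurn.isState_iff (h : c.IsHalfTurn) {P : Fin n → Fin n → Prop}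
    (hP : ∀ i j, P i j ∨ P i.rev j.rev) :
    c.IsState ↔ (∀ i j, P i j → c.inDegree i j = 2) ∧ (∀ i, c.1 i 0 = true) ∧
      (∀ j, c.2 0 j = true) := by
  constructor
  · exact fun hc => ⟨fun i j _ => hc.1 i j, hc.2.1, hc.2.2.2.1⟩
  · rintro ⟨h1, h2, h3⟩
    refine ⟨fun i j => ?_, h2, fun i => ?_, h3, fun j => ?_⟩
    · rcases hP i j with hp | hp
      · exact h1 i j hp
      · rw [← h.inDegree_rev]; exact h1 _ _ hp
    · have := h.1 i.rev 0
      rw [Fin.rev_rev, Fin.rev_zero, h2] at this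
      exact this
    · have := h.2 0 j.rev
      rw [Fin.rev_rev, Fin.rev_zero, h3] at this
      exact this

end HalfTurn

/-! ### The transposition and the reflection of states -/

/-- The reflection of the grid in the main diagonal, combined with the reversal of all arrows. -/
def transpose (c : IceConfig n) : IceConfig n := (fun i j => c.2 j i, fun i j => c.1 j i)

/-- The reflection of the grid in the horizontal axis. -/
def flip (c : IceConfig n) : IceConfig n :=
  (fun i j => c.1 i.rev j, fun i j => !(c.2 i.rev j))

theorem left_transpose (c : IceConfig n) (i j : Fin n) : c.transpose.left i j = c.top j i := rfl

theorem right_transpose (c : IceConfig n) (i j : Fin n) :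
    c.transpose.right i j = c.bottom j i := rfl

theorem top_transpose (c : IceConfig n) (i j : Fin n) : c.transpose.top i j = c.left j i := rfl

theorem left_flip (c : IceConfig n) (i j : Fin n) : c.flip.left i j = c.left i.rev j := rfl

theorem right_flip (c : IceConfig n) (i j : Fin n) : c.flip.right i j = c.right i.rev j := rfl

theorem top_flip (c : IceConfig n) (i j : Fin n) : c.flip.top i j = !(c.bottom i.rev j) := by
  rw [top, bottom, ← Fin.rev_castSucc]; rfl

/-- `transpose` as a permutation. -/
def transposeEquiv : Equiv.Perm (IceConfig n) :=
  ⟨transpose, transpose, fun _ => rfl, fun _ => rfl⟩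

theorem flip_flip (c : IceConfig n) : c.flip.flip = c := by
  simp [flip]

/-- `flip` as a permutation. -/
def flipEquiv : Equiv.Perm (IceConfig n) := ⟨flip, flip, flip_flip, flip_flip⟩

theorem inDegree_transpose (c : IceConfig n) (i j : Fin n) :
    c.transpose.inDegree i j + c.inDegree j i = 4 := by
  simp only [inDegree, transpose, left, right, top, bottom]
  cases c.1 j i.castSucc <;> cases c.1 j i.succ <;> cases c.2 j.castSucc i <;>
    cases c.2 j.succ i <;> rfl

theorem IsState.transpose {c : IceConfig n} (h : c.IsState) : c.transpose.IsState :=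
  ⟨fun i j => by have := c.inDegree_transpose i j; have := h.1 j i; omega,
    h.2.2.2.1, h.2.2.2.2, h.2.1, h.2.2.1⟩

theorem IsHalfTurn.transpose {c : IceConfig n} (h : c.IsHalfTurn) : c.transpose.IsHalfTurn :=
  ⟨fun i j => h.2 j i, fun i j => h.1 j i⟩

theorem inDegree_flip (c : IceConfig n) (i j : Fin n) :
    c.flip.inDegree i j = c.inDegree i.rev j := by
  simp only [inDegree, flip, left, right, top, bottom, Fin.rev_castSucc, Fin.rev_succ,
    Bool.not_not]
  omega

theorem IsState.flip {c : IceConfig n} (h : c.IsState) : c.flip.IsState :=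
  ⟨fun i j => by rw [inDegree_flip]; exact h.1 _ _, fun i => h.2.1 _, fun i => h.2.2.1 _,
    fun j => by simp [IceConfig.flip, h.2.2.2.2], fun j => by simp [IceConfig.flip, h.2.2.2.1]⟩

theorem IsHalfTurn.flip {c : IceConfig n} (h : c.IsHalfTurn) : c.flip.IsHalfTurn :=
  ⟨fun i j => h.1 i.rev j, fun i j => by simpa [IceConfig.flip] using h.2 i.rev j⟩

theorem isState_transpose {c : IceConfig n} : c.transpose.IsState ↔ c.IsState :=
  ⟨fun h => h.transpose, fun h => h.transpose⟩

theorem isHalfTurn_transpose {c : IceConfig n} : c.transpose.IsHalfTurn ↔ c.IsHalfTurn :=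
  ⟨fun h => h.transpose, fun h => h.transpose⟩

theorem isState_flip {c : IceConfig n} : c.flip.IsState ↔ c.IsState :=
  ⟨fun h => by simpa only [flip_flip] using h.flip, fun h => h.flip⟩

theorem isHalfTurn_flip {c : IceConfig n} : c.flip.IsHalfTurn ↔ c.IsHalfTurn :=
  ⟨fun h => by simpa only [flip_flip] using h.flip, fun h => h.flip⟩

theorem toMatrix_transpose {c : IceConfig n} {i j : Fin n} (h : c.inDegree j i = 2) :
    c.transpose.toMatrix i j = c.toMatrix j i := by
  rw [inDegree] at h
  rw [toMatrix, toMatrix, left_transpose, right_transpose]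
  revert h
  cases c.left j i <;> cases c.right j i <;> cases c.top j i <;> cases c.bottom j i <;> simp

theorem toMatrix_flip (c : IceConfig n) (i j : Fin n) :
    c.flip.toMatrix i j = c.toMatrix i.rev j := rfl

variable {K : Type*} [Field K]

theorem vertexWeight_transpose {c : IceConfig n} {i j : Fin n} (h : c.inDegree j i = 2)
    (a z : K) : c.transpose.vertexWeight a z i j = c.vertexWeight a z j i := by
  rw [inDegree] at h
  rw [vertexWeight, vertexWeight, left_transpose, right_transpose, top_transpose]
  revert h
  cases c.left j i <;> cases c.right j i <;> cases c.top j i <;> cases c.bottom j i <;> simp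

theorem vertexWeight_flip {c : IceConfig n} {i j : Fin n} (h : c.inDegree i.rev j = 2)
    (a z : K) : c.flip.vertexWeight a z⁻¹ i j = c.vertexWeight a z i.rev j := by
  rw [inDegree] at h
  rw [vertexWeight, vertexWeight, left_flip, right_flip, top_flip]
  revert h
  cases c.left i.rev j <;> cases c.right i.rev j <;> cases c.top i.rev j <;>
    cases c.bottom i.rev j <;> simp

/-- Transposition with reversal of all arrows keeps the type of every vertex, and exchanging the
parameters with inversion keeps every quotient x/y. -/
theorem IsState.weight_transpose {c : IceConfig n} (h : c.IsState) (a : K) (x y : Fin n → K)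
    (D : Finset (Fin n × Fin n)) :
    c.transpose.weight a y⁻¹ x⁻¹ (D.map (Equiv.prodComm _ _).toEmbedding) =
      c.weight a x y D := by
  rw [weight, Finset.prod_map, weight]
  refine Finset.prod_congr rfl fun p _ => ?_
  simp only [Equiv.coe_toEmbedding, Equiv.prodComm_apply, Prod.fst_swap, Prod.snd_swap,
    Pi.inv_apply, inv_inv]
  rw [vertexWeight_transpose (h.1 _ _), mul_comm]

/-- The reflection exchanges the two types of entries 0, which is compensated by inverting the
spectral parameter. -/
theorem IsState.weight_flip {c : IceConfig n} (h : c.IsState) (a : K) (x y : Fin n → K)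
    (D : Finset (Fin n × Fin n)) :
    c.flip.weight a (fun i => (x i.rev)⁻¹) y⁻¹
      (D.map (Equiv.prodCongr Fin.revPerm (Equiv.refl _)).toEmbedding) = c.weight a x y D := by
  rw [weight, Finset.prod_map, weight]
  refine Finset.prod_congr rfl fun p _ => ?_
  simp only [Equiv.coe_toEmbedding, Equiv.prodCongr_apply, Prod.map_fst, Prod.map_snd,
    Fin.revPerm_apply, Fin.rev_rev, Equiv.refl_apply, Pi.inv_apply]
  rw [← mul_inv, vertexWeight_flip (by rw [Fin.rev_rev]; exact h.1 _ _), Fin.rev_rev]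

end IceConfig

/-! ### Symmetries of the partition functions -/

section Symmetries

open scoped Classical

variable {K : Type*} [Field K] (a : K)

theorem foldIndex_rev {n k : ℕ} (h : n ≤ 2 * k) (r : Fin n) :
    foldIndex h r.rev = foldIndex h r := by
  simp [foldIndex, min_comm]

theorem zDW_transpose (n : ℕ) (x y : Fin n → K) : zDW a n y⁻¹ x⁻¹ = zDW a n x y := by
  refine (Finset.sum_equiv IceConfig.transposeEquiv (fun c => ?_) fun c hc => ?_).symm
  · simp only [Finset.mem_filter, Finset.mem_univ, true_and]
    exact IceConfig.isState_transpose.symm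
  · rw [← (Finset.mem_filter.1 hc).2.weight_transpose]
    rw [Finset.map_univ_equiv]; rfl

theorem zDW_flip (n : ℕ) (x y : Fin n → K) :
    zDW a n (fun i => (x i.rev)⁻¹) y⁻¹ = zDW a n x y := by
  refine (Finset.sum_equiv IceConfig.flipEquiv (fun c => ?_) fun c hc => ?_).symm
  · simp only [Finset.mem_filter, Finset.mem_univ, true_and]
    exact IceConfig.isState_flip.symm
  · rw [← (Finset.mem_filter.1 hc).2.weight_flip]
    rw [Finset.map_univ_equiv]; rfl

theorem zHTEven_transpose (m : ℕ) (x y : Fin m → K) :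
    zHTEven a m y⁻¹ x⁻¹ = zHTEven a m x y := by
  refine (Finset.sum_equiv IceConfig.transposeEquiv (fun c => ?_) fun c hc => ?_).symm
  · simp only [Finset.mem_filter, Finset.mem_univ, true_and]
    exact and_congr IceConfig.isState_transpose.symm IceConfig.isHalfTurn_transpose.symm
  · obtain ⟨hs, hh⟩ := (Finset.mem_filter.1 hc).2
    rw [← hs.weight_transpose]
    -- The image of the left half is the upper half, another fundamental domain of the half-turn.
    refine hh.transpose.weight_eq hs.transpose a ?_ ?_ ?_ ?_ ?_
    · simp [foldIndex_rev]
    · simp [foldIndex_rev]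
    · simp [evenDomain, Fin.val_rev]; omega
    · simp [evenDomain, Fin.val_rev]; omega
    · simp [evenDomain, Fin.val_rev]; omega

theorem zHTEven_inv (m : ℕ) (x y : Fin m → K) : zHTEven a m x⁻¹ y⁻¹ = zHTEven a m x y := by
  refine (Finset.sum_equiv IceConfig.flipEquiv (fun c => ?_) fun c hc => ?_).symm
  · simp only [Finset.mem_filter, Finset.mem_univ, true_and]
    exact and_congr IceConfig.isState_flip.symm IceConfig.isHalfTurn_flip.symm
  · obtain ⟨hs, hh⟩ := (Finset.mem_filter.1 hc).2
    rw [← hs.weight_flip]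
    simp only [foldIndex_rev]
    refine hh.flip.weight_eq hs.flip a ?_ ?_ ?_ ?_ ?_
    · simp [foldIndex_rev]
    · simp [foldIndex_rev]
    · simp [evenDomain, Fin.val_rev]; omega
    · simp [evenDomain, Fin.val_rev]; omega
    · simp [evenDomain, Fin.val_rev]

theorem rev_centre (m : ℕ) : (centre m).rev = centre m := by
  ext; simp [centre, Fin.val_rev]; omega

theorem zHTOddCentral_transpose (ε : ℤ) (m : ℕ) (x y : Fin (m + 1) → K) :
    zHTOddCentral a ε m y⁻¹ x⁻¹ = zHTOddCentral a ε m x y := by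
  refine (Finset.sum_equiv IceConfig.transposeEquiv (fun c => ?_) fun c hc => ?_).symm
  · simp only [Finset.mem_filter, Finset.mem_univ, true_and]
    refine (and_congr_right fun hs => ?_).trans
      (and_congr_left' IceConfig.isState_transpose.symm)
    refine and_congr IceConfig.isHalfTurn_transpose.symm ?_
    rw [← IceConfig.toMatrix_transpose (hs.1 _ _)]; rfl
  · obtain ⟨hs, hh, -⟩ := (Finset.mem_filter.1 hc).2
    rw [oddWeight, ← hs.weight_transpose]
    refine hh.transpose.weight_eq hs.transpose a ?_ ?_ ?_ ?_ ?_
    · simp [foldIndex_rev]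
    · simp [foldIndex_rev]
    · simp [oddDomain, Fin.val_rev]; omega
    · simp [oddDomain, Fin.val_rev]; omega
    · simp [oddDomain, Fin.val_rev]; omega

theorem zHTOddCentral_inv (ε : ℤ) (m : ℕ) (x y : Fin (m + 1) → K) :
    zHTOddCentral a ε m x⁻¹ y⁻¹ = zHTOddCentral a ε m x y := by
  refine (Finset.sum_equiv IceConfig.flipEquiv (fun c => ?_) fun c hc => ?_).symm
  · simp only [Finset.mem_filter, Finset.mem_univ, true_and]
    refine and_congr IceConfig.isState_flip.symm
      (and_congr IceConfig.isHalfTurn_flip.symm ?_)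
    rw [← rev_centre m, ← IceConfig.toMatrix_flip, rev_centre]; rfl
  · obtain ⟨hs, hh, -⟩ := (Finset.mem_filter.1 hc).2
    rw [oddWeight, ← hs.weight_flip]
    simp only [foldIndex_rev]
    refine hh.flip.weight_eq hs.flip a ?_ ?_ ?_ ?_ ?_
    · simp [foldIndex_rev]
    · simp [foldIndex_rev]
    · simp [oddDomain, Fin.val_rev]; omega
    · simp [oddDomain, Fin.val_rev]; omega
    · simp [oddDomain, Fin.val_rev]; omega

/-- The centre is fixed by the half-turn, which makes its left and right edges opposite: its entry
cannot be 0. -/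
theorem zHTOdd_eq_add (m : ℕ) (x y : Fin (m + 1) → K) :
    zHTOdd a m x y = zHTOddCentral a 1 m x y + zHTOddCentral a (-1) m x y := by
  simp only [zHTOdd, zHTOddCentral, Finset.sum_filter, ← Finset.sum_add_distrib]
  refine Finset.sum_congr rfl fun c _ => ?_
  by_cases hs : c.IsState <;> by_cases hh : c.IsHalfTurn <;> simp only [hs, hh, true_and,
    false_and, and_false, if_true, if_false, add_zero]
  have := hh.left_rev (centre m) (centre m)
  rw [rev_centre] at this
  simp only [IceConfig.toMatrix, this]
  cases c.right (centre m) (centre m) <;> simp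

end Symmetries

/-! ### Row operators as sums over edge configurations -/

section Bridge

variable {K : Type*} [Field K]

theorem sum_fin_succ_fun {α M : Type*} [Fintype α] [AddCommMonoid M] (n : ℕ)
    (f : (Fin (n + 1) → α) → M) : ∑ h, f h = ∑ b, ∑ h', f (Fin.cons b h') := by
  rw [← (Fin.consEquiv fun _ => α).sum_comp, Fintype.sum_prod_type]
  rfl

theorem sum_fin_succ_fun_of_head {α M : Type*} [Fintype α] [AddCommMonoid M] (n : ℕ) (b : α)
    (f : (Fin (n + 1) → α) → M) (hf : ∀ h, h 0 ≠ b → f h = 0) :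
    ∑ h, f h = ∑ h', f (Fin.cons b h') := by
  rw [sum_fin_succ_fun]
  refine Finset.sum_eq_single_of_mem b (Finset.mem_univ _) fun c _ hc => ?_
  exact Finset.sum_eq_zero fun h' _ => hf _ (by simpa using hc)

theorem rowAct_ofFn (a x : K) {n : ℕ} (y : Fin n → K) (l r : Bool) (t : Fin n → Bool)
    (Ψ : List Bool → K) :
    rowAct a x l r (List.ofFn y) Ψ (List.ofFn t) =
      ∑ h : Fin (n + 1) → Bool, ∑ s : Fin n → Bool,
        (if h 0 = l ∧ h (Fin.last n) = r then
          ∏ j, iceWeight a (x * (y j)⁻¹) (h j.castSucc) (h j.succ) (t j) (s j) else 0) *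
        Ψ (List.ofFn s) := by
  induction n generalizing l Ψ with
  | zero =>
    simp only [sum_fin_succ_fun, List.ofFn_zero, rowAct, Finset.univ_unique, Finset.sum_singleton,
      Fintype.sum_bool, Finset.univ_eq_empty, Finset.prod_empty]
    cases l <;> cases r <;> simp
  | succ n ih =>
    calc _ = ∑ f : Bool, ∑ b : Bool, ∑ h : Fin (n + 1) → Bool, ∑ s : Fin n → Bool,
          iceWeight a (x * (y 0)⁻¹) l f (t 0) b *
          ((if h 0 = f ∧ h (Fin.last n) = r then
            ∏ j : Fin n, iceWeight a (x * (y j.succ)⁻¹) (h j.castSucc) (h j.succ) (t j.succ) (s j)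
            else 0) * Ψ (b :: List.ofFn s)) := by
          simp only [List.ofFn_succ, rowAct, ih, Finset.mul_sum]
      _ = ∑ h : Fin (n + 1) → Bool, ∑ b : Bool, ∑ s : Fin n → Bool, ∑ f : Bool,
          iceWeight a (x * (y 0)⁻¹) l f (t 0) b *
          ((if h 0 = f ∧ h (Fin.last n) = r then
            ∏ j : Fin n, iceWeight a (x * (y j.succ)⁻¹) (h j.castSucc) (h j.succ) (t j.succ) (s j)
            else 0) * Ψ (b :: List.ofFn s)) := by
          rw [Finset.sum_comm, Finset.sum_comm (s := Finset.univ (α := Fin (n + 1) → Bool))]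
          refine Finset.sum_congr rfl fun b _ => ?_
          rw [Finset.sum_comm]
          exact Finset.sum_congr rfl fun h _ => Finset.sum_comm
      _ = _ := by
          rw [sum_fin_succ_fun_of_head (n + 1) l _ fun h hh =>
            Finset.sum_eq_zero fun s _ => by rw [if_neg fun h' => hh h'.1, zero_mul]]
          refine Finset.sum_congr rfl fun h _ => ?_
          rw [sum_fin_succ_fun]
          refine Finset.sum_congr rfl fun b _ => Finset.sum_congr rfl fun s _ => ?_
          rw [Finset.sum_eq_single_of_mem (h 0) (Finset.mem_univ _)
            (fun f _ hf => by simp [Ne.symm hf])]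
          simp only [Fin.cons_zero, true_and, Fin.prod_univ_succ, Fin.cons_succ,
            Fin.castSucc_zero, ← Fin.succ_castSucc, ← Fin.succ_last, List.ofFn_succ]
          split_ifs <;> ring

theorem rowFold_ofFn (a : K) {k n : ℕ} (x : Fin k → K) (y : Fin n → K) (t : Fin n → Bool)
    (Ψ : List Bool → K) :
    rowFold a (List.ofFn x) (List.ofFn y) Ψ (List.ofFn t) =
      ∑ H : Fin k → Fin (n + 1) → Bool, ∑ v : Fin (k + 1) → Fin n → Bool,
        (if v 0 = t ∧ ∀ i, H i 0 = true ∧ H i (Fin.last n) = false then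
          ∏ i, ∏ j, iceWeight a (x i * (y j)⁻¹) (H i j.castSucc) (H i j.succ)
            (v i.castSucc j) (v i.succ j) else 0) *
        Ψ (List.ofFn (v (Fin.last k))) := by
  induction k generalizing t with
  | zero =>
    rw [Fintype.sum_unique, sum_fin_succ_fun_of_head 0 t _ fun h hh => by
      rw [if_neg fun h' => hh h'.1, zero_mul]]
    simp
  | succ k ih =>
    rw [sum_fin_succ_fun k, List.ofFn_succ, rowFold_cons, rowAct_ofFn]
    refine Finset.sum_congr rfl fun h _ => ?_
    simp only [ih, Finset.mul_sum]
    rw [Finset.sum_comm]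
    refine Finset.sum_congr rfl fun H _ => ?_
    rw [Finset.sum_comm, sum_fin_succ_fun_of_head (k + 1) t _ fun h hh => by
      rw [if_neg fun h' => hh h'.1, zero_mul]]
    refine Finset.sum_congr rfl fun v _ => ?_
    rw [Finset.sum_eq_single_of_mem (v 0) (Finset.mem_univ _)
      (fun f _ hf => by simp [Ne.symm hf])]
    simp only [Fin.cons_zero, true_and, Fin.prod_univ_succ (n := k), Fin.cons_succ,
      Fin.castSucc_zero, ← Fin.succ_castSucc, ← Fin.succ_last, Fin.forall_fin_succ (n := k),
      ite_and]
    split_ifs <;> ring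

end Bridge

/-! ### The partition functions as matrix elements of row transfer operators -/

/-- The condition at the bottom of the `n × n` grid. -/
def dwEnd (K : Type*) [Field K] (s : List Bool) : K := if ∀ b ∈ s, b = false then 1 else 0

/-- The condition for the vertical edges in the middle of a half-turn symmetric state of
even order. -/
def htEnd (K : Type*) [Field K] (s : List Bool) : K :=
  if s.reverse = s.map (fun b => !b) then 1 else 0

section Bridge

open scoped Classical

variable {K : Type*} [Field K]

/-- Since `iceWeight` vanishes where the ice rule fails, unrestricted sums over edges coming from
row operators are sums over states. -/
theorem IceConfig.prod_iceWeight {n : ℕ} (c : IceConfig n) (a : K) (x y : Fin n → K)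
    (D : Finset (Fin n × Fin n)) :
    ∏ p ∈ D, iceWeight a (x p.1 * (y p.2)⁻¹) (c.left p.1 p.2) (c.right p.1 p.2) (c.top p.1 p.2)
      (c.bottom p.1 p.2) =
    if ∀ p ∈ D, c.inDegree p.1 p.2 = 2 then c.weight a x y D else 0 := by
  split_ifs with h
  · refine Finset.prod_congr rfl fun p hp => ?_
    rw [iceWeight]
    exact if_pos (h p hp)
  · push Not at h
    obtain ⟨p, hp, hp2⟩ := h
    refine Finset.prod_eq_zero hp ?_
    rw [iceWeight]
    exact if_neg hp2

theorem zDW_eq_rowFold (a : K) (n : ℕ) (x y : Fin n → K) :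
    zDW a n x y = rowFold a (List.ofFn x) (List.ofFn y) (dwEnd K) (List.replicate n true) := by
  rw [← List.ofFn_const, rowFold_ofFn, zDW, Finset.sum_filter, Fintype.sum_prod_type]
  refine Finset.sum_congr rfl fun H _ => Finset.sum_congr rfl fun v _ => ?_
  have key := IceConfig.prod_iceWeight (H, v) a x y Finset.univ
  rw [Fintype.prod_prod_type] at key
  have h2 : ∀ i j, iceWeight a (x i * (y j)⁻¹) (IceConfig.left (H, v) i j)
      (IceConfig.right (H, v) i j) (IceConfig.top (H, v) i j) (IceConfig.bottom (H, v) i j) =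
      iceWeight a (x i * (y j)⁻¹) (H i j.castSucc) (H i j.succ) (v i.castSucc j) (v i.succ j) :=
    fun i j => rfl
  simp only [h2] at key
  rw [key, dwEnd]
  simp only [List.mem_ofFn, forall_exists_index, forall_apply_eq_imp_iff, Finset.mem_univ,
    forall_true_left, Prod.forall]
  have : IceConfig.IsState (H, v) ↔ (v 0 = fun _ => true) ∧
      (∀ i, H i 0 = true ∧ H i (Fin.last n) = false) ∧
      (∀ i j, IceConfig.inDegree (H, v) i j = 2) ∧ (∀ j, v (Fin.last n) j = false) := by
    rw [IceConfig.IsState, funext_iff, forall_and]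
    tauto
  simp only [this, ite_and, mul_ite, mul_one, mul_zero]
  split_ifs <;> rfl

/-! #### Half-turn symmetric states of even order -/

theorem htEnd_ofFn {n : ℕ} (s : Fin n → Bool) :
    htEnd K (List.ofFn s) = if ∀ j, s j.rev = !(s j) then 1 else 0 := by
  have h1 : (List.ofFn s).reverse = List.ofFn fun j => s j.rev := by
    apply List.ext_getElem
    · simp
    · intro i h1 h2
      simp only [List.getElem_reverse, List.getElem_ofFn, List.length_ofFn]
      congr 1
      ext
      simp [Fin.val_rev]
      omega
  simp only [htEnd, h1, List.map_ofFn, List.ofFn_inj, funext_iff, Function.comp_apply]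

/-- The vertices in the first `k` rows. -/
def topRows (k n : ℕ) : Finset (Fin n × Fin n) := Finset.univ.filter fun p => p.1.val < k

theorem prod_topRows {M : Type*} [CommMonoid M] {k n : ℕ} (h : k ≤ n) (f : Fin n × Fin n → M) :
    ∏ p ∈ topRows k n, f p = ∏ i : Fin k, ∏ j : Fin n, f (Fin.castLE h i, j) := by
  rw [← Fintype.prod_prod_type']
  refine Finset.prod_bij' (fun p hp => (⟨p.1.val, by simpa [topRows] using hp⟩, p.2))
    (fun p _ => (Fin.castLE h p.1, p.2)) ?_ ?_ ?_ ?_ ?_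
  · simp
  · simp [topRows]
  · intros; rfl
  · intros; rfl
  · intros; rfl

/-- The upper half of a configuration of even order. -/
def IceConfig.upperHalf {m : ℕ} (c : IceConfig (2 * m)) :
    (Fin m → Fin (2 * m + 1) → Bool) × (Fin (m + 1) → Fin (2 * m) → Bool) :=
  (fun i j => c.1 (Fin.castLE (by omega) i) j, fun i j => c.2 (Fin.castLE (by omega) i) j)

/-- The half-turn symmetric configuration with a given upper half. -/
def IceConfig.ofUpperHalf {m : ℕ}
    (d : (Fin m → Fin (2 * m + 1) → Bool) × (Fin (m + 1) → Fin (2 * m) → Bool)) :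
    IceConfig (2 * m) :=
  (fun i j => if h : i.val < m then d.1 ⟨i, h⟩ j else !(d.1 ⟨i.rev, by simp; omega⟩ j.rev),
    fun i j => if h : i.val ≤ m then d.2 ⟨i, Nat.lt_succ_of_le h⟩ j else
      !(d.2 ⟨i.rev, by simp; omega⟩ j.rev))

theorem IceConfig.ofUpperHalf_isHalfTurn {m : ℕ}
    (d : (Fin m → Fin (2 * m + 1) → Bool) × (Fin (m + 1) → Fin (2 * m) → Bool))
    (hd : ∀ j, d.2 (Fin.last m) j.rev = !(d.2 (Fin.last m) j)) :
    (IceConfig.ofUpperHalf d).IsHalfTurn := by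
  constructor
  · intro i j
    by_cases h : i.val < m
    · have h' : ¬ (i.rev.val < m) := by simp [Fin.val_rev]; omega
      simp [ofUpperHalf, h, h', -Fin.val_rev]
    · have h' : i.rev.val < m := by simp [Fin.val_rev]; omega
      simp [ofUpperHalf, h, h', -Fin.val_rev]
  · intro i j
    rcases lt_trichotomy i.val m with h | h | h
    · have h' : ¬ (i.rev.val ≤ m) := by simp [Fin.val_rev]; omega
      have h2 : i.val ≤ m := by omega
      simp [ofUpperHalf, h2, h', -Fin.val_rev]
    · have h' : i.rev = i := by ext; simp [Fin.val_rev]; omega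
      have h2 : i.val ≤ m := by omega
      have h3 : (⟨i, Nat.lt_succ_of_le h2⟩ : Fin (m + 1)) = Fin.last m := by ext; simp [h]
      rw [h']
      simp only [ofUpperHalf, h2, dif_pos, h3, hd]
    · have h' : i.rev.val ≤ m := by simp [Fin.val_rev]; omega
      have h2 : ¬ (i.val ≤ m) := by omega
      simp [ofUpperHalf, h2, h', -Fin.val_rev]

theorem IceConfig.IsHalfTurn.ofUpperHalf_upperHalf {m : ℕ} {c : IceConfig (2 * m)}
    (hc : c.IsHalfTurn) : IceConfig.ofUpperHalf c.upperHalf = c := by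
  refine Prod.ext (funext₂ fun i j => ?_) (funext₂ fun i j => ?_)
  · by_cases h : i.val < m
    · simp [ofUpperHalf, upperHalf, h]
    · simp only [ofUpperHalf, upperHalf, h, dif_neg, not_false_iff]
      have := hc.1 i j
      rw [← Bool.not_not (c.1 i j), ← this]
      rfl
  · by_cases h : i.val ≤ m
    · simp [ofUpperHalf, upperHalf, h]
    · simp only [ofUpperHalf, upperHalf, h, dif_neg, not_false_iff]
      have := hc.2 i j
      rw [← Bool.not_not (c.2 i j), ← this]
      rfl

theorem IceConfig.upperHalf_ofUpperHalf {m : ℕ}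
    (d : (Fin m → Fin (2 * m + 1) → Bool) × (Fin (m + 1) → Fin (2 * m) → Bool)) :
    (IceConfig.ofUpperHalf d).upperHalf = d := by
  refine Prod.ext (funext₂ fun i j => ?_) (funext₂ fun i j => ?_) <;>
    simp [ofUpperHalf, upperHalf, Fin.is_le]

theorem IceConfig.IsHalfTurn.upperHalf_last {m : ℕ} {c : IceConfig (2 * m)}
    (hc : c.IsHalfTurn) (j : Fin (2 * m)) :
    c.upperHalf.2 (Fin.last m) j.rev = !(c.upperHalf.2 (Fin.last m) j) := by
  have := hc.2 (Fin.castLE (by omega) (Fin.last m)) j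
  rw [upperHalf, ← this]
  exact congrArg (fun k => c.2 k j.rev) (Fin.ext (by simp [Fin.val_rev]; omega))

theorem IceConfig.IsHalfTurn.isState_iff_upperHalf {m : ℕ} {c : IceConfig (2 * m)}
    (hc : c.IsHalfTurn) : c.IsState ↔ ((c.upperHalf.2 0 = fun _ => true) ∧
      ∀ i, c.upperHalf.1 i 0 = true ∧ c.upperHalf.1 i (Fin.last _) = false) ∧
      ∀ p ∈ topRows m (2 * m), c.inDegree p.1 p.2 = 2 := by
  rw [hc.isState_iff (P := fun i _ => i.val < m) fun i j => by rw [Fin.val_rev]; omega]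
  simp only [topRows, Finset.mem_filter, Finset.mem_univ, true_and, Prod.forall]
  constructor
  · rintro ⟨h1, h2, h3⟩
    refine ⟨⟨funext fun j => h3 j, fun i => ⟨h2 _, ?_⟩⟩, fun i j h => h1 i j h⟩
    have := hc.1 (Fin.castLE (by omega) i) 0
    rw [h2] at this
    have := hc.1 (Fin.castLE (by omega) i).rev 0
    rw [Fin.rev_rev, h2, Fin.rev_zero] at this
    exact this
  · rintro ⟨⟨h1, h2⟩, h3⟩
    refine ⟨fun i j h => h3 i j h, fun i => ?_, fun j => congrFun h1 j⟩
    by_cases h : i.val < m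
    · exact (h2 ⟨i, h⟩).1
    · have h' : i.rev.val < m := by simp [Fin.val_rev]; omega
      have h4 := (h2 ⟨i.rev, h'⟩).2
      have := hc.1 i.rev (Fin.last _)
      rw [Fin.rev_rev, Fin.rev_last] at this
      rw [this]
      exact congrArg (fun b => !b) h4

theorem ofFn_foldIndex_even {α : Type*} (m : ℕ) (y : Fin m → α) :
    (List.ofFn fun r : Fin (2 * m) => y (foldIndex le_rfl r)) =
      List.ofFn y ++ (List.ofFn y).reverse := by
  apply List.ext_getElem
  · simp; omega
  · intro i h1 h2
    simp only [List.getElem_ofFn, List.getElem_append, List.getElem_reverse, List.length_ofFn]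
    simp only [List.length_ofFn] at h1
    split_ifs with h
    · congr 1; ext; simp [foldIndex, Fin.val_rev]; omega
    · congr 1; ext; simp [foldIndex, Fin.val_rev]; omega

theorem zHTEven_eq_rowFold (a : K) (m : ℕ) (x y : Fin m → K) :
    zHTEven a m x y = rowFold a (List.ofFn x) (List.ofFn y ++ (List.ofFn y).reverse) (htEnd K)
      (List.replicate (2 * m) true) := by
  rw [← List.ofFn_const, ← ofFn_foldIndex_even, rowFold_ofFn, ← Fintype.sum_prod_type']
  simp only [htEnd_ofFn, mul_ite, mul_one, mul_zero]
  rw [← Finset.sum_filter, zHTEven]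
  simp only [and_comm (b := IceConfig.IsHalfTurn _)]
  rw [← Finset.filter_filter, Finset.sum_filter]
  refine Finset.sum_bij' (fun c _ => c.upperHalf) (fun d _ => IceConfig.ofUpperHalf d)
    ?_ ?_ ?_ ?_ ?_
  · intro c hc
    simpa using fun j => (Finset.mem_filter.1 hc).2.upperHalf_last j
  · intro d hd
    simpa using IceConfig.ofUpperHalf_isHalfTurn d (Finset.mem_filter.1 hd).2
  · intro c hc
    exact (Finset.mem_filter.1 hc).2.ofUpperHalf_upperHalf
  · intro d _
    exact IceConfig.upperHalf_ofUpperHalf d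
  · intro c hc
    have hh := (Finset.mem_filter.1 hc).2
    have key := IceConfig.prod_iceWeight c a (fun r => x (foldIndex le_rfl r))
      (fun r => y (foldIndex le_rfl r)) (topRows m (2 * m))
    rw [prod_topRows (by omega)] at key
    have h2 : ∀ (i : Fin m) (j : Fin (2 * m)), iceWeight a (x i * (y (foldIndex le_rfl j))⁻¹)
        (c.upperHalf.1 i j.castSucc) (c.upperHalf.1 i j.succ) (c.upperHalf.2 i.castSucc j)
        (c.upperHalf.2 i.succ j) =
        iceWeight a (x (foldIndex le_rfl (Fin.castLE (by omega : m ≤ 2 * m) i)) *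
          (y (foldIndex le_rfl j))⁻¹) (c.left (Fin.castLE (by omega) i) j)
          (c.right (Fin.castLE (by omega) i) j) (c.top (Fin.castLE (by omega) i) j)
          (c.bottom (Fin.castLE (by omega) i) j) := by
      intro i j
      have : foldIndex (k := m) le_rfl (Fin.castLE (by omega : m ≤ 2 * m) i) = i := by
        ext; simp [foldIndex, Fin.val_rev]; omega
      rw [this]; rfl
    simp only [h2]
    have hiff := hh.isState_iff_upperHalf
    rw [key]
    by_cases hs : c.IsState
    · obtain ⟨h3, h4⟩ := hiff.1 hs
      rw [if_pos hs, if_pos h3, if_pos h4]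
      -- The row operators produce the product over the upper half, the partition function is
      -- defined by the left half.
      refine hh.weight_eq hs a ?_ ?_ ?_ ?_ ?_
      · simp [foldIndex_rev]
      · simp [foldIndex_rev]
      · simp [evenDomain, Fin.val_rev]; omega
      · simp [topRows, Fin.val_rev]; omega
      · simp [evenDomain, topRows, Fin.val_rev]; omega
    · rw [if_neg hs]
      split_ifs with h3 h4
      · exact absurd (hiff.2 ⟨h3, h4⟩) hs
      · rfl
      · rfl

end Bridge

section Bridge

open scoped Classical

variable {K : Type*} [Field K]

/-! #### Half-turn symmetric states of odd order -/

theorem lineAct_append_cons (a u : K) (κ : Bool → K) (l c : Bool) (Y : List K)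
    (χ : List Bool → K) (t s : List Bool) (ht : t.length = Y.length) :
    lineAct a u κ l Y χ (t ++ c :: s) = κ c * rowAct a u l c Y (fun b => χ (b ++ s)) t := by
  induction Y generalizing l χ t with
  | nil =>
    obtain rfl := List.length_eq_zero_iff.1 ht
    simp [lineAct, rowAct]
  | cons y Y ih =>
    cases t with
    | nil => simp at ht
    | cons b t =>
      have := fun f b => ih f (fun s => χ (b :: s)) t (by simpa using ht)
      simp only [List.cons_append, lineAct, rowAct, this, Fintype.sum_bool]
      ring

/-- The column `j` in the left half of a grid with `2m+1` columns. -/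
def leftCol {m : ℕ} (j : Fin m) : Fin (2 * m + 1) := ⟨j, by omega⟩

theorem ofFn_odd {α : Type*} {m : ℕ} (s : Fin (2 * m + 1) → α) :
    List.ofFn s = List.ofFn (fun j : Fin m => s (leftCol j)) ++
      s (centre m) :: (List.ofFn fun j : Fin m => s (leftCol j).rev).reverse := by
  apply List.ext_getElem
  · simp; omega
  · intro i h1 h2
    simp only [List.getElem_ofFn, List.getElem_append, List.length_ofFn]
    simp only [List.length_ofFn] at h1
    split_ifs with h
    · rfl
    · obtain ⟨k, rfl⟩ := Nat.exists_eq_add_of_le (not_lt.1 h)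
      rcases k with - | k
      · simp [centre]
      · simp only [List.getElem_cons, List.getElem_reverse, List.getElem_ofFn, List.length_ofFn]
        rw [dif_neg (by omega)]
        congr 1
        ext
        simp [leftCol, Fin.val_rev]
        omega

theorem htEnd_ofFn_append {m : ℕ} (b s : Fin m → Bool) :
    htEnd K (List.ofFn b ++ (List.ofFn s).reverse) = if b = (fun j => !(s j)) then 1 else 0 := by
  have h1 : ((List.ofFn b ++ (List.ofFn s).reverse).reverse =
      (List.ofFn b ++ (List.ofFn s).reverse).map fun b => !b) ↔ b = (fun j => !(s j)) := by
    rw [List.reverse_append, List.reverse_reverse, List.map_append, List.map_reverse,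
      List.map_ofFn, List.map_ofFn]
    constructor
    · intro h
      have := (List.append_inj h (by simp)).1
      rw [List.ofFn_inj] at this
      rw [this]
      funext j
      simp
    · rintro rfl
      congr 2
      funext j
      simp
  simp only [htEnd, h1]

theorem lineAct_ofFn (a u : K) (κ : Bool → K) {m : ℕ} (y : Fin m → K)
    (s : Fin (2 * m + 1) → Bool) :
    lineAct a u κ true (List.ofFn y) (htEnd K) (List.ofFn s) =
      ∑ g : Fin (m + 1) → Bool, if g 0 = true ∧ g (Fin.last m) = s (centre m) then
        κ (s (centre m)) * ∏ j : Fin m, iceWeight a (u * (y j)⁻¹) (g j.castSucc) (g j.succ)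
          (s (leftCol j)) (!(s (leftCol j).rev)) else 0 := by
  rw [ofFn_odd s, lineAct_append_cons _ _ _ _ _ _ _ _ _ (by simp), rowAct_ofFn, Finset.mul_sum]
  refine Finset.sum_congr rfl fun g _ => ?_
  simp only [htEnd_ofFn_append]
  rw [Finset.sum_eq_single_of_mem (fun j => !(s (leftCol j).rev)) (Finset.mem_univ _)
    fun b _ hb => by rw [if_neg hb, mul_zero]]
  simp

/-- The vertices of the central row to the left of the centre. -/
def centreRow (m : ℕ) : Finset (Fin (2 * m + 1) × Fin (2 * m + 1)) :=
  Finset.univ.map ⟨fun j : Fin m => (centre m, leftCol j), fun i j h => by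
    simpa [leftCol, Fin.ext_iff] using h⟩

theorem mem_centreRow {m : ℕ} {i j : Fin (2 * m + 1)} :
    (i, j) ∈ centreRow m ↔ i.val = m ∧ j.val < m := by
  simp only [centreRow, Finset.mem_map, Finset.mem_univ, true_and, Function.Embedding.coeFn_mk,
    Prod.mk.injEq, centre, leftCol, Fin.ext_iff]
  constructor
  · rintro ⟨k, h1, h2⟩; omega
  · rintro ⟨h1, h2⟩; exact ⟨⟨j, h2⟩, h1.symm, rfl⟩

theorem prod_centreRow {M : Type*} [CommMonoid M] {m : ℕ}
    (f : Fin (2 * m + 1) × Fin (2 * m + 1) → M) :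
    ∏ p ∈ centreRow m, f p = ∏ j : Fin m, f (centre m, leftCol j) := by
  rw [centreRow, Finset.prod_map]
  rfl

/-- The upper half of a configuration of odd order, with the left half of the central row. -/
def IceConfig.upperPart {m : ℕ} (c : IceConfig (2 * m + 1)) :
    ((Fin m → Fin (2 * m + 1 + 1) → Bool) × (Fin (m + 1) → Fin (2 * m + 1) → Bool)) ×
      (Fin (m + 1) → Bool) :=
  ((fun i j => c.1 (Fin.castLE (by omega) i) j, fun i j => c.2 (Fin.castLE (by omega) i) j),
    fun j => c.1 (centre m) (Fin.castLE (by omega) j))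

/-- The half-turn symmetric configuration with a given upper part. -/
def IceConfig.ofUpperPart {m : ℕ}
    (d : ((Fin m → Fin (2 * m + 1 + 1) → Bool) × (Fin (m + 1) → Fin (2 * m + 1) → Bool)) ×
      (Fin (m + 1) → Bool)) : IceConfig (2 * m + 1) :=
  (fun i j => if h : i.val < m then d.1.1 ⟨i, h⟩ j
      else if h2 : m < i.val then !(d.1.1 ⟨i.rev, by simp; omega⟩ j.rev)
      else if h3 : j.val ≤ m then d.2 ⟨j, Nat.lt_succ_of_le h3⟩
      else !(d.2 ⟨j.rev, by simp; omega⟩),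
    fun i j => if h : i.val ≤ m then d.1.2 ⟨i, Nat.lt_succ_of_le h⟩ j else
      !(d.1.2 ⟨i.rev, by simp; omega⟩ j.rev))

theorem IceConfig.ofUpperPart_isHalfTurn {m : ℕ}
    (d : ((Fin m → Fin (2 * m + 1 + 1) → Bool) × (Fin (m + 1) → Fin (2 * m + 1) → Bool)) ×
      (Fin (m + 1) → Bool)) : (IceConfig.ofUpperPart d).IsHalfTurn := by
  constructor
  · intro i j
    rcases lt_trichotomy i.val m with h | h | h
    · have h1 : ¬ (i.rev.val < m) := by simp [Fin.val_rev]; omega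
      have h2 : m < i.rev.val := by simp [Fin.val_rev]; omega
      simp [ofUpperPart, h, h1, h2, -Fin.val_rev]
    · have h1 : i.rev = i := by ext; simp [Fin.val_rev]; omega
      have h2 : ¬ (m < i.val) := by omega
      have h3 : ¬ (i.val < m) := by omega
      rw [h1]
      by_cases h4 : j.val ≤ m
      · have h5 : ¬ (j.rev.val ≤ m) := by simp [Fin.val_rev]; omega
        simp only [ofUpperPart, h2, h3, h4, h5, dif_pos, dif_neg, not_false_iff, Fin.rev_rev]
      · have h5 : j.rev.val ≤ m := by simp [Fin.val_rev]; omega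
        simp only [ofUpperPart, h2, h3, h4, h5, dif_pos, dif_neg, not_false_iff, Bool.not_not]
    · have h1 : i.rev.val < m := by simp [Fin.val_rev]; omega
      have h2 : ¬ (i.val < m) := by omega
      simp [ofUpperPart, h, h1, h2, -Fin.val_rev]
  · intro i j
    by_cases h : i.val ≤ m
    · have h' : ¬ (i.rev.val ≤ m) := by simp [Fin.val_rev]; omega
      simp [ofUpperPart, h, h', -Fin.val_rev]
    · have h' : i.rev.val ≤ m := by simp [Fin.val_rev]; omega
      simp [ofUpperPart, h, h', -Fin.val_rev]

theorem IceConfig.IsHalfTurn.ofUpperPart_upperPart {m : ℕ} {c : IceConfig (2 * m + 1)}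
    (hc : c.IsHalfTurn) : IceConfig.ofUpperPart c.upperPart = c := by
  refine Prod.ext (funext₂ fun i j => ?_) (funext₂ fun i j => ?_)
  · have hij := hc.1 i j
    rcases lt_trichotomy i.val m with h | h | h
    · simp [ofUpperPart, upperPart, h]
    · have h1 : i = centre m := Fin.ext h
      subst h1
      rw [rev_centre] at hij
      by_cases h4 : j.val ≤ m
      · simp [ofUpperPart, upperPart, h4, centre]
      · simp only [ofUpperPart, upperPart, h4, centre, lt_irrefl, dif_neg, not_false_iff]
        change (!(c.1 (centre m) j.rev)) = c.1 (centre m) j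
        rw [hij, Bool.not_not]
    · simp only [ofUpperPart, upperPart, h, h.le.not_gt, dif_pos, dif_neg, not_false_iff]
      rw [← Bool.not_not (c.1 i j), ← hij]
      rfl
  · by_cases h : i.val ≤ m
    · simp [ofUpperPart, upperPart, h]
    · simp only [ofUpperPart, upperPart, h, dif_neg, not_false_iff]
      rw [← Bool.not_not (c.2 i j), ← hc.2 i j]
      rfl

theorem IceConfig.upperPart_ofUpperPart {m : ℕ}
    (d : ((Fin m → Fin (2 * m + 1 + 1) → Bool) × (Fin (m + 1) → Fin (2 * m + 1) → Bool)) ×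
      (Fin (m + 1) → Bool)) : (IceConfig.ofUpperPart d).upperPart = d := by
  refine Prod.ext (Prod.ext (funext₂ fun i j => ?_) (funext₂ fun i j => ?_)) (funext fun j => ?_)
    <;> simp [ofUpperPart, upperPart, Fin.is_le, centre]

theorem IceConfig.IsHalfTurn.bottom_centre {m : ℕ} {c : IceConfig (2 * m + 1)}
    (hc : c.IsHalfTurn) (j : Fin (2 * m + 1)) :
    c.bottom (centre m) j = !(c.top (centre m) j.rev) := by
  rw [← hc.bottom_rev, rev_centre, Fin.rev_rev]

theorem IceConfig.IsHalfTurn.isState_iff_upperPart {m : ℕ} {c : IceConfig (2 * m + 1)}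
    (hc : c.IsHalfTurn) : c.IsState ↔ (((c.upperPart.1.2 0 = fun _ => true) ∧
      ∀ i, c.upperPart.1.1 i 0 = true ∧ c.upperPart.1.1 i (Fin.last _) = false) ∧
      (c.upperPart.2 0 = true ∧
        c.upperPart.2 (Fin.last m) = c.upperPart.1.2 (Fin.last m) (centre m))) ∧
      ∀ p ∈ topRows m (2 * m + 1) ∪ centreRow m, c.inDegree p.1 p.2 = 2 := by
  -- At the centre left and right edges are opposite, and so are top and bottom. The ice rule there
  -- reduces to equality of the left and the top edge: the central line turns up.
  have hcc : c.inDegree (centre m) (centre m) = 2 ↔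
      c.upperPart.2 (Fin.last m) = c.upperPart.1.2 (Fin.last m) (centre m) := by
    have h1 : c.upperPart.2 (Fin.last m) = c.left (centre m) (centre m) := rfl
    have h2 : c.upperPart.1.2 (Fin.last m) (centre m) = c.top (centre m) (centre m) := rfl
    have h3 := hc.left_rev (centre m) (centre m)
    have h4 := hc.bottom_centre (centre m)
    rw [rev_centre] at h3 h4
    rw [h1, h2, inDegree, h4, h3]
    cases c.right (centre m) (centre m) <;> cases c.top (centre m) (centre m) <;> simp
  rw [hc.isState_iff (P := fun i j => i.val < m ∨ (i.val = m ∧ j.val ≤ m)) fun i j => by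
    rw [Fin.val_rev, Fin.val_rev]; omega]
  simp only [Finset.mem_union, mem_centreRow, topRows, Finset.mem_filter, Finset.mem_univ,
    true_and, Prod.forall]
  constructor
  · rintro ⟨h1, h2, h3⟩
    refine ⟨⟨⟨funext fun j => h3 j, fun i => ⟨h2 _, ?_⟩⟩, h2 _,
      hcc.1 (h1 _ _ (Or.inr ⟨rfl, le_rfl⟩))⟩, fun i j h => h1 i j (by omega)⟩
    have := hc.1 (Fin.castLE (by omega) i).rev 0
    rw [Fin.rev_rev, h2, Fin.rev_zero] at this
    exact this
  · rintro ⟨⟨⟨h1, h2⟩, h4, h5⟩, h3⟩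
    refine ⟨fun i j h => ?_, fun i => ?_, fun j => congrFun h1 j⟩
    · by_cases h' : i.val = m ∧ j.val = m
      · obtain rfl : i = centre m := Fin.ext h'.1
        obtain rfl : j = centre m := Fin.ext h'.2
        exact hcc.2 h5
      · exact h3 i j (by omega)
    · rcases lt_trichotomy i.val m with h | h | h
      · exact (h2 ⟨i, h⟩).1
      · obtain rfl : i = centre m := Fin.ext h
        exact h4
      · have h' : i.rev.val < m := by simp [Fin.val_rev]; omega
        have h4 := (h2 ⟨i.rev, h'⟩).2
        have := hc.1 i.rev (Fin.last _)
        rw [Fin.rev_rev, Fin.rev_last] at this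
        rw [this]
        exact congrArg (fun b => !b) h4

theorem ofFn_foldIndex_odd {α : Type*} (m : ℕ) (h : 2 * m + 1 ≤ 2 * (m + 1))
    (y : Fin (m + 1) → α) : (List.ofFn fun r : Fin (2 * m + 1) => y (foldIndex h r)) =
      List.ofFn (fun j : Fin m => y j.castSucc) ++
        y (Fin.last m) :: (List.ofFn fun j : Fin m => y j.castSucc).reverse := by
  rw [ofFn_odd]
  have h1 : ∀ j : Fin m, foldIndex h (leftCol j) = j.castSucc := fun j => by
    ext; simp [foldIndex, leftCol, Fin.val_rev]; omega
  have h2 : foldIndex h (centre m) = Fin.last m := by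
    ext; simp [foldIndex, centre, Fin.val_rev]; omega
  simp only [foldIndex_rev, h1, h2]

/-- A half-turn symmetric state is determined by its upper m rows and the left half of its central
row. The edge below a vertex of that half row is opposite to the edge above the mirror vertex, which
is the pairing imposed by `htEnd`; the half row with its turn at the centre is the operator
`lineAct`. -/
theorem sum_oddWeight_eq_rowFold (a : K) (κ : Bool → K) (m : ℕ) (x y : Fin (m + 1) → K) :
    (∑ c : IceConfig (2 * m + 1) with c.IsState ∧ c.IsHalfTurn,
      κ (c.left (centre m) (centre m)) * oddWeight a m x y c) =
    rowFold a (List.ofFn fun i : Fin m => x i.castSucc)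
      (List.ofFn (fun j : Fin m => y j.castSucc) ++
        y (Fin.last m) :: (List.ofFn fun j : Fin m => y j.castSucc).reverse)
      (lineAct a (x (Fin.last m)) κ true (List.ofFn fun j : Fin m => y j.castSucc) (htEnd K))
      (List.replicate (2 * m + 1) true) := by
  rw [← List.ofFn_const, ← ofFn_foldIndex_odd m (by omega), rowFold_ofFn,
    ← Fintype.sum_prod_type']
  simp only [lineAct_ofFn, Finset.mul_sum]
  rw [← Fintype.sum_prod_type']
  simp only [and_comm (b := IceConfig.IsHalfTurn _)]
  rw [← Finset.filter_filter, Finset.sum_filter]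
  refine Finset.sum_bij' (fun c _ => c.upperPart) (fun d _ => IceConfig.ofUpperPart d)
    ?_ ?_ ?_ ?_ ?_
  · simp
  · intro d hd
    simpa using IceConfig.ofUpperPart_isHalfTurn d
  · intro c hc
    exact (Finset.mem_filter.1 hc).2.ofUpperPart_upperPart
  · intro d _
    exact IceConfig.upperPart_ofUpperPart d
  · intro c hc
    have hh := (Finset.mem_filter.1 hc).2
    have hle : 2 * m + 1 ≤ 2 * (m + 1) := by omega
    have key := IceConfig.prod_iceWeight c a (fun r => x (foldIndex hle r))
      (fun r => y (foldIndex hle r)) (topRows m (2 * m + 1) ∪ centreRow m)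
    have hdisj : Disjoint (topRows m (2 * m + 1)) (centreRow m) := by
      rw [Finset.disjoint_left]
      rintro ⟨i, j⟩ h1 h2
      rw [mem_centreRow] at h2
      simp only [topRows, Finset.mem_filter] at h1
      omega
    rw [Finset.prod_union hdisj, prod_topRows (by omega), prod_centreRow] at key
    have h2 : ∀ (i : Fin m) (j : Fin (2 * m + 1)), iceWeight a
        (x i.castSucc * (y (foldIndex hle j))⁻¹)
        (c.upperPart.1.1 i j.castSucc) (c.upperPart.1.1 i j.succ) (c.upperPart.1.2 i.castSucc j)
        (c.upperPart.1.2 i.succ j) =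
        iceWeight a (x (foldIndex hle (Fin.castLE (by omega : m ≤ 2 * m + 1) i)) *
          (y (foldIndex hle j))⁻¹) (c.left (Fin.castLE (by omega) i) j)
          (c.right (Fin.castLE (by omega) i) j) (c.top (Fin.castLE (by omega) i) j)
          (c.bottom (Fin.castLE (by omega) i) j) := by
      intro i j
      have : foldIndex hle (Fin.castLE (by omega : m ≤ 2 * m + 1) i) = i.castSucc := by
        ext; simp [foldIndex, Fin.val_rev]; omega
      rw [this]; rfl
    have h3 : ∀ j : Fin m, iceWeight a (x (Fin.last m) * (y j.castSucc)⁻¹)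
        (c.upperPart.2 j.castSucc) (c.upperPart.2 j.succ)
        (c.upperPart.1.2 (Fin.last m) (leftCol j)) (!(c.upperPart.1.2 (Fin.last m) (leftCol j).rev))
        = iceWeight a (x (foldIndex hle (centre m)) * (y (foldIndex hle (leftCol j)))⁻¹)
          (c.left (centre m) (leftCol j)) (c.right (centre m) (leftCol j))
          (c.top (centre m) (leftCol j)) (c.bottom (centre m) (leftCol j)) := by
      intro j
      have h4 : foldIndex hle (centre m) = Fin.last m := by
        ext; simp [foldIndex, centre, Fin.val_rev]; omega
      have h5 : foldIndex hle (leftCol j) = j.castSucc := by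
        ext; simp [foldIndex, leftCol, Fin.val_rev]; omega
      rw [hh.bottom_centre, h4, h5]; rfl
    simp only [h2, h3]
    have hiff := hh.isState_iff_upperPart
    have hw : ∀ (p q : Prop) [Decidable p] [Decidable q] (A B k : K),
        (if p then A else 0) * (if q then k * B else 0) =
        if p ∧ q then k * (A * B) else 0 := by
      intro p q _ _ A B k
      by_cases hp : p <;> by_cases hq : q <;> simp [hp, hq]; ring
    rw [hw, key]
    by_cases hs : c.IsState
    · obtain ⟨h3, h4⟩ := hiff.1 hs
      rw [if_pos hs, if_pos h3, if_pos h4, ← h3.2.2]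
      congr 1
      refine hh.weight_eq hs a ?_ ?_ ?_ ?_ ?_
      · simp [foldIndex_rev]
      · simp [foldIndex_rev]
      · simp [oddDomain, Fin.val_rev]; omega
      · simp [topRows, mem_centreRow, Fin.val_rev]; omega
      · simp [oddDomain, topRows, mem_centreRow, Fin.val_rev]; omega
    · rw [if_neg hs]
      split_ifs with h3 h4
      · exact absurd (hiff.2 ⟨h3, h4⟩) hs
      · simp
      · rfl

theorem zHTOddCentral_eq_sum (a : K) (κ : Bool → K) (m : ℕ) (x y : Fin (m + 1) → K) :
    κ true * zHTOddCentral a 1 m x y + κ false * zHTOddCentral a (-1) m x y =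
    ∑ c : IceConfig (2 * m + 1) with c.IsState ∧ c.IsHalfTurn,
      κ (c.left (centre m) (centre m)) * oddWeight a m x y c := by
  simp only [zHTOddCentral, Finset.sum_filter, Finset.mul_sum, ← Finset.sum_add_distrib]
  refine Finset.sum_congr rfl fun c _ => ?_
  by_cases hs : c.IsState <;> by_cases hh : c.IsHalfTurn <;> simp only [hs, hh, true_and,
    false_and, and_false, if_true, if_false, add_zero, mul_zero]
  have := hh.left_rev (centre m) (centre m)
  rw [rev_centre] at this
  simp only [IceConfig.toMatrix, this]
  cases c.right (centre m) (centre m) <;> simp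

end Bridge

/-! ### Laurent polynomials as functions -/

section Laurent

open Polynomial

variable {K : Type*} [Field K]

/-- On nonzero arguments, `f` is a Laurent polynomial with exponents between `-W` and `W`. -/
def IsLaurent (W : ℕ) (f : K → K) : Prop :=
  ∃ p : K[X], p.natDegree ≤ 2 * W ∧ ∀ t : K, t ≠ 0 → f t * t ^ W = p.eval t

namespace IsLaurent

variable {W W' : ℕ} {f g : K → K}

theorem congr (hf : IsLaurent W f) (h : ∀ t, t ≠ 0 → g t = f t) : IsLaurent W g := by
  obtain ⟨p, hp, hpf⟩ := hf
  exact ⟨p, hp, fun t ht => by rw [h t ht, hpf t ht]⟩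

theorem mono (hf : IsLaurent W f) (h : W ≤ W') : IsLaurent W' f := by
  obtain ⟨p, hp, hpf⟩ := hf
  obtain ⟨k, rfl⟩ := Nat.exists_eq_add_of_le h
  refine ⟨p * X ^ k, natDegree_mul_le.trans ?_, fun t ht => ?_⟩
  · rw [natDegree_X_pow]; omega
  · rw [pow_add, ← mul_assoc, hpf t ht]; simp

theorem const (c : K) : IsLaurent 0 fun _ => c := ⟨C c, by simp, by simp⟩

theorem add (hf : IsLaurent W f) (hg : IsLaurent W g) : IsLaurent W fun t => f t + g t := by
  obtain ⟨p, hp, hpf⟩ := hf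
  obtain ⟨q, hq, hqg⟩ := hg
  refine ⟨p + q, (natDegree_add_le _ _).trans (max_le hp hq), fun t ht => ?_⟩
  rw [add_mul, hpf t ht, hqg t ht, eval_add]

theorem mul (hf : IsLaurent W f) (hg : IsLaurent W' g) :
    IsLaurent (W + W') fun t => f t * g t := by
  obtain ⟨p, hp, hpf⟩ := hf
  obtain ⟨q, hq, hqg⟩ := hg
  refine ⟨p * q, natDegree_mul_le.trans (by omega), fun t ht => ?_⟩
  rw [pow_add, mul_mul_mul_comm, hpf t ht, hqg t ht, eval_mul]

theorem const_mul (c : K) (hf : IsLaurent W f) : IsLaurent W fun t => c * f t := by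
  simpa using (const c).mul hf

theorem mul_const (hf : IsLaurent W f) (c : K) : IsLaurent W fun t => f t * c := by
  simpa using hf.mul (const c)

theorem sub (hf : IsLaurent W f) (hg : IsLaurent W g) : IsLaurent W fun t => f t - g t :=
  (hf.add (hg.const_mul (-1))).congr fun t _ => by ring

theorem zero : IsLaurent W fun _ : K => 0 := (const 0).mono (Nat.zero_le _)

theorem sum {ι : Type*} {s : Finset ι} {F : ι → K → K} (h : ∀ i ∈ s, IsLaurent W (F i)) :
    IsLaurent W fun t => ∑ i ∈ s, F i t := by
  classical
  induction s using Finset.induction_on with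
  | empty => simpa using zero
  | insert i s hi ih =>
    simp only [Finset.sum_insert hi]
    exact (h i (by simp)).add (ih fun j hj => h j (by simp [hj]))

theorem prod {ι : Type*} {s : Finset ι} {w : ι → ℕ} {F : ι → K → K}
    (h : ∀ i ∈ s, IsLaurent (w i) (F i)) : IsLaurent (∑ i ∈ s, w i) fun t => ∏ i ∈ s, F i t := by
  classical
  induction s using Finset.induction_on with
  | empty => simpa using const 1
  | insert i s hi ih =>
    simp only [Finset.prod_insert hi, Finset.sum_insert hi]
    exact (h i (by simp)).mul (ih fun j hj => h j (by simp [hj]))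

theorem zpow (c : K) (k : ℤ) : IsLaurent k.natAbs fun t => c * t ^ k := by
  refine ⟨C c * X ^ (k + k.natAbs).toNat, natDegree_C_mul_X_pow_le _ _ |>.trans (by omega),
    fun t ht => ?_⟩
  rw [eval_mul, eval_C, eval_pow, eval_X, mul_assoc, ← zpow_natCast, ← zpow_natCast,
    ← zpow_add₀ ht, Int.toNat_of_nonneg (by omega)]

theorem iceSigma_zpow (c : K) (k : ℤ) : IsLaurent k.natAbs fun t => iceSigma (c * t ^ k) := by
  refine ((zpow c k).sub ((zpow c⁻¹ (-k)).mono (by omega))).congr fun t _ => ?_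
  rw [iceSigma, mul_inv, zpow_neg]

theorem eq_zero_of_card_lt (hf : IsLaurent W f) (S : Finset K) (hS : 2 * W < S.card)
    (h0 : ∀ t ∈ S, t ≠ 0) (hz : ∀ t ∈ S, f t = 0) {t : K} (ht : t ≠ 0) : f t = 0 := by
  obtain ⟨p, hp, hpf⟩ := hf
  have hp0 : p = 0 := eq_zero_of_natDegree_lt_card_of_eval_eq_zero' p S
    (fun s hs => by rw [← hpf s (h0 s hs), hz s hs, zero_mul]) (by omega)
  have := hpf t ht
  rw [hp0, eval_zero] at this
  exact (mul_eq_zero.1 this).resolve_right (pow_ne_zero _ ht)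

/-- This removes genericity assumptions: on a suitable curve through the given point t = 1 they fail
for finitely many t only. -/
theorem eq_zero_of_finite [Infinite K] (hf : IsLaurent W f) {B : Set K} (hB : B.Finite)
    (h : ∀ t, t ≠ 0 → t ∉ B → f t = 0) : f 1 = 0 := by
  have hinf : ((B ∪ {0})ᶜ : Set K).Infinite := (hB.union (Set.finite_singleton 0)).infinite_compl
  obtain ⟨S, hS, hcard⟩ := hinf.exists_subset_card_eq (2 * W + 1)
  have hS' : ∀ t ∈ S, t ≠ 0 ∧ t ∉ B := fun t ht => by
    have := hS ht
    simp only [Set.mem_compl_iff, Set.mem_union, Set.mem_singleton_iff, not_or] at this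
    exact this.symm
  exact hf.eq_zero_of_card_lt S (by omega) (fun t ht => (hS' t ht).1)
    (fun t ht => h t (hS' t ht).1 (hS' t ht).2) one_ne_zero

end IsLaurent

theorem finite_zpow_eq {k : ℤ} (hk : k ≠ 0) (c : K) : {t : K | t ≠ 0 ∧ t ^ k = c}.Finite := by
  classical
  have hX : ∀ (n : ℕ) (d : K), 0 < n → {t : K | t ^ n = d}.Finite := fun n d hn => by
    refine ((X ^ n - C d : K[X]).roots.toFinset.finite_toSet).subset fun t ht => ?_
    have hne := X_pow_sub_C_ne_zero hn d
    simpa [hne, sub_eq_zero] using ht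
  rcases lt_or_gt_of_ne hk with h | h
  · refine (hX k.natAbs c⁻¹ (by omega)).subset ?_
    rintro t ⟨ht, rfl⟩
    rw [Set.mem_ofPred_eq, ← zpow_neg, ← zpow_natCast]
    congr 1; omega
  · refine (hX k.natAbs c (by omega)).subset ?_
    rintro t ⟨ht, rfl⟩
    rw [Set.mem_ofPred_eq, ← zpow_natCast]
    congr 1; omega

/-- Each triple (i, j, d) provides the two zeros t = ± a^d q_j / p_i. Genericity makes all of them
distinct, and these 2 |S| > 2 W values exceed the degree 2 W. -/
theorem eq_zero_of_zeros_of_generic [CharZero K] {n : ℕ} {a : K} (ha : a ≠ 0)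
    (Δ : (Fin n → K) → (Fin n → K) → K) {W : ℕ} (S : Finset (Fin n × Fin n × ℤ))
    (hS : W < S.card)
    (hz : ∀ s ∈ S, ∀ p q : Fin n → K, (∀ i, p i ≠ 0) → (∀ j, q j ≠ 0) →
      p s.1 ^ 2 = (a ^ s.2.2 * q s.2.1) ^ 2 → Δ p q = 0)
    (p q : Fin n → K) (hp : ∀ i, p i ≠ 0) (hq : ∀ j, q j ≠ 0)
    (hW : IsLaurent W fun t => Δ (fun i => p i * t) q)
    (hgen : ∀ s ∈ S, ∀ s' ∈ S, s ≠ s' →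
      (a ^ s.2.2 * q s.2.1 / p s.1) ^ 2 ≠ (a ^ s'.2.2 * q s'.2.1 / p s'.1) ^ 2) :
    Δ p q = 0 := by
  classical
  set r : Fin n × Fin n × ℤ → K := fun s => a ^ s.2.2 * q s.2.1 / p s.1 with hr
  have hr0 : ∀ s, r s ≠ 0 := fun s =>
    div_ne_zero (mul_ne_zero (zpow_ne_zero _ ha) (hq _)) (hp _)
  set ρ : (Fin n × Fin n × ℤ) × Bool → K := fun s => if s.2 = true then r s.1 else -r s.1 with hρ
  have hρ2 : ∀ s, ρ s ^ 2 = r s.1 ^ 2 := by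
    rintro ⟨s, b⟩
    cases b <;> simp [hρ]
  have hρ0 : ∀ s, ρ s ≠ 0 := fun s h => hr0 s.1 (by
    have := hρ2 s
    rw [h, zero_pow two_ne_zero] at this
    exact (pow_eq_zero_iff two_ne_zero).1 this.symm)
  have hinj : Set.InjOn ρ (S ×ˢ (Finset.univ : Finset Bool) : Finset _) := by
    rintro ⟨s, b⟩ hs ⟨s', b'⟩ hs' h
    simp only [Finset.coe_product, Set.mem_prod, Finset.mem_coe] at hs hs'
    have hss : s = s' := by
      by_contra hne
      refine hgen s hs.1 s' hs'.1 hne ?_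
      have h1 := hρ2 (s, b)
      rw [h, hρ2] at h1
      exact h1.symm
    subst hss
    have hne : r s ≠ -r s := fun h => hr0 s (self_eq_neg.1 h)
    cases b <;> cases b'
    · rfl
    · exact absurd h.symm hne
    · exact absurd h hne
    · rfl
  have key := hW.eq_zero_of_card_lt ((S ×ˢ (Finset.univ : Finset Bool)).image ρ)
    ?_ ?_ ?_ one_ne_zero
  · simpa only [mul_one] using key
  · rw [Finset.card_image_of_injOn hinj, Finset.card_product, Finset.card_univ, Fintype.card_bool]
    omega
  · intro t ht
    obtain ⟨s, -, rfl⟩ := Finset.mem_image.1 ht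
    exact hρ0 s
  · intro t ht
    obtain ⟨s, hs, rfl⟩ := Finset.mem_image.1 ht
    refine hz s.1 (Finset.mem_product.1 hs).1 _ q (fun i => mul_ne_zero (hp i) (hρ0 s)) hq ?_
    rw [mul_pow, hρ2, hr]
    have := hp s.1.1
    field_simp

/-- If the exponents on the two sides differ, the condition fixes a nonzero power of t. If they
agree, the triples share i and j and differ in d only, and then a² = 1 or a⁴ = 1 would follow. -/
theorem finite_setOf_eq_of_laurent {n : ℕ} {a : K} (ha : a ≠ 0) (ha4 : a ^ 4 ≠ 1)
    (p q : Fin n → K) (hp : ∀ i, p i ≠ 0) (hq : ∀ j, q j ≠ 0) {s s' : Fin n × Fin n × ℤ}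
    (hne : s ≠ s') (hd : s.2.2 = -1 ∨ s.2.2 = 0 ∨ s.2.2 = 1)
    (hd' : s'.2.2 = -1 ∨ s'.2.2 = 0 ∨ s'.2.2 = 1) (e f : Fin n → ℤ)
    (hef : ∀ i j i' j', f j - e i = f j' - e i' → i = i' ∧ j = j') :
    {t : K | t ≠ 0 ∧ (a ^ s.2.2 * (q s.2.1 * t ^ f s.2.1) / (p s.1 * t ^ e s.1)) ^ 2 =
      (a ^ s'.2.2 * (q s'.2.1 * t ^ f s'.2.1) / (p s'.1 * t ^ e s'.1)) ^ 2}.Finite := by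
  have hr0 : ∀ s : Fin n × Fin n × ℤ, a ^ s.2.2 * q s.2.1 / p s.1 ≠ 0 := fun s =>
    div_ne_zero (mul_ne_zero (zpow_ne_zero _ ha) (hq _)) (hp _)
  have hpow : ∀ (t : K), t ≠ 0 → ∀ s : Fin n × Fin n × ℤ,
      (a ^ s.2.2 * (q s.2.1 * t ^ f s.2.1) / (p s.1 * t ^ e s.1)) ^ 2 =
      (a ^ s.2.2 * q s.2.1 / p s.1) ^ 2 * (t ^ (f s.2.1 - e s.1)) ^ 2 := by
    intro t ht s
    rw [zpow_sub₀ ht]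
    have := hp s.1
    have := zpow_ne_zero (e s.1) ht
    field_simp
  by_cases hk : f s.2.1 - e s.1 = f s'.2.1 - e s'.1
  · refine Set.Finite.subset Set.finite_empty ?_
    rintro t ⟨ht, h⟩
    rw [hpow t ht, hpow t ht, hk, mul_left_inj' (pow_ne_zero _ (zpow_ne_zero _ ht))] at h
    obtain ⟨i, j, d⟩ := s
    obtain ⟨i', j', d'⟩ := s'
    obtain ⟨rfl, rfl⟩ := hef _ _ _ _ hk
    have hdd : d ≠ d' := fun h => hne (by rw [h])
    simp only at h hd hd'
    rw [div_pow, div_pow, mul_pow, mul_pow, div_left_inj' (pow_ne_zero _ (hp _)),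
      mul_left_inj' (pow_ne_zero _ (hq _))] at h
    have h2 : a ^ (-1 : ℤ) * a = 1 := by rw [zpow_neg_one, inv_mul_cancel₀ ha]
    apply ha4
    rcases hd with rfl | rfl | rfl <;> rcases hd' with rfl | rfl | rfl <;>
      simp only [ne_eq, not_true_eq_false, zpow_zero, zpow_one] at h hdd
    · linear_combination (a ^ 2 * h - (a ^ (-1 : ℤ) * a + 1) * h2) * (-1 - a ^ 2)
    · linear_combination -a ^ 2 * h + (a ^ (-1 : ℤ) * a + 1) * h2
    · linear_combination (a ^ 2 * h + (a ^ (-1 : ℤ) * a + 1) * h2) * (1 + a ^ 2)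
    · linear_combination -h * (1 + a ^ 2)
    · linear_combination a ^ 2 * h + (a ^ (-1 : ℤ) * a + 1) * h2
    · linear_combination h * (1 + a ^ 2)
  · refine (finite_zpow_eq (k := 2 * ((f s.2.1 - e s.1) - (f s'.2.1 - e s'.1))) (by omega)
      ((a ^ s'.2.2 * q s'.2.1 / p s'.1) ^ 2 / (a ^ s.2.2 * q s.2.1 / p s.1) ^ 2)).subset ?_
    rintro t ⟨ht, h⟩
    refine ⟨ht, ?_⟩
    rw [hpow t ht, hpow t ht] at h
    rw [mul_comm, zpow_mul, zpow_sub₀ ht, eq_div_iff (pow_ne_zero _ (hr0 s))]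
    have h5 : (t ^ (f s'.2.1 - e s'.1)) ≠ 0 := zpow_ne_zero _ ht
    rw [show ((2 : ℤ)) = ((2 : ℕ) : ℤ) by rfl, zpow_natCast, div_pow, div_mul_eq_mul_div,
      div_eq_iff (pow_ne_zero _ h5)]
    linear_combination h

/-- A function of `p` and `q` that is a Laurent polynomial on all monomial curves, has width `W`
in a common scale of the `p i`, and vanishes for `p i = ± a ^ d * q j` for more than `W` triples
`(i, j, d)` with `d ∈ {-1, 0, 1}`, is zero. -/
theorem eq_zero_of_laurent_of_zeros [CharZero K] {n : ℕ} {a : K} (ha : a ≠ 0) (ha4 : a ^ 4 ≠ 1)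
    (Δ : (Fin n → K) → (Fin n → K) → K)
    (hΔ : ∀ p q : Fin n → K, (∀ i, p i ≠ 0) → (∀ j, q j ≠ 0) → ∀ e f : Fin n → ℤ,
      ∃ W, IsLaurent W fun t => Δ (fun i => p i * t ^ e i) (fun j => q j * t ^ f j))
    {W : ℕ} (hW : ∀ p q : Fin n → K, (∀ i, p i ≠ 0) → (∀ j, q j ≠ 0) →
      IsLaurent W fun t => Δ (fun i => p i * t) q)
    (S : Finset (Fin n × Fin n × ℤ)) (hd : ∀ s ∈ S, s.2.2 = -1 ∨ s.2.2 = 0 ∨ s.2.2 = 1)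
    (hS : W < S.card)
    (hz : ∀ s ∈ S, ∀ p q : Fin n → K, (∀ i, p i ≠ 0) → (∀ j, q j ≠ 0) →
      p s.1 ^ 2 = (a ^ s.2.2 * q s.2.1) ^ 2 → Δ p q = 0)
    (p q : Fin n → K) (hp : ∀ i, p i ≠ 0) (hq : ∀ j, q j ≠ 0) : Δ p q = 0 := by
  have : Infinite K := CharZero.infinite K
  -- The differences n (j + 1) - i are distinct for distinct pairs (i, j), as an expansion in base n
  -- shows. So on this curve different zeros collide for finitely many t only.
  set e : Fin n → ℤ := fun i => i with he
  set f : Fin n → ℤ := fun j => n * (j + 1) with hf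
  have hef : ∀ i j i' j', f j - e i = f j' - e i' → i = i' ∧ j = j' := by
    intro i j i' j' hk
    simp only [he, hf] at hk
    have h2 : (i' : ℕ) + n * j = i + n * j' := by zify; linarith
    have h3 : (i' : ℕ) = i := by
      have := congrArg (· % n) h2
      simpa [Nat.add_mul_mod_self_left, Nat.mod_eq_of_lt] using this
    have h4 : n * (j : ℕ) = n * j' := by omega
    exact ⟨Fin.ext h3.symm, Fin.ext (Nat.eq_of_mul_eq_mul_left i.pos h4)⟩
  obtain ⟨W', hW'⟩ := hΔ p q hp hq e f
  set B : Set K := ⋃ s ∈ S, ⋃ s' ∈ S, ⋃ (_ : s ≠ s'), {t : K | t ≠ 0 ∧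
    (a ^ s.2.2 * (q s.2.1 * t ^ f s.2.1) / (p s.1 * t ^ e s.1)) ^ 2 =
      (a ^ s'.2.2 * (q s'.2.1 * t ^ f s'.2.1) / (p s'.1 * t ^ e s'.1)) ^ 2} with hB
  have hBfin : B.Finite :=
    S.finite_toSet.biUnion fun s hs => S.finite_toSet.biUnion fun s' hs' =>
      Set.finite_iUnion fun hne =>
        finite_setOf_eq_of_laurent ha ha4 p q hp hq hne (hd s hs) (hd s' hs') e f hef
  have h1 := hW'.eq_zero_of_finite hBfin fun t ht htB => ?_
  · simpa only [one_zpow, mul_one] using h1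
  · have hp' : ∀ i, p i * t ^ e i ≠ 0 := fun i => mul_ne_zero (hp i) (zpow_ne_zero _ ht)
    have hq' : ∀ j, q j * t ^ f j ≠ 0 := fun j => mul_ne_zero (hq j) (zpow_ne_zero _ ht)
    refine eq_zero_of_zeros_of_generic ha Δ S hS hz _ _ hp' hq' (hW _ _ hp' hq')
      fun s hs s' hs' hne h => htB ?_
    simp only [hB, Set.mem_iUnion]
    exact ⟨s, hs, s', hs', hne, ht, h⟩

end Laurent

/-! ### The partition functions on monomial curves -/

section Width

open scoped Classical

variable {K : Type*} [Field K]

theorem IceConfig.isLaurent_weight {n : ℕ} (c : IceConfig n) (a : K) (x y : Fin n → K)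
    (e f : Fin n → ℤ) (D : Finset (Fin n × Fin n)) :
    IsLaurent (∑ p ∈ D, if c.left p.1 p.2 = c.right p.1 p.2 then (e p.1 - f p.2).natAbs else 0)
      fun t => c.weight a (fun i => x i * t ^ e i) (fun j => y j * t ^ f j) D := by
  refine IsLaurent.prod fun p _ => ?_
  have h : ∀ t : K, t ≠ 0 → x p.1 * t ^ e p.1 * (y p.2 * t ^ f p.2)⁻¹ =
      x p.1 * (y p.2)⁻¹ * t ^ (e p.1 - f p.2) := fun t ht => by
    rw [zpow_sub₀ ht, mul_inv]; ring
  by_cases h1 : c.left p.1 p.2 = c.right p.1 p.2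
  · rw [if_pos h1]
    by_cases h2 : c.left p.1 p.2 = c.top p.1 p.2
    · refine (IsLaurent.iceSigma_zpow (a * (x p.1 * (y p.2)⁻¹)) (e p.1 - f p.2)).congr
        fun t ht => ?_
      rw [vertexWeight, if_neg (not_not.2 h1), if_pos h2, h t ht]
      congr 1; ring
    · refine ((IsLaurent.iceSigma_zpow (a * (x p.1 * (y p.2)⁻¹)⁻¹) (-(e p.1 - f p.2))).mono
        (by omega)).congr fun t ht => ?_
      rw [vertexWeight, if_neg (not_not.2 h1), if_neg h2, h t ht, mul_inv _ (t ^ _), zpow_neg,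
        mul_assoc]
  · rw [if_neg h1]
    refine (IsLaurent.const (iceSigma (a ^ 2))).congr fun t _ => ?_
    rw [vertexWeight, if_pos h1]

theorem IceConfig.isLaurent_weight' {n : ℕ} (c : IceConfig n) (a : K) (x y : Fin n → K)
    (e f : Fin n → ℤ) (D : Finset (Fin n × Fin n)) :
    IsLaurent (∑ p ∈ D, (e p.1 - f p.2).natAbs)
      fun t => c.weight a (fun i => x i * t ^ e i) (fun j => y j * t ^ f j) D :=
  (c.isLaurent_weight a x y e f D).mono (Finset.sum_le_sum fun p _ => by split_ifs <;> simp)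

/-- If the entry at some vertex of `D` is not `0`, the weight has a smaller width in a common
scale of the row parameters. -/
theorem IceConfig.isLaurent_weight_of_left_ne {n : ℕ} {c : IceConfig n} (a : K) (x y : Fin n → K)
    {D : Finset (Fin n × Fin n)} {p : Fin n × Fin n} (hp : p ∈ D)
    (h : c.left p.1 p.2 ≠ c.right p.1 p.2) :
    IsLaurent (D.card - 1) fun t => c.weight a (fun i => x i * t) y D := by
  have h1 := c.isLaurent_weight a x y 1 0 D
  simp only [Pi.one_apply, Pi.zero_apply, zpow_one, zpow_zero, mul_one] at h1
  refine h1.mono ?_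
  rw [← Finset.card_erase_of_mem hp, Finset.card_eq_sum_ones, ← Finset.add_sum_erase D _ hp,
    if_neg h, zero_add]
  exact Finset.sum_le_sum fun q _ => by split_ifs <;> simp

theorem IceConfig.IsState.exists_left_ne {n : ℕ} {c : IceConfig n} (hc : c.IsState) (i : Fin n) :
    ∃ j, c.left i j ≠ c.right i j := by
  by_contra! h
  have key : ∀ j, c.1 i j = true := fun j => by
    induction j using Fin.induction with
    | zero => exact hc.2.1 i
    | succ j ih => rw [← ih]; exact (h j).symm
  have := key (Fin.last n)
  rw [hc.2.2.1] at this
  exact Bool.false_ne_true this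

theorem isLaurent_zDW (a : K) (n : ℕ) (x y : Fin n → K) (e f : Fin n → ℤ) :
    IsLaurent (∑ p : Fin n × Fin n, (e p.1 - f p.2).natAbs)
      fun t => zDW a n (fun i => x i * t ^ e i) (fun j => y j * t ^ f j) :=
  IsLaurent.sum fun c _ => c.isLaurent_weight' a x y e f _

/-- Each state has a nonzero entry in the first row; its weight σ(a²) is constant, which lowers the
width n² by one. Without this saving the interpolation for even order would lack a zero. -/
theorem isLaurent_zDW_scale (a : K) {n : ℕ} (hn : n ≠ 0) (x y : Fin n → K) :
    IsLaurent (n ^ 2 - 1) fun t => zDW a n (fun i => x i * t) y := by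
  refine IsLaurent.sum fun c hc => ?_
  obtain ⟨j, hj⟩ := (Finset.mem_filter.1 hc).2.exists_left_ne ⟨0, Nat.pos_of_ne_zero hn⟩
  have h2 := IceConfig.isLaurent_weight_of_left_ne a x y (D := Finset.univ) (p := (_, j))
    (Finset.mem_univ _) hj
  exact h2.mono (by simp [sq])

theorem isLaurent_zHTEven (a : K) (m : ℕ) (x y : Fin m → K) (e f : Fin m → ℤ) :
    ∃ W, IsLaurent W fun t => zHTEven a m (fun i => x i * t ^ e i) (fun j => y j * t ^ f j) :=
  ⟨_, IsLaurent.sum fun c _ => c.isLaurent_weight' a (fun r => x (foldIndex le_rfl r))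
    (fun r => y (foldIndex le_rfl r)) (fun r => e (foldIndex le_rfl r))
    (fun r => f (foldIndex le_rfl r)) _⟩

theorem card_evenDomain (m : ℕ) : (evenDomain m).card = 2 * m ^ 2 := by
  have : evenDomain m = (Finset.univ : Finset (Fin (2 * m))) ×ˢ
      (Finset.univ.filter fun j : Fin (2 * m) => j.val < m) := by
    ext ⟨i, j⟩; simp [evenDomain]
  rw [this, Finset.card_product, Fin.card_filter_val_lt, Finset.card_univ, Fintype.card_fin,
    min_eq_right (by omega)]
  ring

/-- Again one vertex of weight σ(a²) saves one; if it lies in the right half, its image under the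
half-turn is used. -/
theorem isLaurent_zHTEven_scale (a : K) {m : ℕ} (hm : m ≠ 0) (x y : Fin m → K) :
    IsLaurent (2 * m ^ 2 - 1) fun t => zHTEven a m (fun i => x i * t) y := by
  refine IsLaurent.sum fun c hc => ?_
  obtain ⟨hs, hh⟩ := (Finset.mem_filter.1 hc).2
  obtain ⟨j, hj⟩ := hs.exists_left_ne ⟨0, by omega⟩
  have h1 : ∃ p ∈ evenDomain m, c.left p.1 p.2 ≠ c.right p.1 p.2 := by
    by_cases h : j.val < m
    · exact ⟨(_, j), by simp [evenDomain, h], hj⟩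
    · refine ⟨(Fin.rev ⟨0, by omega⟩, j.rev), ?_, ?_⟩
      · simp only [evenDomain, Finset.mem_filter, Finset.mem_univ, true_and, Fin.val_rev]
        omega
      change c.left (Fin.rev _) j.rev ≠ c.right (Fin.rev _) j.rev
      rw [hh.left_rev, hh.right_rev]
      exact fun h => hj (Bool.not_inj h).symm
  obtain ⟨p, hp, hpc⟩ := h1
  have h2 := IceConfig.isLaurent_weight_of_left_ne a (fun r => x (foldIndex le_rfl r))
    (fun r => y (foldIndex le_rfl r)) hp hpc
  rw [card_evenDomain] at h2
  exact h2

theorem isLaurent_zHTOddCentral' (a : K) (ε : ℤ) (m : ℕ) (x y : Fin (m + 1) → K)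
    (e f : Fin (m + 1) → ℤ) :
    IsLaurent (∑ p ∈ oddDomain m,
        (e (foldIndex (by omega) p.1) - f (foldIndex (by omega) p.2)).natAbs)
      fun t => zHTOddCentral a ε m (fun i => x i * t ^ e i) (fun j => y j * t ^ f j) :=
  IsLaurent.sum fun c _ => c.isLaurent_weight' a (fun r => x (foldIndex (by omega) r))
    (fun r => y (foldIndex (by omega) r)) (fun r => e (foldIndex (by omega) r))
    (fun r => f (foldIndex (by omega) r)) _

theorem isLaurent_zHTOddCentral (a : K) (ε : ℤ) (m : ℕ) (x y : Fin (m + 1) → K)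
    (e f : Fin (m + 1) → ℤ) :
    ∃ W, IsLaurent W
      fun t => zHTOddCentral a ε m (fun i => x i * t ^ e i) (fun j => y j * t ^ f j) :=
  ⟨_, isLaurent_zHTOddCentral' a ε m x y e f⟩

/-- The exponents of the scale in which all but the last of the row parameters and the last
column parameter are multiplied. -/
def rowScale {m : ℕ} (i : Fin (m + 1)) : ℤ := if i = Fin.last m then 0 else 1

/-- See `rowScale`. -/
def colScale {m : ℕ} (j : Fin (m + 1)) : ℤ := if j = Fin.last m then 1 else 0

/-- In this scale the quotients x_i/v and u/y_j are constant, so only the 2m · m vertices in the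
left columns outside the central row contribute. -/
theorem isLaurent_zHTOddCentral_scale (a : K) (ε : ℤ) (m : ℕ) (x y : Fin (m + 1) → K) :
    IsLaurent (2 * m ^ 2) fun t =>
      zHTOddCentral a ε m (fun i => x i * t ^ rowScale i) (fun j => y j * t ^ colScale j) := by
  refine (isLaurent_zHTOddCentral' a ε m x y rowScale colScale).mono ?_
  calc _ = ∑ p ∈ oddDomain m, if p.1.val ≠ m ∧ p.2.val < m then 1 else 0 := by
        refine Finset.sum_congr rfl fun p hp => ?_
        have hp : p.2.val < m ∨ (p.2.val = m ∧ m < p.1.val) := by simpa [oddDomain] using hp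
        simp only [rowScale, colScale, foldIndex, Fin.ext_iff, Fin.val_last, Fin.val_rev]
        split_ifs <;> omega
    _ ≤ ∑ p : Fin (2 * m + 1) × Fin (2 * m + 1), if p.1.val ≠ m ∧ p.2.val < m then 1 else 0 :=
        Finset.sum_le_sum_of_subset (Finset.subset_univ _)
    _ = 2 * m ^ 2 := by
        rw [← Finset.card_filter]
        have : (Finset.univ.filter fun p : Fin (2 * m + 1) × Fin (2 * m + 1) =>
            p.1.val ≠ m ∧ p.2.val < m) = (Finset.univ.erase (centre m)) ×ˢ
            (Finset.univ.filter fun j : Fin (2 * m + 1) => j.val < m) := by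
          ext ⟨i, j⟩; simp [centre, Fin.ext_iff]
        rw [this, Finset.card_product, Fin.card_filter_val_lt,
          Finset.card_erase_of_mem (Finset.mem_univ _), Finset.card_univ, Fintype.card_fin,
          min_eq_right (by omega)]
        simp; ring

/-- Here the vertex with parameter u/v is present and adds one to the m² vertices with parameters
x_i/y_j. -/
theorem isLaurent_zDW_scale_last (a : K) (m : ℕ) (x y : Fin (m + 1) → K) :
    IsLaurent (m ^ 2 + 1) fun t =>
      zDW a (m + 1) (fun i => x i * t ^ rowScale i) (fun j => y j * t ^ colScale j) := by
  refine (isLaurent_zDW a (m + 1) x y rowScale colScale).mono (le_of_eq ?_)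
  rw [Fintype.sum_prod_type, Fin.sum_univ_castSucc]
  simp only [Fin.sum_univ_castSucc, rowScale, colScale, Fin.castSucc_ne_last]
  simp; ring

end Width

section Symmetry

variable {K : Type*} [Field K]

/-- The parameters `x` followed by `u`. -/
abbrev snocFun {K : Type*} {m : ℕ} (x : Fin m → K) (u : K) : Fin (m + 1) → K := Fin.snoc x u

theorem snocFun_ne_zero {m : ℕ} {x : Fin m → K} {u : K} (hx : ∀ i, x i ≠ 0) (hu : u ≠ 0)
    (i : Fin (m + 1)) : snocFun x u i ≠ 0 := by
  induction i using Fin.lastCases <;> simp [hu, hx]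

theorem snocFun_inv {m : ℕ} (x : Fin m → K) (u : K) : (snocFun x u)⁻¹ = snocFun x⁻¹ u⁻¹ := by
  funext i
  induction i using Fin.lastCases <;> simp

theorem snocFun_succ {K : Type*} {m : ℕ} (x : Fin (m + 1) → K) (u : K) :
    (fun i : Fin (m + 1) => snocFun x u i.succ) = snocFun (fun i => x i.succ) u := by
  funext i
  induction i using Fin.lastCases with
  | last => simp [Fin.succ_last]
  | cast i => simp [← Fin.castSucc_succ]

/-! ### Invariance under permutations of the spectral parameters -/

theorem iceSigma_eq_zero {z : K} (hz : z ≠ 0) : iceSigma z = 0 ↔ z ^ 2 = 1 := by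
  rw [iceSigma, sub_eq_zero, ← mul_eq_one_iff_eq_inv₀ hz, sq]

/-- Commutation of row operators requires that certain σ do not vanish. Along the curve x_i t^i this
holds for all but finitely many t, and the identity extends to t = 1. -/
theorem comp_perm_of_generic [CharZero K] {a : K} (ha : a ≠ 0) {n : ℕ} (Z : (Fin n → K) → K)
    (hZ : ∀ (x : Fin n → K) (e : Fin n → ℤ), ∃ W, IsLaurent W fun t => Z fun i => x i * t ^ e i)
    (π : Equiv.Perm (Fin n))
    (h : ∀ x : Fin n → K, (∀ i, x i ≠ 0) →
      (∀ i j, i ≠ j → iceSigma (a * (a * x i * (x j)⁻¹)) ≠ 0) → Z (x ∘ π) = Z x)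
    (x : Fin n → K) (hx : ∀ i, x i ≠ 0) : Z (x ∘ π) = Z x := by
  have : Infinite K := CharZero.infinite K
  obtain ⟨W, hW⟩ := hZ x fun i => i
  obtain ⟨W', hW'⟩ := hZ (x ∘ π) fun i => π i
  have key := (hW'.mono (le_max_left W' W)).sub (hW.mono (le_max_right W' W))
  have hfin : (⋃ i : Fin n, ⋃ j : Fin n, ⋃ (_ : i ≠ j), {t : K | t ≠ 0 ∧
      t ^ (2 * ((i : ℤ) - j)) = ((a ^ 2 * x i * (x j)⁻¹) ^ 2)⁻¹}).Finite :=
    Set.finite_iUnion fun i => Set.finite_iUnion fun j => Set.finite_iUnion fun hij =>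
      finite_zpow_eq (by rw [ne_eq, Fin.ext_iff] at hij; omega) _
  have h1 := key.eq_zero_of_finite hfin fun t ht htB => ?_
  · simpa [sub_eq_zero, Function.comp_def] using h1
  rw [sub_eq_zero]
  refine h (fun i => x i * t ^ (i : ℤ)) (fun i => mul_ne_zero (hx i) (zpow_ne_zero _ ht))
    fun i j hij h0 => htB ?_
  simp only [Set.mem_iUnion]
  refine ⟨i, j, hij, ht, ?_⟩
  have hi := hx i
  have hj := hx j
  have hti := zpow_ne_zero (i : ℤ) ht
  have htj := zpow_ne_zero (j : ℤ) ht
  rw [iceSigma_eq_zero (by positivity)] at h0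
  rw [mul_comm, zpow_mul, zpow_sub₀ ht, ← mul_eq_one_iff_eq_inv₀ (by positivity),
    show ((2 : ℤ)) = ((2 : ℕ) : ℤ) by rfl, zpow_natCast, ← h0]
  field_simp

theorem pairwise_ofFn_of_ne {K : Type*} {n : ℕ} {R : K → K → Prop} {x : Fin n → K}
    (h : ∀ i j, i ≠ j → R (x i) (x j)) : (List.ofFn x).Pairwise R :=
  List.pairwise_ofFn.2 fun i j hij => h i j hij.ne

theorem zDW_comp_perm_left [CharZero K] {a : K} (ha : a ≠ 0) {n : ℕ} {x y : Fin n → K}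
    (hx : ∀ i, x i ≠ 0) (hy : ∀ j, y j ≠ 0) (π : Equiv.Perm (Fin n)) :
    zDW a n (x ∘ π) y = zDW a n x y := by
  refine comp_perm_of_generic ha (fun x => zDW a n x y) (fun x e => ?_) π (fun x hx h => ?_) x hx
  · have := isLaurent_zDW a n x y e 0
    simp only [Pi.zero_apply, zpow_zero, mul_one] at this
    exact ⟨_, this⟩
  · simp only [zDW_eq_rowFold]
    rw [rowFold_perm ha _ (by simpa [List.mem_ofFn] using hy) (by simpa [List.mem_ofFn] using hx)
      (pairwise_ofFn_of_ne h) (Equiv.Perm.ofFn_comp_perm π x).symm]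

theorem zHTEven_comp_perm_left [CharZero K] {a : K} (ha : a ≠ 0) {m : ℕ} {x y : Fin m → K}
    (hx : ∀ i, x i ≠ 0) (hy : ∀ j, y j ≠ 0) (π : Equiv.Perm (Fin m)) :
    zHTEven a m (x ∘ π) y = zHTEven a m x y := by
  refine comp_perm_of_generic ha (fun x => zHTEven a m x y) (fun x e => ?_) π
    (fun x hx h => ?_) x hx
  · simpa using isLaurent_zHTEven a m x y e 0
  · simp only [zHTEven_eq_rowFold]
    rw [rowFold_perm ha _ (by simpa [List.mem_ofFn] using hy) (by simpa [List.mem_ofFn] using hx)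
      (pairwise_ofFn_of_ne h) (Equiv.Perm.ofFn_comp_perm π x).symm]

/-- `κ true` times the contribution to `Z_HT(2m+1)` of the central entry `1` plus `κ false`
times the contribution of the central entry `-1`, with the parameters of the central row and
column written separately. -/
noncomputable def zHTOddTurn (a : K) (κ : Bool → K) {m : ℕ} (x y : Fin m → K) (u v : K) : K :=
  κ true * zHTOddCentral a 1 m (snocFun x u) (snocFun y v) +
    κ false * zHTOddCentral a (-1) m (snocFun x u) (snocFun y v)

theorem zHTOddTurn_eq_rowFold (a : K) (κ : Bool → K) {m : ℕ} (x y : Fin m → K) (u v : K) :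
    zHTOddTurn a κ x y u v = rowFold a (List.ofFn x)
      (List.ofFn y ++ v :: (List.ofFn y).reverse)
      (lineAct a u κ true (List.ofFn y) (htEnd K)) (List.replicate (2 * m + 1) true) := by
  rw [zHTOddTurn, zHTOddCentral_eq_sum, sum_oddWeight_eq_rowFold]
  simp [snocFun]

theorem zHTOddTurn_transpose (a : K) (κ : Bool → K) {m : ℕ} (x y : Fin m → K) (u v : K) :
    zHTOddTurn a κ y⁻¹ x⁻¹ v⁻¹ u⁻¹ = zHTOddTurn a κ x y u v := by
  rw [zHTOddTurn, ← snocFun_inv, ← snocFun_inv, zHTOddCentral_transpose, zHTOddCentral_transpose,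
    zHTOddTurn]

theorem zHTOddTurn_inv (a : K) (κ : Bool → K) {m : ℕ} (x y : Fin m → K) (u v : K) :
    zHTOddTurn a κ x⁻¹ y⁻¹ u⁻¹ v⁻¹ = zHTOddTurn a κ x y u v := by
  rw [zHTOddTurn, ← snocFun_inv, ← snocFun_inv, zHTOddCentral_inv, zHTOddCentral_inv,
    zHTOddTurn]

theorem snocFun_mul_zpow {m : ℕ} (x : Fin m → K) (u : K) (e : Fin m → ℤ) (k : ℤ) (t : K) :
    (fun i => snocFun x u i * t ^ (Fin.snoc e k : Fin (m + 1) → ℤ) i) =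
      snocFun (fun i => x i * t ^ e i) (u * t ^ k) := by
  funext i
  induction i using Fin.lastCases <;> simp

theorem isLaurent_zHTOddTurn (a : K) {κ : Bool → K → K} {w : ℕ} (hκ : ∀ c, IsLaurent w (κ c))
    {m : ℕ} (x y : Fin m → K) (u v : K) (e f : Fin m → ℤ) (k l : ℤ) : ∃ W, IsLaurent W fun t =>
      zHTOddTurn a (fun c => κ c t) (fun i => x i * t ^ e i) (fun j => y j * t ^ f j)
        (u * t ^ k) (v * t ^ l) := by
  obtain ⟨W, hW⟩ := isLaurent_zHTOddCentral a 1 m (snocFun x u) (snocFun y v) (Fin.snoc e k)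
    (Fin.snoc f l)
  obtain ⟨W', hW'⟩ := isLaurent_zHTOddCentral a (-1) m (snocFun x u) (snocFun y v) (Fin.snoc e k)
    (Fin.snoc f l)
  simp only [snocFun_mul_zpow] at hW hW'
  exact ⟨_, ((hκ true).mul (hW.mono (le_max_left W W'))).add
    ((hκ false).mul (hW'.mono (le_max_right W W')))⟩

theorem snocFun_rowScale {m : ℕ} (x : Fin m → K) (u t : K) :
    (fun i => snocFun x u i * t ^ rowScale i) = snocFun (fun i => x i * t) u := by
  funext i
  induction i using Fin.lastCases <;> simp [rowScale]

theorem snocFun_colScale {m : ℕ} (y : Fin m → K) (v t : K) :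
    (fun j => snocFun y v j * t ^ colScale j) = snocFun y (v * t) := by
  funext j
  induction j using Fin.lastCases <;> simp [colScale]

theorem isLaurent_zHTOddTurn_scale (a : K) {κ : Bool → K → K} {w : ℕ}
    (hκ : ∀ c, IsLaurent w (κ c)) {m : ℕ} (x y : Fin m → K) (u v : K) :
    IsLaurent (w + 2 * m ^ 2) fun t =>
      zHTOddTurn a (fun c => κ c t) (fun i => x i * t) y u (v * t) := by
  have h := fun ε => isLaurent_zHTOddCentral_scale a ε m (snocFun x u) (snocFun y v)
  simp only [snocFun_rowScale, snocFun_colScale] at h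
  exact ((hκ true).mul (h 1)).add ((hκ false).mul (h (-1)))

theorem isLaurent_zDW_snoc (a : K) {m : ℕ} (x y : Fin m → K) (u v : K) :
    IsLaurent (m ^ 2 + 1) fun t =>
      zDW a (m + 1) (snocFun (fun i => x i * t) u) (snocFun y (v * t)) := by
  have h := isLaurent_zDW_scale_last a m (snocFun x u) (snocFun y v)
  simpa only [snocFun_rowScale, snocFun_colScale] using h

theorem zHTOddTurn_comp_perm_left [CharZero K] {a : K} (ha : a ≠ 0) (κ : Bool → K) {m : ℕ}
    {x y : Fin m → K} {u v : K} (hx : ∀ i, x i ≠ 0) (hy : ∀ j, y j ≠ 0) (hv : v ≠ 0)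
    (π : Equiv.Perm (Fin m)) : zHTOddTurn a κ (x ∘ π) y u v = zHTOddTurn a κ x y u v := by
  refine comp_perm_of_generic ha (fun x => zHTOddTurn a κ x y u v) (fun x e => ?_) π
    (fun x hx h => ?_) x hx
  · simpa using isLaurent_zHTOddTurn a (fun c => IsLaurent.const (κ c)) x y u v e 0 0 0
  · simp only [zHTOddTurn_eq_rowFold]
    rw [rowFold_perm ha _ ?_ (by simpa [List.mem_ofFn] using hx)
      (pairwise_ofFn_of_ne h) (Equiv.Perm.ofFn_comp_perm π x).symm]
    intro z hz
    simp only [List.mem_append, List.mem_cons, List.mem_reverse, List.mem_ofFn] at hz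
    rcases hz with ⟨j, rfl⟩ | rfl | ⟨j, rfl⟩
    exacts [hy j, hv, hy j]

theorem zDW_comp_perm [CharZero K] {a : K} (ha : a ≠ 0) {n : ℕ} {x y : Fin n → K}
    (hx : ∀ i, x i ≠ 0) (hy : ∀ j, y j ≠ 0) (π ρ : Equiv.Perm (Fin n)) :
    zDW a n (x ∘ π) (y ∘ ρ) = zDW a n x y := by
  rw [zDW_comp_perm_left ha hx (y := y ∘ ρ) (fun j => hy _), ← zDW_transpose,
    ← zDW_transpose a n x y]
  exact zDW_comp_perm_left ha (x := y⁻¹) (fun j => inv_ne_zero (hy j))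
    (fun i => inv_ne_zero (hx i)) ρ

theorem zHTEven_comp_perm [CharZero K] {a : K} (ha : a ≠ 0) {n : ℕ} {x y : Fin n → K}
    (hx : ∀ i, x i ≠ 0) (hy : ∀ j, y j ≠ 0) (π ρ : Equiv.Perm (Fin n)) :
    zHTEven a n (x ∘ π) (y ∘ ρ) = zHTEven a n x y := by
  rw [zHTEven_comp_perm_left ha hx (y := y ∘ ρ) (fun j => hy _), ← zHTEven_transpose,
    ← zHTEven_transpose a n x y]
  exact zHTEven_comp_perm_left ha (x := y⁻¹) (fun j => inv_ne_zero (hy j))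
    (fun i => inv_ne_zero (hx i)) ρ

theorem zHTOddTurn_comp_perm [CharZero K] {a : K} (ha : a ≠ 0) (κ : Bool → K) {m : ℕ}
    {x y : Fin m → K} {u v : K} (hx : ∀ i, x i ≠ 0) (hy : ∀ j, y j ≠ 0) (hu : u ≠ 0) (hv : v ≠ 0)
    (π ρ : Equiv.Perm (Fin m)) :
    zHTOddTurn a κ (x ∘ π) (y ∘ ρ) u v = zHTOddTurn a κ x y u v := by
  rw [zHTOddTurn_comp_perm_left ha κ hx (y := y ∘ ρ) (fun j => hy _) hv, ← zHTOddTurn_transpose,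
    ← zHTOddTurn_transpose a κ x y]
  exact zHTOddTurn_comp_perm_left ha κ (x := y⁻¹) (fun j => inv_ne_zero (hy j))
    (fun i => inv_ne_zero (hx i)) (inv_ne_zero hu) ρ

/-- The reflection inverts the parameters and reverses the order of the rows; the reversal is undone
by the symmetry in the row parameters. -/
theorem zDW_inv [CharZero K] {a : K} (ha : a ≠ 0) {n : ℕ} {x y : Fin n → K}
    (hx : ∀ i, x i ≠ 0) (hy : ∀ j, y j ≠ 0) : zDW a n x⁻¹ y⁻¹ = zDW a n x y := by
  rw [← zDW_flip, inv_inv, ← zDW_comp_perm_left ha hx hy Fin.revPerm]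
  congr 1
  funext i
  simp

theorem snocFun_comp_finRotate {K : Type*} {m : ℕ} (x : Fin m → K) (u : K) :
    snocFun x u = (Fin.cons u x : Fin (m + 1) → K) ∘ finRotate (m + 1) :=
  Fin.snoc_eq_cons_rotate x u

/-! ### Frozen corners -/

theorem prod_map_ofFn {n : ℕ} (x : Fin n → K) (f : K → K) :
    ((List.ofFn x).map f).prod = ∏ i, f (x i) := by
  rw [List.map_ofFn, List.prod_ofFn]; rfl

theorem dwEnd_cons_false (s : List Bool) : dwEnd K (false :: s) = dwEnd K s := by simp [dwEnd]

theorem htEnd_cons_append (s : List Bool) (b : Bool) :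
    htEnd K (false :: (s ++ [b])) = if b = true then htEnd K s else 0 := by
  cases b <;> simp [htEnd]

theorem zDW_of_corner {a : K} {n : ℕ} {x y : Fin (n + 1) → K}
    (h : iceSigma (a * (x 0 * (y 0)⁻¹)) = 0) :
    zDW a (n + 1) x y = iceSigma (a ^ 2) * (∏ j : Fin n, iceSigma (a * (x 0 * (y j.succ)⁻¹)⁻¹)) *
      (∏ i : Fin n, iceSigma (a * (x i.succ * (y 0)⁻¹)⁻¹)) *
      zDW a n (fun i => x i.succ) (fun j => y j.succ) := by
  have := rowFold_freeze_left a (x 0) (y 0) (List.ofFn fun i => x i.succ)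
    (List.ofFn fun j => y j.succ) (dwEnd K) h
  simp only [dwEnd_cons_false, prod_map_ofFn, List.length_ofFn] at this
  rw [zDW_eq_rowFold, zDW_eq_rowFold, List.ofFn_succ, List.ofFn_succ, this]

/-- The half-turn pairs the first column with the last, so both freeze. The frozen row crosses each
inner column parameter twice, and each other row crosses both frozen columns; hence the squares. -/
theorem zHTEven_of_corner {a : K} {m : ℕ} {x y : Fin (m + 1) → K}
    (h : iceSigma (a * (x 0 * (y 0)⁻¹)) = 0) :
    zHTEven a (m + 1) x y = iceSigma (a ^ 2) * iceSigma (a * (x 0 * (y 0)⁻¹)⁻¹) *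
      (∏ j : Fin m, iceSigma (a * (x 0 * (y j.succ)⁻¹)⁻¹)) ^ 2 *
      (∏ i : Fin m, iceSigma (a * (x i.succ * (y 0)⁻¹)⁻¹)) ^ 2 *
      zHTEven a m (fun i => x i.succ) (fun j => y j.succ) := by
  set Y := List.ofFn fun j => y j.succ with hY
  have h1 := rowFold_freeze_left a (x 0) (y 0) (List.ofFn fun i => x i.succ)
    (Y ++ Y.reverse ++ [y 0]) (htEnd K) h
  rw [show (Y ++ Y.reverse ++ [y 0]).length = 2 * m + 1 by simp [hY]; omega,
    show List.replicate (2 * m + 1) true = List.replicate (2 * m) true ++ [true] by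
      rw [← List.replicate_succ'], rowFold_append_singleton _ _ _ _ _
      (fun s _ => by rw [htEnd_cons_append]; rfl) _ _ (by simp [hY]; omega), if_pos rfl] at h1
  simp only [htEnd_cons_append, if_true, List.map_append, List.prod_append, List.map_cons,
    List.map_nil, List.prod_cons, List.prod_nil, mul_one, List.map_reverse, List.prod_reverse] at h1
  simp only [hY, prod_map_ofFn] at h1
  rw [zHTEven_eq_rowFold, zHTEven_eq_rowFold, List.ofFn_succ, List.ofFn_succ (f := y),
    List.reverse_cons, List.cons_append, ← List.append_assoc, show 2 * (m + 1) = 2 * m + 1 + 1 by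
    ring, h1]
  ring

/-- Compared with even order there are two more frozen vertices: the first row meets the central
column once, and the central line meets the first column once. The turn is not affected. -/
theorem zHTOddTurn_of_corner {a : K} (κ : Bool → K) {m : ℕ} {x y : Fin (m + 1) → K} (u v : K)
    (h : iceSigma (a * (x 0 * (y 0)⁻¹)) = 0) :
    zHTOddTurn a κ x y u v = iceSigma (a ^ 2) * iceSigma (a * (x 0 * (y 0)⁻¹)⁻¹) *
      (∏ j : Fin m, iceSigma (a * (x 0 * (y j.succ)⁻¹)⁻¹)) ^ 2 *
      (∏ i : Fin m, iceSigma (a * (x i.succ * (y 0)⁻¹)⁻¹)) ^ 2 *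
      (iceSigma (a * (x 0 * v⁻¹)⁻¹) * iceSigma (a * (u * (y 0)⁻¹)⁻¹)) *
      zHTOddTurn a κ (fun i => x i.succ) (fun j => y j.succ) u v := by
  set Y := List.ofFn fun j => y j.succ with hY
  have h1 := rowFold_freeze_left a (x 0) (y 0) (List.ofFn fun i => x i.succ)
    (Y ++ v :: Y.reverse ++ [y 0]) (lineAct a u κ true (y 0 :: Y) (htEnd K)) h
  have hline : ∀ (s : List Bool) (b : Bool), s.length = 2 * m + 1 →
      lineAct a u κ true (y 0 :: Y) (htEnd K) (false :: (s ++ [b])) =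
      if b = true then iceSigma (a * (u * (y 0)⁻¹)⁻¹) * lineAct a u κ true Y (htEnd K) s
      else 0 := fun s b hs => by
    rw [lineAct_true_cons_false, lineAct_append _ _ _ _ _ _ _ _ (by simp [hY, hs]; omega)]
    simp only [htEnd_cons_append]
    split_ifs
    · rfl
    · rw [lineAct_zero, mul_zero]
  have hlen : (Y ++ v :: Y.reverse).length = 2 * m + 1 := by simp [hY]; omega
  have h2 := rowFold_congr a (List.ofFn fun i => x i.succ) (Y ++ v :: Y.reverse)
    (fun s hs => (hline s true (hs.trans hlen)).trans (if_pos rfl))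
    (List.replicate (2 * m + 1) true) (by rw [hlen, List.length_replicate])
  rw [show (Y ++ v :: Y.reverse ++ [y 0]).length = 2 * m + 1 + 1 by simp [hY]; omega,
    show List.replicate (2 * m + 1 + 1) true = List.replicate (2 * m + 1) true ++ [true] by
      rw [← List.replicate_succ'], rowFold_append_singleton _ _ _ _ _
      (fun s hs => by rw [hline _ _ (hs.trans hlen)]; rfl) _ _
      (by rw [hlen, List.length_replicate]),
    if_pos rfl, h2, rowFold_smul] at h1
  simp only [List.map_append, List.prod_append, List.map_cons,
    List.map_nil, List.prod_cons, List.prod_nil, mul_one, List.map_reverse, List.prod_reverse] at h1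
  simp only [hY, prod_map_ofFn] at h1
  rw [zHTOddTurn_eq_rowFold, zHTOddTurn_eq_rowFold, List.ofFn_succ, List.ofFn_succ (f := y),
    List.reverse_cons, List.cons_append, ← List.cons_append (as := List.reverse _), ←
    List.append_assoc, show 2 * (m + 1) + 1 = 2 * m + 1 + 1 + 1 by ring, h1]
  ring

/-! ### The central line -/

/-- The central line is moved above all rows, where it meets only boundary edges `true` and splits
off as a product. What remains is a half-turn symmetric system of even order. -/
theorem zHTOddTurn_of_eq_mul {a : K} (ha : a ≠ 0) {m : ℕ} {x y : Fin m → K} {u v : K}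
    (hx : ∀ i, x i ≠ 0) (hy : ∀ j, y j ≠ 0) (hu : u ≠ 0) (huv : u = a * v) :
    zHTOddTurn a 1 x y u v = (∏ i, iceSigma (a * (x i * v⁻¹))) *
      (∏ j, iceSigma (a * (u * (y j)⁻¹))) * zHTEven a m x y := by
  rw [zHTOddTurn_eq_rowFold, rowFold_lineAct ha hu huv _ _ _ (by simpa [List.mem_ofFn] using hx)
    (by simpa [List.mem_ofFn] using hy), prod_map_ofFn,
    show 2 * m + 1 = m + 1 + m by ring, List.replicate_add, zHTEven_eq_rowFold]
  have := lineAct_true_replicate a u 1 (List.ofFn y) (rowFold a (List.ofFn x)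
    (List.ofFn y ++ (List.ofFn y).reverse) (htEnd K)) (List.replicate m true)
  rw [List.length_ofFn, prod_map_ofFn, List.replicate_append_replicate (n := m) (m := m),
    ← two_mul] at this
  rw [this]
  simp [mul_assoc]

theorem zHTOddTurn_neg (a : K) (κ : Bool → K) {m : ℕ} (x y : Fin m → K) (u v : K) :
    zHTOddTurn a κ x y (-u) v = (-1) ^ m *
      zHTOddTurn a (fun c => (if c = true then 1 else -1) * κ c) x y u v := by
  rw [zHTOddTurn_eq_rowFold, zHTOddTurn_eq_rowFold, ← rowFold_smul]
  congr 1
  funext s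
  rw [lineAct_neg, List.length_ofFn]
  simp

end Symmetry

/-! ### The determinant for half-turn symmetric states -/

section HalfTurnDet

open Polynomial

variable {K : Type*} [Field K]

theorem iceSigma_inv (z : K) : iceSigma z⁻¹ = -iceSigma z := by
  simp [iceSigma]

theorem iceSigma_sign_mul {ε : K} (hε : ε ^ 2 = 1) (z : K) :
    iceSigma (ε * z) = ε * iceSigma z := by
  rcases sq_eq_one_iff.1 hε with rfl | rfl
  · simp
  · simp [iceSigma_neg]

/-- The product `σ(a z) σ(a z⁻¹)` of the two weights of type `0`. -/
def iceProd (a z : K) : K := iceSigma (a * z) * iceSigma (a * z⁻¹)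

/-- The sum `σ(a z) + σ(a z⁻¹)` of the two weights of type `0`. -/
def iceSum (a z : K) : K := iceSigma (a * z) + iceSigma (a * z⁻¹)

theorem iceProd_inv (a z : K) : iceProd a z⁻¹ = iceProd a z := by
  rw [iceProd, iceProd, inv_inv, mul_comm]

theorem iceSum_inv (a z : K) : iceSum a z⁻¹ = iceSum a z := by
  rw [iceSum, iceSum, inv_inv, add_comm]

theorem iceProd_sign_mul (a : K) {ε : K} (hε : ε ^ 2 = 1) (z : K) :
    iceProd a (ε * z) = iceProd a z := by
  have h : ε⁻¹ = ε := inv_eq_of_mul_eq_one_left (by rw [← sq, hε])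
  rw [iceProd, iceProd, mul_inv, h, mul_left_comm, mul_left_comm a ε, iceSigma_sign_mul hε,
    iceSigma_sign_mul hε]
  linear_combination iceSigma (a * z) * iceSigma (a * z⁻¹) * hε

theorem iceSum_sign_mul (a : K) {ε : K} (hε : ε ^ 2 = 1) (z : K) :
    iceSum a (ε * z) = ε * iceSum a z := by
  have h : ε⁻¹ = ε := inv_eq_of_mul_eq_one_left (by rw [← sq, hε])
  rw [iceSum, iceSum, mul_inv, h, mul_left_comm, mul_left_comm a ε, iceSigma_sign_mul hε,
    iceSigma_sign_mul hε]
  ring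

/-- The matrix with entries `(σ(a z) + σ(a z⁻¹)) ∏ σ(a w) σ(a w⁻¹)`, where `z = x i / y j` and
`w` runs over `x i / y k`, `k ≠ j`. -/
def htMatrix (a : K) {n : ℕ} (x y : Fin n → K) : Matrix (Fin n) (Fin n) K :=
  Matrix.of fun i j => iceSum a (x i * (y j)⁻¹) *
    ∏ k ∈ Finset.univ.erase j, iceProd a (x i * (y k)⁻¹)

/-- The determinant of `htMatrix`. -/
def htDet (a : K) {n : ℕ} (x y : Fin n → K) : K := (htMatrix a x y).det

/-- The product of `σ(x i / x j) σ(y j / y i)` over all `i < j`. -/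
def sigmaVandermonde {n : ℕ} (x y : Fin n → K) : K :=
  ∏ i, ∏ j ∈ Finset.Ioi i, iceSigma (x i * (x j)⁻¹) * iceSigma (y j * (y i)⁻¹)

theorem htDet_comp_perm (a : K) {n : ℕ} (x y : Fin n → K) (π ρ : Equiv.Perm (Fin n)) :
    htDet a (x ∘ π) (y ∘ ρ) = Equiv.Perm.sign π * Equiv.Perm.sign ρ * htDet a x y := by
  have : htMatrix a (x ∘ π) (y ∘ ρ) = ((htMatrix a x y).submatrix id ρ).submatrix π id := by
    ext i j
    simp only [htMatrix, Matrix.of_apply, Matrix.submatrix_apply, id, Function.comp_apply]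
    congr 1
    exact Finset.prod_equiv ρ (by simp) (by simp)
  rw [htDet, this, Matrix.det_permute, Matrix.det_permute', htDet, mul_assoc]

theorem sigmaVandermonde_comp_perm {n : ℕ} (x y : Fin n → K) (π ρ : Equiv.Perm (Fin n)) :
    sigmaVandermonde (x ∘ π) (y ∘ ρ) =
      Equiv.Perm.sign π * Equiv.Perm.sign ρ * sigmaVandermonde x y := by
  simp only [sigmaVandermonde, Finset.prod_mul_distrib, Function.comp_apply]
  rw [Equiv.Perm.prod_Ioi_comp_eq_sign_mul_prod π (f := fun i j => iceSigma (x i * (x j)⁻¹)),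
    Equiv.Perm.prod_Ioi_comp_eq_sign_mul_prod ρ (f := fun i j => iceSigma (y j * (y i)⁻¹))]
  · ring
  all_goals
    intro i j
    rw [← iceSigma_inv, mul_inv, inv_inv, mul_comm]

theorem sign_mul_self_cast {n : ℕ} (π : Equiv.Perm (Fin n)) :
    ((Equiv.Perm.sign π : ℤ) : K) * (Equiv.Perm.sign π : ℤ) = 1 := by
  rw [← Int.cast_mul, ← Units.val_mul, ← sq, Int.units_sq]; simp

/-- The last row and column are rotated to the front by the same permutation, so the two signs
cancel. -/
theorem htDet_snoc (a : K) {m : ℕ} (x y : Fin m → K) (u v : K) :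
    htDet a (snocFun x u) (snocFun y v) =
      htDet a (Fin.cons u x : Fin (m + 1) → K) (Fin.cons v y : Fin (m + 1) → K) := by
  rw [snocFun_comp_finRotate, snocFun_comp_finRotate, htDet_comp_perm, sign_mul_self_cast, one_mul]

theorem sigmaVandermonde_snoc {m : ℕ} (x y : Fin m → K) (u v : K) :
    sigmaVandermonde (snocFun x u) (snocFun y v) =
      sigmaVandermonde (Fin.cons u x : Fin (m + 1) → K) (Fin.cons v y : Fin (m + 1) → K) := by
  rw [snocFun_comp_finRotate, snocFun_comp_finRotate, sigmaVandermonde_comp_perm,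
    sign_mul_self_cast, one_mul]

theorem htDet_inv (a : K) {n : ℕ} (x y : Fin n → K) : htDet a x⁻¹ y⁻¹ = htDet a x y := by
  have h : ∀ i j, x⁻¹ i * (y⁻¹ j)⁻¹ = (x i * (y j)⁻¹)⁻¹ := fun i j => by
    rw [Pi.inv_apply, Pi.inv_apply, mul_inv]
  simp only [htDet, htMatrix, h, iceSum_inv, iceProd_inv]

theorem sigmaVandermonde_inv {n : ℕ} (x y : Fin n → K) :
    sigmaVandermonde x⁻¹ y⁻¹ = sigmaVandermonde x y := by
  have h : ∀ (x : Fin n → K) i j, x⁻¹ i * (x⁻¹ j)⁻¹ = (x i * (x j)⁻¹)⁻¹ := fun x i j => by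
    rw [Pi.inv_apply, Pi.inv_apply, mul_inv]
  simp only [sigmaVandermonde, h, iceSigma_inv, neg_mul_neg]

theorem sigmaVandermonde_succ {n : ℕ} (x y : Fin (n + 1) → K) :
    sigmaVandermonde x y = (∏ k : Fin n, iceSigma (x 0 * (x k.succ)⁻¹) *
      iceSigma (y k.succ * (y 0)⁻¹)) * sigmaVandermonde (fun i => x i.succ) fun j => y j.succ := by
  rw [sigmaVandermonde, Fin.prod_univ_succ]
  simp only [Fin.prod_Ioi_zero, Fin.prod_Ioi_succ]
  rfl

/-- At the corner x_0 and a⁻¹ y_0 agree up to a sign ε. Replacing one by the other turns the factors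
with index 0 into weights σ(a z); the signs occur in pairs and cancel. -/
theorem sigmaVandermonde_of_corner {a : K} {n : ℕ} {x y : Fin (n + 1) → K}
    (ha : a ≠ 0) (hx : ∀ i, x i ≠ 0) (hy : ∀ j, y j ≠ 0)
    (h : iceSigma (a * (x 0 * (y 0)⁻¹)) = 0) :
    sigmaVandermonde x y = (∏ i : Fin n, iceSigma (a * (x i.succ * (y 0)⁻¹))) *
      (∏ j : Fin n, iceSigma (a * (x 0 * (y j.succ)⁻¹))) *
      sigmaVandermonde (fun i => x i.succ) fun j => y j.succ := by
  have hx0 := hx 0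
  have hy0 := hy 0
  rw [iceSigma_eq_zero (mul_ne_zero ha (mul_ne_zero hx0 (inv_ne_zero hy0)))] at h
  rw [sigmaVandermonde_succ, ← Finset.prod_mul_distrib]
  congr 1
  refine Finset.prod_congr rfl fun k _ => ?_
  set ε := a * (x 0 * (y 0)⁻¹) with hε
  have h1 : x 0 * (x k.succ)⁻¹ = ε * (a * (x k.succ * (y 0)⁻¹))⁻¹ := by
    have := hx k.succ
    rw [hε]; field_simp
  have h2 : y k.succ * (y 0)⁻¹ = ε * (a * (x 0 * (y k.succ)⁻¹))⁻¹ := by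
    have := hy k.succ
    rw [hε]; field_simp
  rw [h1, h2, iceSigma_sign_mul h, iceSigma_sign_mul h, iceSigma_inv, iceSigma_inv]
  linear_combination iceSigma (a * (x k.succ * (y 0)⁻¹)) *
    iceSigma (a * (x 0 * (y k.succ)⁻¹)) * h

theorem univ_erase_zero (n : ℕ) : (Finset.univ.erase (0 : Fin (n + 1))) =
    Finset.univ.map (Fin.succEmb n) := by
  ext i
  induction i using Fin.cases <;> simp

theorem univ_erase_succ {n : ℕ} (j : Fin n) : (Finset.univ.erase j.succ) =
    insert 0 ((Finset.univ.erase j).map (Fin.succEmb n)) := by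
  ext i
  induction i using Fin.cases with
  | zero => simp [(Fin.succ_ne_zero j).symm]
  | succ i => simp [Fin.succ_ne_zero]

theorem htMatrix_zero_right (a : K) {n : ℕ} (x y : Fin (n + 1) → K) (i : Fin (n + 1)) :
    htMatrix a x y i 0 = iceSum a (x i * (y 0)⁻¹) *
      ∏ k : Fin n, iceProd a (x i * (y k.succ)⁻¹) := by
  rw [htMatrix, Matrix.of_apply, univ_erase_zero, Finset.prod_map]; rfl

theorem htMatrix_succ_right (a : K) {n : ℕ} (x y : Fin (n + 1) → K) (i : Fin (n + 1)) (j : Fin n) :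
    htMatrix a x y i j.succ = iceProd a (x i * (y 0)⁻¹) * (iceSum a (x i * (y j.succ)⁻¹) *
      ∏ k ∈ Finset.univ.erase j, iceProd a (x i * (y k.succ)⁻¹)) := by
  rw [htMatrix, Matrix.of_apply, univ_erase_succ, Finset.prod_insert (by simp [Fin.succ_ne_zero]),
    Finset.prod_map, mul_left_comm]
  rfl

theorem htMatrix_submatrix_succ (a : K) {n : ℕ} (x y : Fin (n + 1) → K) :
    (htMatrix a x y).submatrix Fin.succ Fin.succ = Matrix.of fun i j =>
      iceProd a (x i.succ * (y 0)⁻¹) * htMatrix a (fun i => x i.succ) (fun j => y j.succ) i j := by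
  ext i j
  rw [Matrix.submatrix_apply, htMatrix_succ_right]
  rfl

/-- In row 0 every entry outside column 0 contains the vanishing factor `iceProd a (x 0 * (y 0)⁻¹)`,
so only one cofactor survives. -/
theorem htDet_of_corner {a : K} {n : ℕ} {x y : Fin (n + 1) → K}
    (h : iceSigma (a * (x 0 * (y 0)⁻¹)) = 0) :
    htDet a x y = iceSigma (a * (x 0 * (y 0)⁻¹)⁻¹) *
      (∏ j : Fin n, iceProd a (x 0 * (y j.succ)⁻¹)) *
      (∏ i : Fin n, iceProd a (x i.succ * (y 0)⁻¹)) *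
      htDet a (fun i => x i.succ) fun j => y j.succ := by
  have h0 : iceProd a (x 0 * (y 0)⁻¹) = 0 := by rw [iceProd, h, zero_mul]
  rw [htDet, Matrix.det_succ_row_zero, Fin.sum_univ_succ, Finset.sum_eq_zero, add_zero]
  · rw [Fin.succAbove_zero, htMatrix_submatrix_succ, Matrix.det_mul_column, htMatrix_zero_right,
      iceSum, h, htDet]
    simp [mul_assoc]
  · intro j _
    rw [htMatrix_succ_right, h0]
    simp

theorem htDet_sign_mul (a : K) {n : ℕ} {ε δ : Fin n → K} (hε : ∀ i, ε i ^ 2 = 1)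
    (hδ : ∀ j, δ j ^ 2 = 1) (x y : Fin n → K) :
    htDet a (fun i => ε i * x i) (fun j => δ j * y j) = (∏ i, ε i) * (∏ j, δ j) * htDet a x y := by
  have key : ∀ i j, ε i * x i * (δ j * y j)⁻¹ = ε i * (δ j * (x i * (y j)⁻¹)) := fun i j => by
    have h : (δ j)⁻¹ = δ j := inv_eq_of_mul_eq_one_left (by rw [← sq, hδ])
    rw [mul_inv, h]; ring
  have : htMatrix a (fun i => ε i * x i) (fun j => δ j * y j) =
      Matrix.of fun i j => ε i * (Matrix.of fun i j => δ j * htMatrix a x y i j) i j := by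
    ext i j
    simp only [htMatrix, Matrix.of_apply, key, iceSum_sign_mul a (hε _), iceSum_sign_mul a (hδ _),
      iceProd_sign_mul a (hε _), iceProd_sign_mul a (hδ _), mul_assoc]
  rw [htDet, this, Matrix.det_mul_column, Matrix.det_mul_row, htDet, mul_assoc]

theorem comp_swap_of_eq {α : Type*} {n : ℕ} {x : Fin n → α} {i j : Fin n} (h : x i = x j) :
    x ∘ Equiv.swap i j = x := by
  funext k
  rw [Function.comp_apply, Equiv.swap_apply_def]
  split_ifs with h1 h2
  · rw [h1, h]
  · rw [h2, h]
  · rfl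

theorem exists_sign_of_sq_eq {n : ℕ} {x : Fin n → K} {i j : Fin n} (hij : i ≠ j)
    (h : x i ^ 2 = x j ^ 2) : ∃ ε : Fin n → K, (∀ k, ε k ^ 2 = 1) ∧ ε i * x i = ε j * x j := by
  rcases sq_eq_sq_iff_eq_or_eq_neg.1 h with h | h
  · exact ⟨1, by simp, by simp [h]⟩
  · refine ⟨fun k => if k = i then -1 else 1, fun k => by dsimp only; split_ifs <;> simp, ?_⟩
    simp [h, hij.symm]

theorem prod_ne_zero_of_sq {n : ℕ} {ε : Fin n → K} (hε : ∀ k, ε k ^ 2 = 1) : ∏ k, ε k ≠ 0 :=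
  Finset.prod_ne_zero_iff.2 fun k _ h => by simpa [h] using hε k

/-- Sign changes of the parameters only multiply the determinant by signs, so the two parameters may
be taken equal; then a transposition fixes and negates the determinant. -/
theorem htDet_eq_zero_of_sq_eq_left [CharZero K] (a : K) {n : ℕ} {x : Fin n → K} (y : Fin n → K)
    {i j : Fin n} (hij : i ≠ j) (h : x i ^ 2 = x j ^ 2) : htDet a x y = 0 := by
  obtain ⟨ε, hε, hεx⟩ := exists_sign_of_sq_eq hij h
  have h1 := htDet_sign_mul a hε (δ := 1) (by simp) x y
  have h2 := htDet_comp_perm a (fun i => ε i * x i) (fun j => (1 : Fin n → K) j * y j)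
    (Equiv.swap i j) 1
  simp only [comp_swap_of_eq (x := fun k => ε k * x k) hεx, Equiv.Perm.coe_one, Function.comp_id,
    h1, Equiv.Perm.sign_swap hij] at h2
  have h3 : (∏ k, ε k) * htDet a x y = 0 := by
    refine self_eq_neg.1 ?_
    simpa using h2
  exact (mul_eq_zero.1 h3).resolve_left (prod_ne_zero_of_sq hε)

theorem htDet_eq_zero_of_sq_eq_right [CharZero K] (a : K) {n : ℕ} (x : Fin n → K) {y : Fin n → K}
    {i j : Fin n} (hij : i ≠ j) (h : y i ^ 2 = y j ^ 2) : htDet a x y = 0 := by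
  obtain ⟨ε, hε, hεy⟩ := exists_sign_of_sq_eq hij h
  have h1 := htDet_sign_mul a (ε := 1) (by simp) hε x y
  have h2 := htDet_comp_perm a (fun i => (1 : Fin n → K) i * x i) (fun j => ε j * y j)
    1 (Equiv.swap i j)
  simp only [comp_swap_of_eq (x := fun k => ε k * y k) hεy, Equiv.Perm.coe_one, Function.comp_id,
    h1, Equiv.Perm.sign_swap hij] at h2
  have h3 : (∏ k, ε k) * htDet a x y = 0 := by
    refine self_eq_neg.1 ?_
    simpa using h2
  exact (mul_eq_zero.1 h3).resolve_left (prod_ne_zero_of_sq hε)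

theorem sigmaVandermonde_eq_zero_of_left {m : ℕ} {x : Fin m → K} (y : Fin m → K) {u : K} (v : K)
    (hu : u ≠ 0) {i : Fin m} (hx : x i ≠ 0) (h : x i ^ 2 = u ^ 2) :
    sigmaVandermonde (snocFun x u) (snocFun y v) = 0 := by
  rw [sigmaVandermonde_snoc, sigmaVandermonde_succ, Finset.prod_eq_zero (Finset.mem_univ i),
    zero_mul]
  have : iceSigma (u * (x i)⁻¹) = 0 := by
    rw [iceSigma_eq_zero (mul_ne_zero hu (inv_ne_zero hx)), mul_pow, ← h, ← mul_pow,
      mul_inv_cancel₀ hx, one_pow]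
  simp [this]

theorem sigmaVandermonde_eq_zero_of_right {m : ℕ} (x : Fin m → K) {y : Fin m → K} (u : K) {v : K}
    (hv : v ≠ 0) {j : Fin m} (hy : y j ≠ 0) (h : y j ^ 2 = v ^ 2) :
    sigmaVandermonde (snocFun x u) (snocFun y v) = 0 := by
  rw [sigmaVandermonde_snoc, sigmaVandermonde_succ, Finset.prod_eq_zero (Finset.mem_univ j),
    zero_mul]
  have : iceSigma (y j * v⁻¹) = 0 := by
    rw [iceSigma_eq_zero (mul_ne_zero hy (inv_ne_zero hv)), mul_pow, h, ← mul_pow,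
      mul_inv_cancel₀ hv, one_pow]
  simp [this]

end HalfTurnDet

/-! ### The width of the determinant in a common scale -/

section DetWidth

open Polynomial

variable {K : Type*} [Field K]

/-- On nonzero arguments, `f` is a Laurent polynomial with exponents `-L, -L + 2, …, L`. -/
def IsParityLaurent (L : ℕ) (f : K → K) : Prop :=
  ∃ p : K[X], p.natDegree ≤ L ∧ ∀ z : K, z ≠ 0 → f z * z ^ L = p.eval (z ^ 2)

namespace IsParityLaurent

variable {L L' : ℕ} {f g : K → K}

theorem one : IsParityLaurent 0 fun _ : K => 1 := ⟨1, by simp, by simp⟩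

theorem add (hf : IsParityLaurent L f) (hg : IsParityLaurent L g) :
    IsParityLaurent L fun z => f z + g z := by
  obtain ⟨p, hp, hpf⟩ := hf
  obtain ⟨q, hq, hqg⟩ := hg
  refine ⟨p + q, (natDegree_add_le _ _).trans (max_le hp hq), fun t ht => ?_⟩
  rw [add_mul, hpf t ht, hqg t ht, eval_add]

theorem mul (hf : IsParityLaurent L f) (hg : IsParityLaurent L' g) :
    IsParityLaurent (L + L') fun z => f z * g z := by
  obtain ⟨p, hp, hpf⟩ := hf
  obtain ⟨q, hq, hqg⟩ := hg
  refine ⟨p * q, natDegree_mul_le.trans (by omega), fun t ht => ?_⟩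
  rw [pow_add, mul_mul_mul_comm, hpf t ht, hqg t ht, eval_mul]

theorem prod {ι : Type*} {s : Finset ι} {F : ι → K → K}
    (h : ∀ i ∈ s, IsParityLaurent L (F i)) :
    IsParityLaurent (s.card * L) fun t => ∏ i ∈ s, F i t := by
  classical
  induction s using Finset.induction_on with
  | empty => simpa using one
  | insert i s hi ih =>
    simp only [Finset.prod_insert hi, Finset.card_insert_of_notMem hi, add_mul, one_mul, add_comm]
    exact (h i (by simp)).mul (ih fun j hj => h j (by simp [hj]))

theorem iceSigma_mul (a c : K) : IsParityLaurent 1 fun z => iceSigma (a * (z * c)) := by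
  refine ⟨C (a * c) * X - C (a * c)⁻¹, by compute_degree, fun z hz => ?_⟩
  simp only [iceSigma, eval_sub, eval_mul, eval_C, eval_X, mul_inv]
  field_simp

theorem iceSigma_mul_inv (a c : K) : IsParityLaurent 1 fun z => iceSigma (a * (z * c)⁻¹) := by
  refine ⟨C (-(a⁻¹ * c)) * X + C (a * c⁻¹), by compute_degree, fun z hz => ?_⟩
  simp only [iceSigma, eval_add, eval_mul, eval_C, eval_X, mul_inv, inv_inv]
  field_simp
  ring

theorem iceSum (a c : K) : IsParityLaurent 1 fun z => iceSum a (z * c) :=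
  (iceSigma_mul a c).add (iceSigma_mul_inv a c)

theorem iceProd (a c : K) : IsParityLaurent 2 fun z => iceProd a (z * c) :=
  (iceSigma_mul a c).mul (iceSigma_mul_inv a c)

theorem isLaurent (hf : IsParityLaurent L f) (x : K) (hx : x ≠ 0) :
    IsLaurent L fun t => f (x * t) := by
  obtain ⟨p, hp, hpf⟩ := hf
  refine ⟨C (x ^ L)⁻¹ * p.comp (C (x ^ 2) * X ^ 2), ?_, fun t ht => ?_⟩
  · refine (natDegree_C_mul_le _ _).trans (natDegree_comp_le.trans ?_)
    rw [mul_comm 2 L]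
    exact Nat.mul_le_mul hp (natDegree_C_mul_X_pow_le _ _)
  · have := hpf (x * t) (mul_ne_zero hx ht)
    rw [eval_mul, eval_C, eval_comp, eval_mul, eval_C, eval_pow, eval_X, ← mul_pow, ← this]
    field_simp
    ring

theorem exists_coeff (hf : IsParityLaurent L f) :
    ∃ c : Fin (L + 1) → K, ∀ z, z ≠ 0 → f z = ∑ k, c k * z ^ (2 * (k : ℤ) - L) := by
  obtain ⟨p, hp, hpf⟩ := hf
  refine ⟨fun k => p.coeff k, fun z hz => ?_⟩
  have h := hpf z hz
  rw [eval_eq_sum_range' (Nat.lt_succ_of_le hp), ← Fin.sum_univ_eq_sum_range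
    (fun k => p.coeff k * (z ^ 2) ^ k)] at h
  rw [← mul_left_inj' (pow_ne_zero L hz), h, Finset.sum_mul]
  refine Finset.sum_congr rfl fun k _ => ?_
  rw [mul_assoc, ← zpow_natCast z L, ← zpow_add₀ hz, sub_add_cancel, zpow_mul, zpow_ofNat,
    zpow_natCast]

end IsParityLaurent

theorem two_mul_sum_range_int (n : ℕ) : 2 * ∑ k ∈ Finset.range n, (k : ℤ) = n * (n - 1) := by
  induction n with
  | zero => simp
  | succ n ih => rw [Finset.sum_range_succ, mul_add, ih]; push_cast; ring

/-- The sum of n distinct numbers from 0, …, L is extremal for the n smallest and the n largest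
ones. -/
theorem natAbs_sum_le_of_injective {n L : ℕ} {r : Fin n → Fin (L + 1)}
    (hr : Function.Injective r) :
    (∑ j, (2 * ((r j : ℕ) : ℤ) - L)).natAbs ≤ n * (L + 1 - n) := by
  have hn : n ≤ L + 1 := by simpa using Fintype.card_le_of_injective r hr
  obtain ⟨d, hd⟩ := Nat.exists_eq_add_of_le hn
  have hinj : Function.Injective fun j => ((r j : ℕ) : ℤ) := fun i j h =>
    hr (Fin.ext (by simpa using h))
  have h1 := Finset.sum_range_le_sum (s := Finset.univ.image fun j => ((r j : ℕ) : ℤ)) (c := 0)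
    (by simp)
  have h2 := Finset.sum_le_sum_range (s := Finset.univ.image fun j => ((r j : ℕ) : ℤ)) (c := L)
    (by intro x hx; obtain ⟨j, -, rfl⟩ := Finset.mem_image.1 hx; have := (r j).is_lt; omega)
  rw [Finset.card_image_of_injective _ hinj, Finset.sum_image hinj.injOn, Finset.card_univ,
    Fintype.card_fin] at h1 h2
  simp only [zero_add] at h1
  rw [Finset.sum_sub_distrib, Finset.sum_const, Finset.card_range, nsmul_eq_mul] at h2
  have h3 := two_mul_sum_range_int n
  rw [show L + 1 - n = d by omega, Finset.sum_sub_distrib, ← Finset.mul_sum, Finset.sum_const,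
    Finset.card_univ, Fintype.card_fin, nsmul_eq_mul]
  have hL : (L : ℤ) = n + d - 1 := by omega
  rw [hL] at h2 ⊢
  zify
  rw [abs_le]
  constructor <;> linarith

/-- Expand every column in powers of t. A choice of one exponent per column contributes only if the
exponents are distinct, since otherwise two columns are equal. For L = 2n - 1 this gives the width
n² in place of the naive n (2n - 1), and the interpolation depends on it. -/
theorem isLaurent_det_of_isParityLaurent {n L : ℕ} (α x : Fin n → K) (hx : ∀ i, x i ≠ 0)
    (f : Fin n → K → K) (hf : ∀ j, IsParityLaurent L (f j)) :
    IsLaurent (n * (L + 1 - n)) fun t =>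
      (Matrix.of fun i j => α i * f j (x i * t) : Matrix (Fin n) (Fin n) K).det := by
  choose c hc using fun j => (hf j).exists_coeff
  set w : Fin (L + 1) → Fin n → K := fun k i => x i ^ (2 * (k : ℤ) - L) with hw
  have key : IsLaurent (n * (L + 1 - n)) fun t => (∏ i, α i) * ∑ r : Fin n → Fin (L + 1),
      ((∏ j, c j (r j)) * Matrix.detRowAlternating fun j => w (r j)) *
        t ^ ∑ j, (2 * ((r j : ℕ) : ℤ) - L) := by
    refine (IsLaurent.sum fun r _ => ?_).const_mul _
    by_cases hr : Function.Injective r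
    · exact (IsLaurent.zpow _ _).mono (natAbs_sum_le_of_injective hr)
    · refine IsLaurent.zero.congr fun t _ => ?_
      rw [AlternatingMap.map_eq_zero_of_not_injective _ _
        fun h => hr fun i j hij => h (congrArg w hij)]
      simp
  refine key.congr fun t ht => ?_
  have h1 := Matrix.det_mul_column α (Matrix.of fun i j => f j (x i * t))
  simp only [Matrix.of_apply] at h1
  rw [h1, ← Matrix.det_transpose]
  congr 1
  have h2 : (Matrix.of fun i j => f j (x i * t) : Matrix (Fin n) (Fin n) K).transpose =
      fun j => ∑ k, (c j k * t ^ (2 * (k : ℤ) - L)) • w k := by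
    funext j i
    simp only [Matrix.transpose_apply, Matrix.of_apply, Finset.sum_apply, Pi.smul_apply,
      smul_eq_mul, hw]
    rw [hc j _ (mul_ne_zero (hx i) ht)]
    refine Finset.sum_congr rfl fun k _ => ?_
    rw [mul_zpow]; ring
  have h3 : ∀ (s : Finset (Fin n)) (k : Fin n → ℤ), ∏ j ∈ s, t ^ k j = t ^ ∑ j ∈ s, k j := by
    intro s k
    induction s using Finset.induction_on with
    | empty => simp
    | insert i s hi ih => rw [Finset.prod_insert hi, Finset.sum_insert hi, ih, zpow_add₀ ht]
  rw [h2]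
  change Matrix.detRowAlternating.toMultilinearMap _ = _
  rw [MultilinearMap.map_sum]
  refine Finset.sum_congr rfl fun r _ => ?_
  rw [MultilinearMap.map_smul_univ, Finset.prod_mul_distrib, h3, smul_eq_mul]
  exact mul_right_comm _ _ _

theorem isLaurent_det {n : ℕ} (M : Fin n → Fin n → K → K)
    (h : ∀ i j, ∃ W, IsLaurent W (M i j)) :
    ∃ W, IsLaurent W fun t => (Matrix.of fun i j => M i j t : Matrix (Fin n) (Fin n) K).det := by
  choose w hw using h
  refine ⟨∑ i, ∑ j, w i j, ?_⟩
  simp only [Matrix.det_apply', Matrix.of_apply]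
  refine IsLaurent.sum fun π _ => IsLaurent.const_mul _ ?_
  refine (IsLaurent.prod fun i _ => hw (π i) i).mono ?_
  rw [Finset.sum_comm]
  exact Finset.sum_le_sum fun i _ =>
    Finset.single_le_sum (f := fun j => w j i) (fun _ _ => Nat.zero_le _) (Finset.mem_univ _)

theorem isLaurent_iceSigma_ratio (b x y : K) (k l : ℤ) :
    IsLaurent (k - l).natAbs fun t => iceSigma (b * (x * t ^ k * (y * t ^ l)⁻¹)) := by
  refine (IsLaurent.iceSigma_zpow (b * (x * y⁻¹)) (k - l)).congr fun t ht => ?_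
  rw [zpow_sub₀ ht, mul_inv]
  congr 1; ring

theorem isLaurent_iceSigma_ratio_inv (b x y : K) (k l : ℤ) :
    IsLaurent (k - l).natAbs fun t => iceSigma (b * (x * t ^ k * (y * t ^ l)⁻¹)⁻¹) := by
  refine ((isLaurent_iceSigma_ratio b y x l k).mono (by omega)).congr fun t ht => ?_
  rw [mul_inv (_ * _), inv_inv, mul_comm (_)⁻¹]

theorem isLaurent_iceSum_ratio (a x y : K) (k l : ℤ) :
    IsLaurent (k - l).natAbs fun t => iceSum a (x * t ^ k * (y * t ^ l)⁻¹) :=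
  (isLaurent_iceSigma_ratio a x y k l).add (isLaurent_iceSigma_ratio_inv a x y k l)

theorem isLaurent_iceProd_ratio (a x y : K) (k l : ℤ) :
    IsLaurent ((k - l).natAbs + (k - l).natAbs)
      fun t => iceProd a (x * t ^ k * (y * t ^ l)⁻¹) :=
  (isLaurent_iceSigma_ratio a x y k l).mul (isLaurent_iceSigma_ratio_inv a x y k l)

theorem isLaurent_htDet (a : K) {n : ℕ} (x y : Fin n → K) (e f : Fin n → ℤ) :
    ∃ W, IsLaurent W fun t => htDet a (fun i => x i * t ^ e i) fun j => y j * t ^ f j :=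
  isLaurent_det _ fun i j => ⟨_, (isLaurent_iceSum_ratio a (x i) (y j) (e i) (f j)).mul
    (IsLaurent.prod fun k _ => isLaurent_iceProd_ratio a (x i) (y k) (e i) (f k))⟩

theorem isLaurent_sigmaVandermonde {n : ℕ} (x y : Fin n → K) (e f : Fin n → ℤ) :
    ∃ W, IsLaurent W fun t =>
      sigmaVandermonde (fun i => x i * t ^ e i) fun j => y j * t ^ f j := by
  refine ⟨_, IsLaurent.prod fun i _ => IsLaurent.prod fun j _ =>
    ((isLaurent_iceSigma_ratio 1 (x i) (x j) (e i) (e j)).mul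
      (isLaurent_iceSigma_ratio 1 (y j) (y i) (f j) (f i))).congr fun t _ => ?_⟩
  rw [one_mul, one_mul]

theorem sigmaVandermonde_scale {n : ℕ} (x y : Fin n → K) {t : K} (ht : t ≠ 0) :
    sigmaVandermonde (fun i => x i * t) y = sigmaVandermonde x y := by
  refine Finset.prod_congr rfl fun i _ => Finset.prod_congr rfl fun j _ => ?_
  rw [mul_inv, mul_mul_mul_comm, mul_inv_cancel₀ ht, mul_one]

theorem isLaurent_sigmaVandermonde_snoc {m : ℕ} (x y : Fin m → K) (u v : K) :
    IsLaurent (2 * m) fun t =>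
      sigmaVandermonde (snocFun (fun i => x i * t) u) (snocFun y (v * t)) := by
  have h : IsLaurent (∑ _k : Fin m, 2) fun t => ∏ k : Fin m,
      iceSigma (u * (x k * t)⁻¹) * iceSigma (y k * (v * t)⁻¹) := by
    refine IsLaurent.prod fun k _ => ?_
    have := (isLaurent_iceSigma_ratio 1 u (x k) 0 1).mul (isLaurent_iceSigma_ratio 1 (y k) v 0 1)
    simpa using this
  refine ((h.mono (W' := 2 * m) (by simp [mul_comm])).mul_const (sigmaVandermonde x y)).congr
    fun t ht => ?_
  rw [sigmaVandermonde_snoc, sigmaVandermonde_succ]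
  simp only [Fin.cons_succ, Fin.cons_zero, sigmaVandermonde_scale x y ht]

/-- The entries of a column of `htMatrix` as functions of the row parameter. -/
theorem isParityLaurent_htEntry (a : K) {n : ℕ} (y : Fin n → K) (j : Fin n) :
    IsParityLaurent (2 * n - 1) fun z => iceSum a (z * (y j)⁻¹) *
      ∏ k ∈ Finset.univ.erase j, iceProd a (z * (y k)⁻¹) := by
  have h := (IsParityLaurent.iceSum a (y j)⁻¹).mul (IsParityLaurent.prod
    (s := Finset.univ.erase j) fun k _ => IsParityLaurent.iceProd a (y k)⁻¹)
  rw [Finset.card_erase_of_mem (Finset.mem_univ _), Finset.card_univ, Fintype.card_fin] at h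
  have hn : 1 + (n - 1) * 2 = 2 * n - 1 := by have := j.pos; omega
  rwa [hn] at h

theorem isLaurent_htDet_scale (a : K) {n : ℕ} (x y : Fin n → K) (hx : ∀ i, x i ≠ 0) :
    IsLaurent (n ^ 2) fun t => htDet a (fun i => x i * t) y := by
  have h := isLaurent_det_of_isParityLaurent 1 x hx _ (isParityLaurent_htEntry a y)
  simp only [Pi.one_apply, one_mul] at h
  refine h.mono ?_
  rcases n with - | n
  · simp
  · rw [sq]; exact Nat.mul_le_mul_left _ (by omega)

/-- The row of u and the column of v do not scale like the rest, so the determinant is expanded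
along both and the previous bound is applied to the remaining minors. -/
theorem isLaurent_htDet_snoc (a : K) {m : ℕ} (x y : Fin m → K) (hx : ∀ i, x i ≠ 0) (u v : K) :
    IsLaurent ((m + 1) ^ 2) fun t =>
      htDet a (snocFun (fun i => x i * t) u) (snocFun y (v * t)) := by
  have hz : ∀ t : K, t ≠ 0 → ∀ i, x i * t * (v * t)⁻¹ = x i * v⁻¹ := fun t ht i => by
    rw [mul_inv, mul_mul_mul_comm, mul_inv_cancel₀ ht, mul_one]
  simp only [htDet_snoc]
  let M : K → Matrix (Fin (m + 1)) (Fin (m + 1)) K := fun t =>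
    htMatrix a (Fin.cons u fun i => x i * t : Fin (m + 1) → K)
      (Fin.cons (v * t) y : Fin (m + 1) → K)
  have hMt : ∀ t, M t = htMatrix a (Fin.cons u fun i => x i * t : Fin (m + 1) → K)
      (Fin.cons (v * t) y : Fin (m + 1) → K) := fun _ => rfl
  change IsLaurent _ fun t => (M t).det
  clear_value M
  simp only [Matrix.det_succ_row_zero]
  refine IsLaurent.sum fun j _ => ?_
  induction j using Fin.cases with
  | zero =>
    have h0 := (isLaurent_iceSum_ratio a u v 0 1).mul_const
      (∏ k, iceProd a (u * (y k)⁻¹))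
    have h1 := (isLaurent_htDet_scale a x y hx).const_mul (∏ i, iceProd a (x i * v⁻¹))
    refine ((h0.mul h1).mono ?_).congr fun t ht => ?_
    · have : (m + 1) ^ 2 = m ^ 2 + 2 * m + 1 := by ring
      simp only [zero_sub, Int.natAbs_neg, Int.natAbs_one]
      omega
    · rw [Fin.succAbove_zero, hMt, htMatrix_submatrix_succ, Matrix.det_mul_column,
        htMatrix_zero_right]
      simp only [Fin.cons_succ, Fin.cons_zero, hz t ht, htDet, Fin.val_zero, pow_zero, one_mul,
        zpow_zero, zpow_one, mul_one]
  | succ j =>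
    obtain ⟨m, rfl⟩ : ∃ k, m = k + 1 := ⟨m - 1, by have := j.pos; omega⟩
    have h0 := ((isLaurent_iceProd_ratio a u v 0 1).mul_const (iceSum a (u * (y j)⁻¹) *
      ∏ k ∈ Finset.univ.erase j, iceProd a (u * (y k)⁻¹))).const_mul
        ((-1) ^ (j.succ : ℕ))
    -- The entry in the row of u contains σ(a z) σ(a z⁻¹) with z = u/(v t), of width 2. An entry in
    -- the column of v has width 2 (m + 1), and the minor of order m with L = 2m + 1 has width m (m
    -- + 2). In total this is (m + 2)².
    have h1 : IsLaurent (2 * (m + 1) + m * (m + 2)) fun t =>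
        ((M t).submatrix Fin.succ j.succ.succAbove).det := by
      simp only [Matrix.det_succ_column_zero]
      refine IsLaurent.sum fun i _ => ?_
      have h2 := (((IsParityLaurent.prod (s := (Finset.univ : Finset (Fin (m + 1)))) fun k _ =>
        IsParityLaurent.iceProd a (y k)⁻¹).isLaurent (x i) (hx i)).const_mul
          (iceSum a (x i * v⁻¹))).const_mul ((-1) ^ (i : ℕ))
      have h3 := isLaurent_det_of_isParityLaurent
        (fun r : Fin m => iceProd a (x (i.succAbove r) * v⁻¹)) (fun r => x (i.succAbove r))
        (fun r => hx _) _ (fun s : Fin m => isParityLaurent_htEntry a y (j.succAbove s))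
      refine ((h2.mul h3).mono ?_).congr fun t ht => ?_
      · rw [Finset.card_univ, Fintype.card_fin, show 2 * (m + 1) - 1 + 1 - m = m + 2 by omega]
        omega
      · congr 1
        · rw [Matrix.submatrix_apply, Fin.succ_succAbove_zero, hMt, htMatrix_zero_right]
          simp [hz t ht, -mul_inv_rev]
        · congr 1
          ext r s
          simp only [Matrix.submatrix_apply, Matrix.of_apply]
          rw [Fin.succ_succAbove_succ, hMt, htMatrix_succ_right]
          simp [hz t ht, -mul_inv_rev]
    refine ((h0.mul h1).mono ?_).congr fun t ht => ?_
    · simp; nlinarith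
    · congr 2
      rw [hMt, htMatrix_succ_right]
      simp

end DetWidth

section Factorization

variable {K : Type*} [Field K]

/-! ### Reduction to the corner -/

theorem sq_eq_zpow_mul_sq_iff {a x y : K} (ha : a ≠ 0) (hx : x ≠ 0) (hy : y ≠ 0) :
    x ^ 2 = (a ^ (-1 : ℤ) * y) ^ 2 ↔ iceSigma (a * (x * y⁻¹)) = 0 := by
  rw [iceSigma_eq_zero (by positivity), zpow_neg_one]
  constructor <;> intro h
  · rw [mul_pow, mul_pow, h]; field_simp
  · field_simp at h ⊢; linear_combination h

/-- Antisymmetry moves i and j to the corner, and inversion of all parameters turns d = 1 into d =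
-1. -/
theorem eq_zero_of_corner {a : K} (ha : a ≠ 0) {m : ℕ}
    (Δ : (Fin (m + 1) → K) → (Fin (m + 1) → K) → K → K → K)
    (hperm : ∀ x y u v, (∀ i, x i ≠ 0) → (∀ j, y j ≠ 0) → u ≠ 0 → v ≠ 0 →
      ∀ π ρ : Equiv.Perm (Fin (m + 1)),
        Δ (x ∘ π) (y ∘ ρ) u v = Equiv.Perm.sign π * Equiv.Perm.sign ρ * Δ x y u v)
    (hinv : ∀ x y u v, (∀ i, x i ≠ 0) → (∀ j, y j ≠ 0) → u ≠ 0 → v ≠ 0 →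
      Δ x⁻¹ y⁻¹ u⁻¹ v⁻¹ = Δ x y u v)
    (hcorner : ∀ x y u v, (∀ i, x i ≠ 0) → (∀ j, y j ≠ 0) → u ≠ 0 → v ≠ 0 →
      iceSigma (a * (x 0 * (y 0)⁻¹)) = 0 → Δ x y u v = 0)
    {x y : Fin (m + 1) → K} {u v : K} (hx : ∀ i, x i ≠ 0) (hy : ∀ j, y j ≠ 0)
    (hu : u ≠ 0) (hv : v ≠ 0) {i j : Fin (m + 1)} {d : ℤ} (hd : d = -1 ∨ d = 1)
    (h : x i ^ 2 = (a ^ d * y j) ^ 2) : Δ x y u v = 0 := by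
  have key : ∀ x y u v, (∀ i, x i ≠ 0) → (∀ j, y j ≠ 0) → u ≠ 0 → v ≠ 0 →
      x i ^ 2 = (a ^ (-1 : ℤ) * y j) ^ 2 → Δ x y u v = 0 := by
    intro x y u v hx hy hu hv h
    have h1 := hcorner (x ∘ Equiv.swap 0 i) (y ∘ Equiv.swap 0 j) u v (fun _ => hx _)
      (fun _ => hy _) hu hv (by simpa using (sq_eq_zpow_mul_sq_iff ha (hx i) (hy j)).1 h)
    rw [hperm x y u v hx hy hu hv] at h1
    refine (mul_eq_zero.1 h1).resolve_left (mul_ne_zero ?_ ?_)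
    · exact left_ne_zero_of_mul_eq_one (sign_mul_self_cast _)
    · exact left_ne_zero_of_mul_eq_one (sign_mul_self_cast _)
  rcases hd with rfl | rfl
  · exact key x y u v hx hy hu hv h
  · rw [← hinv x y u v hx hy hu hv]
    refine key _ _ _ _ (fun i => inv_ne_zero (hx i)) (fun j => inv_ne_zero (hy j))
      (inv_ne_zero hu) (inv_ne_zero hv) ?_
    simp only [Pi.inv_apply]
    rw [zpow_neg_one, ← mul_inv, inv_pow, inv_pow, h, zpow_one]

theorem prod_iceProd {ι : Type*} (s : Finset ι) (a : K) (z : ι → K) :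
    ∏ i ∈ s, iceProd a (z i) =
      (∏ i ∈ s, iceSigma (a * z i)) * ∏ i ∈ s, iceSigma (a * (z i)⁻¹) :=
  Finset.prod_mul_distrib

/-! ### Half-turn symmetric states of even order -/

/-- In order m + 1 both sides have width 2 (m + 1)² - 1 in a common scale of the x_i, under which
the Vandermonde product is constant. The (m + 1)² pairs with d = ± 1 give 2 (m + 1)² triples. At the
corner both sides acquire the same factor, and the induction hypothesis remains. -/
theorem zHTEven_mul_sigmaVandermonde [CharZero K] {a : K} (ha : a ≠ 0) (ha4 : a ^ 4 ≠ 1) (m : ℕ)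
    (x y : Fin m → K) (hx : ∀ i, x i ≠ 0) (hy : ∀ j, y j ≠ 0) :
    zHTEven a m x y * sigmaVandermonde x y = zDW a m x y * htDet a x y := by
  induction m with
  | zero =>
    simp [zHTEven_eq_rowFold, zDW_eq_rowFold, htEnd, dwEnd, sigmaVandermonde, htDet]
  | succ m ih =>
    rw [← sub_eq_zero]
    refine eq_zero_of_laurent_of_zeros ha ha4
      (fun x y => zHTEven a (m + 1) x y * sigmaVandermonde x y - zDW a (m + 1) x y * htDet a x y)
      ?_ (W := 2 * (m + 1) ^ 2 - 1) ?_
      ((Finset.univ : Finset (Fin (m + 1))) ×ˢ (Finset.univ : Finset (Fin (m + 1))) ×ˢ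
        ({-1, 1} : Finset ℤ)) ?_ ?_ ?_ x y hx hy
    · intro x y _ _ e f
      obtain ⟨W₁, h₁⟩ := isLaurent_zHTEven a (m + 1) x y e f
      obtain ⟨W₂, h₂⟩ := isLaurent_sigmaVandermonde x y e f
      obtain ⟨W₃, h₃⟩ := isLaurent_htDet a x y e f
      exact ⟨_, ((h₁.mul h₂).mono (le_max_left _ _)).sub
        (((isLaurent_zDW a (m + 1) x y e f).mul h₃).mono (le_max_right _ _))⟩
    · intro x y hx _
      have h₁ := (isLaurent_zHTEven_scale a m.succ_ne_zero x y).mul_const (sigmaVandermonde x y)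
      have h₂ := (isLaurent_zDW_scale a m.succ_ne_zero x y).mul (isLaurent_htDet_scale a x y hx)
      have hW : (m + 1) ^ 2 - 1 + (m + 1) ^ 2 ≤ 2 * (m + 1) ^ 2 - 1 := by
        have : 0 < (m + 1) ^ 2 := by positivity
        omega
      refine (h₁.sub (h₂.mono hW)).congr fun t ht => ?_
      rw [sigmaVandermonde_scale x y ht]
    · intro s hs
      simp only [Finset.mem_product, Finset.mem_univ, Finset.mem_insert, Finset.mem_singleton,
        true_and] at hs
      omega
    · have : 0 < (m + 1) ^ 2 := by positivity
      simp only [Finset.card_product, Finset.card_univ, Fintype.card_fin]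
      rw [show ({-1, 1} : Finset ℤ).card = 2 by rfl, ← mul_assoc, ← sq]
      omega
    · intro s hs x y hx hy h
      simp only [Finset.mem_product, Finset.mem_univ, Finset.mem_insert, Finset.mem_singleton,
        true_and] at hs
      refine eq_zero_of_corner ha (fun x y _ _ => zHTEven a (m + 1) x y * sigmaVandermonde x y -
        zDW a (m + 1) x y * htDet a x y) ?_ ?_ ?_ hx hy one_ne_zero one_ne_zero hs h
      · intro x y _ _ hx hy _ _ π ρ
        rw [zHTEven_comp_perm ha hx hy, zDW_comp_perm ha hx hy, sigmaVandermonde_comp_perm,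
          htDet_comp_perm]
        ring
      · intro x y _ _ hx hy _ _
        rw [zHTEven_inv, zDW_inv ha hx hy, sigmaVandermonde_inv, htDet_inv]
      · intro x y _ _ hx hy _ _ h0
        have IH := ih (fun i => x i.succ) (fun j => y j.succ) (fun i => hx _) (fun j => hy _)
        rw [zHTEven_of_corner h0, zDW_of_corner h0, sigmaVandermonde_of_corner ha hx hy h0,
          htDet_of_corner h0, prod_iceProd, prod_iceProd]
        set A := ∏ j : Fin m, iceSigma (a * (x 0 * (y j.succ)⁻¹)⁻¹)
        set B := ∏ i : Fin m, iceSigma (a * (x i.succ * (y 0)⁻¹)⁻¹)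
        set C := ∏ i : Fin m, iceSigma (a * (x i.succ * (y 0)⁻¹))
        set D := ∏ j : Fin m, iceSigma (a * (x 0 * (y j.succ)⁻¹))
        linear_combination iceSigma (a ^ 2) * iceSigma (a * (x 0 * (y 0)⁻¹)⁻¹) * A ^ 2 * B ^ 2 *
          C * D * IH

end Factorization

/-! ### Factorization for odd order: corner and central line -/

section OddFactorization

variable {K : Type*} [Field K]

theorem prod_snocFun_succ {m : ℕ} (y : Fin (m + 1) → K) (v : K) (f : K → K) :
    ∏ j : Fin (m + 1), f (snocFun y v j.succ) = (∏ j : Fin m, f (y j.succ)) * f v := by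
  have h : ∀ j, snocFun y v j.succ = snocFun (fun j => y j.succ) v j :=
    fun j => congrFun (snocFun_succ y v) j
  simp only [h, Fin.prod_univ_castSucc, snocFun, Fin.snoc_castSucc, Fin.snoc_last]

theorem snocFun_zero {K : Type*} {m : ℕ} (y : Fin (m + 1) → K) (v : K) : snocFun y v 0 = y 0 := by
  rw [← Fin.castSucc_zero]; exact Fin.snoc_castSucc (α := fun _ => K) v y 0

section Corner

variable {a : K} {m : ℕ} {x y : Fin (m + 1) → K} {u v : K}

theorem zDW_snoc_of_corner (h : iceSigma (a * (x 0 * (y 0)⁻¹)) = 0) :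
    zDW a (m + 2) (snocFun x u) (snocFun y v) = iceSigma (a ^ 2) *
      ((∏ j : Fin m, iceSigma (a * (x 0 * (y j.succ)⁻¹)⁻¹)) * iceSigma (a * (x 0 * v⁻¹)⁻¹)) *
      ((∏ i : Fin m, iceSigma (a * (x i.succ * (y 0)⁻¹)⁻¹)) * iceSigma (a * (u * (y 0)⁻¹)⁻¹)) *
      zDW a (m + 1) (snocFun (fun i => x i.succ) u) (snocFun (fun j => y j.succ) v) := by
  rw [← snocFun_zero x u, ← snocFun_zero y v] at h
  rw [zDW_of_corner h, snocFun_succ, snocFun_succ, snocFun_zero, snocFun_zero,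
    prod_snocFun_succ y v fun z => iceSigma (a * (x 0 * z⁻¹)⁻¹),
    prod_snocFun_succ x u fun z => iceSigma (a * (z * (y 0)⁻¹)⁻¹)]

theorem sigmaVandermonde_snoc_of_corner (ha : a ≠ 0) (hx : ∀ i, x i ≠ 0) (hy : ∀ j, y j ≠ 0)
    (hu : u ≠ 0) (hv : v ≠ 0) (h : iceSigma (a * (x 0 * (y 0)⁻¹)) = 0) :
    sigmaVandermonde (snocFun x u) (snocFun y v) =
      ((∏ i : Fin m, iceSigma (a * (x i.succ * (y 0)⁻¹))) * iceSigma (a * (u * (y 0)⁻¹))) *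
      ((∏ j : Fin m, iceSigma (a * (x 0 * (y j.succ)⁻¹))) * iceSigma (a * (x 0 * v⁻¹))) *
      sigmaVandermonde (snocFun (fun i => x i.succ) u) (snocFun (fun j => y j.succ) v) := by
  rw [← snocFun_zero x u, ← snocFun_zero y v] at h
  rw [sigmaVandermonde_of_corner ha (snocFun_ne_zero hx hu) (snocFun_ne_zero hy hv) h,
    snocFun_succ, snocFun_succ, snocFun_zero, snocFun_zero,
    prod_snocFun_succ y v fun z => iceSigma (a * (x 0 * z⁻¹)),
    prod_snocFun_succ x u fun z => iceSigma (a * (z * (y 0)⁻¹))]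

theorem htDet_snoc_of_corner (h : iceSigma (a * (x 0 * (y 0)⁻¹)) = 0) :
    htDet a (snocFun x u) (snocFun y v) = iceSigma (a * (x 0 * (y 0)⁻¹)⁻¹) *
      ((∏ j : Fin m, iceProd a (x 0 * (y j.succ)⁻¹)) * iceProd a (x 0 * v⁻¹)) *
      ((∏ i : Fin m, iceProd a (x i.succ * (y 0)⁻¹)) * iceProd a (u * (y 0)⁻¹)) *
      htDet a (snocFun (fun i => x i.succ) u) (snocFun (fun j => y j.succ) v) := by
  rw [← snocFun_zero x u, ← snocFun_zero y v] at h
  rw [htDet_of_corner h, snocFun_succ, snocFun_succ, snocFun_zero, snocFun_zero,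
    prod_snocFun_succ y v fun z => iceProd a (x 0 * z⁻¹),
    prod_snocFun_succ x u fun z => iceProd a (z * (y 0)⁻¹)]

end Corner

/-- A permutation of the first m parameters extends to one of all parameters that fixes u and has
the same sign. -/
theorem cons_comp_decomposeFin {α : Type*} {m : ℕ} (x : Fin m → α) (u : α)
    (π : Equiv.Perm (Fin m)) : (Fin.cons u (x ∘ π) : Fin (m + 1) → α) =
      (Fin.cons u x : Fin (m + 1) → α) ∘ Equiv.Perm.decomposeFin.symm (0, π) := by
  funext i
  induction i using Fin.cases <;> simp

section Symmetry

variable {m : ℕ} (x y : Fin m → K) (u v : K) (π ρ : Equiv.Perm (Fin m))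

theorem htDet_snoc_comp_perm (a : K) : htDet a (snocFun (x ∘ π) u) (snocFun (y ∘ ρ) v) =
    Equiv.Perm.sign π * Equiv.Perm.sign ρ * htDet a (snocFun x u) (snocFun y v) := by
  rw [htDet_snoc, htDet_snoc, cons_comp_decomposeFin, cons_comp_decomposeFin, htDet_comp_perm,
    Equiv.Perm.decomposeFin.symm_sign, Equiv.Perm.decomposeFin.symm_sign]
  simp

theorem sigmaVandermonde_snoc_comp_perm :
    sigmaVandermonde (snocFun (x ∘ π) u) (snocFun (y ∘ ρ) v) =
      Equiv.Perm.sign π * Equiv.Perm.sign ρ * sigmaVandermonde (snocFun x u) (snocFun y v) := by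
  rw [sigmaVandermonde_snoc, sigmaVandermonde_snoc, cons_comp_decomposeFin,
    cons_comp_decomposeFin, sigmaVandermonde_comp_perm, Equiv.Perm.decomposeFin.symm_sign,
    Equiv.Perm.decomposeFin.symm_sign]
  simp

end Symmetry

theorem cons_ne_zero {m : ℕ} {x : Fin m → K} {u : K} (hx : ∀ i, x i ≠ 0) (hu : u ≠ 0)
    (i : Fin (m + 1)) : (Fin.cons u x : Fin (m + 1) → K) i ≠ 0 := by
  induction i using Fin.cases <;> simp [hu, hx]

section Last

variable {a : K} {m : ℕ} {x y : Fin m → K} {u v : K}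

theorem zDW_snoc [CharZero K] (ha : a ≠ 0) (hx : ∀ i, x i ≠ 0) (hy : ∀ j, y j ≠ 0)
    (hu : u ≠ 0) (hv : v ≠ 0) :
    zDW a (m + 1) (snocFun x u) (snocFun y v) =
      zDW a (m + 1) (Fin.cons u x : Fin (m + 1) → K) (Fin.cons v y : Fin (m + 1) → K) := by
  rw [snocFun_comp_finRotate, snocFun_comp_finRotate,
    zDW_comp_perm ha (cons_ne_zero hx hu) (cons_ne_zero hy hv)]

theorem zDW_snoc_comp_perm [CharZero K] (ha : a ≠ 0) (hx : ∀ i, x i ≠ 0) (hy : ∀ j, y j ≠ 0)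
    (hu : u ≠ 0) (hv : v ≠ 0) (π ρ : Equiv.Perm (Fin m)) :
    zDW a (m + 1) (snocFun (x ∘ π) u) (snocFun (y ∘ ρ) v) =
      zDW a (m + 1) (snocFun x u) (snocFun y v) := by
  rw [zDW_snoc ha (x := x ∘ π) (y := y ∘ ρ) (fun _ => hx _) (fun _ => hy _) hu hv,
    zDW_snoc ha hx hy hu hv,
    cons_comp_decomposeFin, cons_comp_decomposeFin,
    zDW_comp_perm ha (cons_ne_zero hx hu) (cons_ne_zero hy hv)]

theorem zDW_snoc_inv [CharZero K] (ha : a ≠ 0) (hx : ∀ i, x i ≠ 0) (hy : ∀ j, y j ≠ 0)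
    (hu : u ≠ 0) (hv : v ≠ 0) : zDW a (m + 1) (snocFun x⁻¹ u⁻¹) (snocFun y⁻¹ v⁻¹) =
      zDW a (m + 1) (snocFun x u) (snocFun y v) := by
  rw [← snocFun_inv, ← snocFun_inv, zDW_inv ha (snocFun_ne_zero hx hu) (snocFun_ne_zero hy hv)]

theorem inv_mul_inv_inv (u v : K) : u⁻¹ * (v⁻¹)⁻¹ = (u * v⁻¹)⁻¹ := by rw [mul_inv]

theorem iceSigma_of_line (ha : a ≠ 0) (hv : v ≠ 0) {ε : K} (hε : ε ^ 2 = 1)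
    (huv : u = ε * (a * v)) : iceSigma (a * (u⁻¹ * (v⁻¹)⁻¹)) = 0 := by
  have h0 : ε ≠ 0 := fun h => by simp [h] at hε
  rw [iceSigma_eq_zero (by subst huv; positivity), huv]
  field_simp
  exact hε.symm

/-- On u = ± a v the inverse parameters u⁻¹, v⁻¹, moved to the front, satisfy the corner condition.
The same device serves for the Vandermonde product and the determinant. -/
theorem zDW_snoc_of_line [CharZero K] (ha : a ≠ 0) (hx : ∀ i, x i ≠ 0) (hy : ∀ j, y j ≠ 0)
    (hu : u ≠ 0) (hv : v ≠ 0) {ε : K} (hε : ε ^ 2 = 1) (huv : u = ε * (a * v)) :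
    zDW a (m + 1) (snocFun x u) (snocFun y v) = iceSigma (a ^ 2) *
      (∏ j, iceSigma (a * (u * (y j)⁻¹))) * (∏ i, iceSigma (a * (x i * v⁻¹))) * zDW a m x y := by
  have h0 := iceSigma_of_line ha hv hε huv
  have hx' : ∀ i, x⁻¹ i ≠ 0 := fun i => inv_ne_zero (hx i)
  have hy' : ∀ j, y⁻¹ j ≠ 0 := fun j => inv_ne_zero (hy j)
  have h1 := zDW_of_corner (x := (Fin.cons u⁻¹ x⁻¹ : Fin (m + 1) → K))
    (y := (Fin.cons v⁻¹ y⁻¹ : Fin (m + 1) → K)) h0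
  rw [← zDW_snoc ha hx' hy' (inv_ne_zero hu) (inv_ne_zero hv),
    zDW_snoc_inv ha hx hy hu hv] at h1
  simp only [Fin.cons_succ, Fin.cons_zero, Pi.inv_apply, inv_mul_inv_inv] at h1
  rw [h1, ← zDW_inv ha hx hy]
  simp only [inv_inv]
  rfl

/-- For ε = -1 the sign change of u negates the turn weight of `false` relative to that of `true`.
The condition on κ cancels this, so that both central entries carry the weight κ `true` up to the
sign (-1)^m, which is absorbed by the product over j. -/
theorem zHTOddTurn_of_line (ha : a ≠ 0) (hx : ∀ i, x i ≠ 0) (hy : ∀ j, y j ≠ 0)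
    (hv : v ≠ 0) {ε : K} (hε : ε ^ 2 = 1) (huv : u = ε * (a * v)) (κ : Bool → K)
    (hκ : κ false = ε * κ true) :
    zHTOddTurn a κ x y u v = κ true * (∏ i, iceSigma (a * (x i * v⁻¹))) *
      (∏ j, iceSigma (a * (u * (y j)⁻¹))) * zHTEven a m x y := by
  have h := zHTOddTurn_of_eq_mul ha hx hy (mul_ne_zero ha hv) (rfl : a * v = a * v)
  simp only [zHTOddTurn, Pi.one_apply, one_mul] at h
  rcases sq_eq_one_iff.1 hε with rfl | rfl
  · rw [one_mul] at huv hκ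
    rw [zHTOddTurn, hκ, huv, ← mul_add, h]
    ring
  · rw [neg_one_mul] at huv
    have h2 : ∏ j, iceSigma (a * (u * (y j)⁻¹)) =
        (-1) ^ m * ∏ j, iceSigma (a * (a * v * (y j)⁻¹)) := by
      simp only [huv, neg_mul, mul_neg, iceSigma_neg, Finset.prod_neg, Finset.card_univ,
        Fintype.card_fin]
    rw [h2, huv, zHTOddTurn_neg, zHTOddTurn, hκ]
    simp only [if_true, Bool.false_eq_true, if_false]
    linear_combination (-1) ^ m * κ true * h

theorem sigmaVandermonde_snoc_of_line (ha : a ≠ 0) (hx : ∀ i, x i ≠ 0) (hy : ∀ j, y j ≠ 0)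
    (hu : u ≠ 0) (hv : v ≠ 0) {ε : K} (hε : ε ^ 2 = 1) (huv : u = ε * (a * v)) :
    sigmaVandermonde (snocFun x u) (snocFun y v) =
      (∏ i, iceSigma (a * (x i * v⁻¹)⁻¹)) * (∏ j, iceSigma (a * (u * (y j)⁻¹)⁻¹)) *
        sigmaVandermonde x y := by
  have h1 := sigmaVandermonde_of_corner (x := (Fin.cons u⁻¹ x⁻¹ : Fin (m + 1) → K))
    (y := (Fin.cons v⁻¹ y⁻¹ : Fin (m + 1) → K)) ha
    (cons_ne_zero (fun i => inv_ne_zero (hx i)) (inv_ne_zero hu))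
    (cons_ne_zero (fun j => inv_ne_zero (hy j)) (inv_ne_zero hv)) (iceSigma_of_line ha hv hε huv)
  rw [← sigmaVandermonde_snoc, ← snocFun_inv, ← snocFun_inv, sigmaVandermonde_inv] at h1
  simp only [Fin.cons_succ, Fin.cons_zero, Pi.inv_apply, inv_mul_inv_inv] at h1
  rw [h1, ← sigmaVandermonde_inv x y]
  rfl

theorem htDet_snoc_of_line (ha : a ≠ 0) (hv : v ≠ 0) {ε : K} (hε : ε ^ 2 = 1)
    (huv : u = ε * (a * v)) : htDet a (snocFun x u) (snocFun y v) = ε * iceSigma (a ^ 2) *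
      (∏ j, iceProd a (u * (y j)⁻¹)) * (∏ i, iceProd a (x i * v⁻¹)) * htDet a x y := by
  have h1 := htDet_of_corner (x := (Fin.cons u⁻¹ x⁻¹ : Fin (m + 1) → K))
    (y := (Fin.cons v⁻¹ y⁻¹ : Fin (m + 1) → K)) (iceSigma_of_line ha hv hε huv)
  rw [← htDet_snoc, ← snocFun_inv, ← snocFun_inv, htDet_inv] at h1
  simp only [Fin.cons_succ, Fin.cons_zero, Pi.inv_apply, inv_mul_inv_inv] at h1
  simp only [iceProd_inv, inv_inv] at h1
  have h2 : a * (u * v⁻¹) = ε * a ^ 2 := by rw [huv]; field_simp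
  rw [h1, h2, iceSigma_sign_mul hε, ← htDet_inv a x y]
  rfl

end Last

/-! ### Half-turn symmetric states of odd order -/

theorem iceSigma_mul_add_inv {a : K} (ha : a ≠ 0) :
    iceSigma a * (a + a⁻¹) = iceSigma (a ^ 2) := by
  rw [iceSigma, iceSigma]; field_simp; ring

theorem isLaurent_ratio_add_inv (u v : K) (k l : ℤ) : IsLaurent (k - l).natAbs
    fun t => u * t ^ k * (v * t ^ l)⁻¹ + (u * t ^ k)⁻¹ * (v * t ^ l) := by
  refine ((IsLaurent.zpow (u * v⁻¹) (k - l)).add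
    ((IsLaurent.zpow (u⁻¹ * v) (l - k)).mono (by omega))).congr fun t ht => ?_
  rw [zpow_sub₀ ht, zpow_sub₀ ht, mul_inv, mul_inv]
  ring

/-- There are m² pairs without the last index and one pair of last indices, each with d = ± 1: one
triple more than the width 2m² + 1 of `oddDefect`. -/
theorem card_filter_corner (m : ℕ) : (((Finset.univ : Finset (Fin (m + 1))) ×ˢ
    (Finset.univ : Finset (Fin (m + 1))) ×ˢ ({-1, 0, 1} : Finset ℤ)).filter fun s =>
      s.2.2 ≠ 0 ∧ (s.1 = Fin.last m ↔ s.2.1 = Fin.last m)).card = 2 * m ^ 2 + 2 := by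
  simp only [Finset.card_filter, Finset.sum_product, Fin.sum_univ_castSucc, Fin.castSucc_ne_last]
  simp
  ring

/-- The further 2m triples have d = 0 and exactly one last index. They balance the additional width
2m of the larger Vandermonde product in `oddDefect'`. -/
theorem card_filter_corner_or_equal (m : ℕ) : (((Finset.univ : Finset (Fin (m + 1))) ×ˢ
    (Finset.univ : Finset (Fin (m + 1))) ×ˢ ({-1, 0, 1} : Finset ℤ)).filter fun s =>
      (s.2.2 ≠ 0 ↔ (s.1 = Fin.last m ↔ s.2.1 = Fin.last m))).card = 2 * m ^ 2 + 2 * m + 2 := by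
  simp only [Finset.card_filter, Finset.sum_product, Fin.sum_univ_castSucc, Fin.castSucc_ne_last]
  simp
  ring

/-- In the cases in which `x i = ± a ^ d * y j` with `d = ± 1` and both or none of `i`, `j` are
the last index, vanishing follows from vanishing at the corner and on the central line. -/
theorem eq_zero_of_corner_of_line {a : K} (ha : a ≠ 0) {m : ℕ}
    (Δ : (Fin m → K) → (Fin m → K) → K → K → K)
    (hperm : ∀ x y u v, (∀ i, x i ≠ 0) → (∀ j, y j ≠ 0) → u ≠ 0 → v ≠ 0 →
      ∀ π ρ : Equiv.Perm (Fin m),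
        Δ (x ∘ π) (y ∘ ρ) u v = Equiv.Perm.sign π * Equiv.Perm.sign ρ * Δ x y u v)
    (hinv : ∀ x y u v, (∀ i, x i ≠ 0) → (∀ j, y j ≠ 0) → u ≠ 0 → v ≠ 0 →
      Δ x⁻¹ y⁻¹ u⁻¹ v⁻¹ = Δ x y u v)
    (hcorner : ∀ x y u v, (∀ i, x i ≠ 0) → (∀ j, y j ≠ 0) → u ≠ 0 → v ≠ 0 →
      ∀ h : m ≠ 0, iceSigma (a * (x ⟨0, Nat.pos_of_ne_zero h⟩ *
        (y ⟨0, Nat.pos_of_ne_zero h⟩)⁻¹)) = 0 → Δ x y u v = 0)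
    (hline : ∀ x y u v, (∀ i, x i ≠ 0) → (∀ j, y j ≠ 0) → u ≠ 0 → v ≠ 0 →
      ∀ ε, ε ^ 2 = 1 → u = ε * (a * v) → Δ x y u v = 0)
    {p q : Fin (m + 1) → K} (hp : ∀ i, p i ≠ 0) (hq : ∀ j, q j ≠ 0) {i j : Fin (m + 1)}
    (hij : i = Fin.last m ↔ j = Fin.last m) {d : ℤ} (hd : d = -1 ∨ d = 1)
    (h : p i ^ 2 = (a ^ d * q j) ^ 2) :
    Δ (fun i => p i.castSucc) (fun j => q j.castSucc) (q (Fin.last m)) (p (Fin.last m)) = 0 := by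
  induction i using Fin.lastCases with
  | last =>
    obtain rfl := hij.1 rfl
    -- The last entry of p is v and that of q is u, so the condition for the last indices with d =
    -- -1 means u = ± a v.
    have key : ∀ x y u v, (∀ i, x i ≠ 0) → (∀ j, y j ≠ 0) → u ≠ 0 → v ≠ 0 →
        v ^ 2 = (a ^ (-1 : ℤ) * u) ^ 2 → Δ x y u v = 0 := by
      intro x y u v hx hy hu hv h
      refine hline x y u v hx hy hu hv (u * (a * v)⁻¹) ?_ (by field_simp)
      rw [zpow_neg_one] at h
      field_simp at h ⊢
      exact h.symm
    rcases hd with rfl | rfl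
    · exact key _ _ _ _ (fun i => hp _) (fun j => hq _) (hq _) (hp _) h
    · rw [← hinv _ _ _ _ (fun i => hp _) (fun j => hq _) (hq _) (hp _)]
      refine key _ _ _ _ (fun i => inv_ne_zero (hp _)) (fun j => inv_ne_zero (hq _))
        (inv_ne_zero (hq _)) (inv_ne_zero (hp _)) ?_
      rw [zpow_neg_one, ← mul_inv, inv_pow, inv_pow, h, zpow_one]
  | cast i =>
    induction j using Fin.lastCases with
    | last => exact absurd (hij.2 rfl) (Fin.castSucc_ne_last i)
    | cast j =>
      obtain ⟨m, rfl⟩ : ∃ k, m = k + 1 := ⟨m - 1, by have := j.pos; omega⟩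
      exact eq_zero_of_corner ha Δ hperm hinv
        (fun x y u v hx hy hu hv h0 => hcorner x y u v hx hy hu hv m.succ_ne_zero h0)
        (fun i => hp _) (fun j => hq _) (hq _) (hp _) hd h

end OddFactorization

section OddFactorization

variable {K : Type*} [Field K] {a : K}

theorem ratio_add_inv_of_line (ha : a ≠ 0) {u v : K} (hv : v ≠ 0) {ε : K} (hε : ε ^ 2 = 1)
    (huv : u = ε * (a * v)) : u * v⁻¹ + u⁻¹ * v = ε * (a + a⁻¹) := by
  have h : ε⁻¹ = ε := inv_eq_of_mul_eq_one_left (by rw [← sq, hε])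
  have h1 : u * v⁻¹ = ε * a := by rw [huv]; field_simp
  have h2 : u⁻¹ * v = (u * v⁻¹)⁻¹ := by rw [mul_inv, inv_inv]
  rw [h2, h1, mul_inv, h]
  ring

/-- The difference of the two sides of the first of the two factorizations for odd order. -/
noncomputable def oddDefect (a : K) {m : ℕ} (x y : Fin m → K) (u v : K) : K :=
  iceSigma a * zHTOddTurn a (fun c => cond c (a + a⁻¹) (u * v⁻¹ + u⁻¹ * v)) x y u v *
    sigmaVandermonde x y - zDW a (m + 1) (snocFun x u) (snocFun y v) * htDet a x y

/-- The difference of the two sides of the second of the two factorizations for odd order. -/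
noncomputable def oddDefect' (a : K) {m : ℕ} (x y : Fin m → K) (u v : K) : K :=
  iceSigma a * zHTOddTurn a (fun c => cond c (u * v⁻¹ + u⁻¹ * v) (a + a⁻¹)) x y u v *
    sigmaVandermonde (snocFun x u) (snocFun y v) -
      zDW a m x y * htDet a (snocFun x u) (snocFun y v)

section Symmetry

variable {m : ℕ} {x y : Fin m → K} {u v : K}

theorem ratio_add_inv_inv (u v : K) :
    u⁻¹ * (v⁻¹)⁻¹ + (u⁻¹)⁻¹ * v⁻¹ = u * v⁻¹ + u⁻¹ * v := by
  rw [inv_inv, inv_inv, add_comm]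

theorem oddDefect_comp_perm [CharZero K] (ha : a ≠ 0) (hx : ∀ i, x i ≠ 0) (hy : ∀ j, y j ≠ 0)
    (hu : u ≠ 0) (hv : v ≠ 0) (π ρ : Equiv.Perm (Fin m)) : oddDefect a (x ∘ π) (y ∘ ρ) u v =
      Equiv.Perm.sign π * Equiv.Perm.sign ρ * oddDefect a x y u v := by
  rw [oddDefect, zHTOddTurn_comp_perm ha _ hx hy hu hv, zDW_snoc_comp_perm ha hx hy hu hv,
    sigmaVandermonde_comp_perm, htDet_comp_perm, oddDefect]
  ring

theorem oddDefect'_comp_perm [CharZero K] (ha : a ≠ 0) (hx : ∀ i, x i ≠ 0) (hy : ∀ j, y j ≠ 0)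
    (hu : u ≠ 0) (hv : v ≠ 0) (π ρ : Equiv.Perm (Fin m)) : oddDefect' a (x ∘ π) (y ∘ ρ) u v =
      Equiv.Perm.sign π * Equiv.Perm.sign ρ * oddDefect' a x y u v := by
  rw [oddDefect', zHTOddTurn_comp_perm ha _ hx hy hu hv, zDW_comp_perm ha hx hy,
    sigmaVandermonde_snoc_comp_perm, htDet_snoc_comp_perm, oddDefect']
  ring

theorem oddDefect_inv [CharZero K] (ha : a ≠ 0) (hx : ∀ i, x i ≠ 0) (hy : ∀ j, y j ≠ 0)
    (hu : u ≠ 0) (hv : v ≠ 0) : oddDefect a x⁻¹ y⁻¹ u⁻¹ v⁻¹ = oddDefect a x y u v := by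
  rw [oddDefect, ratio_add_inv_inv, zHTOddTurn_inv, zDW_snoc_inv ha hx hy hu hv,
    sigmaVandermonde_inv, htDet_inv, oddDefect]

theorem oddDefect'_inv [CharZero K] (ha : a ≠ 0) (hx : ∀ i, x i ≠ 0) (hy : ∀ j, y j ≠ 0) :
    oddDefect' a x⁻¹ y⁻¹ u⁻¹ v⁻¹ = oddDefect' a x y u v := by
  rw [oddDefect', ratio_add_inv_inv, zHTOddTurn_inv, zDW_inv ha hx hy, ← snocFun_inv,
    ← snocFun_inv, sigmaVandermonde_inv, htDet_inv, oddDefect']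

end Symmetry

theorem oddDefect_of_corner (ha : a ≠ 0) {m : ℕ} {x y : Fin (m + 1) → K} {u v : K}
    (hx : ∀ i, x i ≠ 0) (hy : ∀ j, y j ≠ 0) (h : iceSigma (a * (x 0 * (y 0)⁻¹)) = 0)
    (ih : oddDefect a (fun i => x i.succ) (fun j => y j.succ) u v = 0) :
    oddDefect a x y u v = 0 := by
  rw [oddDefect] at ih ⊢
  rw [zHTOddTurn_of_corner _ _ _ h, zDW_snoc_of_corner h, sigmaVandermonde_of_corner ha hx hy h,
    htDet_of_corner h, prod_iceProd, prod_iceProd]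
  set A := ∏ j : Fin m, iceSigma (a * (x 0 * (y j.succ)⁻¹)⁻¹)
  set B := ∏ i : Fin m, iceSigma (a * (x i.succ * (y 0)⁻¹)⁻¹)
  set C := ∏ i : Fin m, iceSigma (a * (x i.succ * (y 0)⁻¹))
  set D := ∏ j : Fin m, iceSigma (a * (x 0 * (y j.succ)⁻¹))
  linear_combination iceSigma (a ^ 2) * iceSigma (a * (x 0 * (y 0)⁻¹)⁻¹) * A ^ 2 * B ^ 2 *
    C * D * iceSigma (a * (x 0 * v⁻¹)⁻¹) * iceSigma (a * (u * (y 0)⁻¹)⁻¹) * ih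

theorem oddDefect'_of_corner (ha : a ≠ 0) {m : ℕ} {x y : Fin (m + 1) → K} {u v : K}
    (hx : ∀ i, x i ≠ 0) (hy : ∀ j, y j ≠ 0) (hu : u ≠ 0) (hv : v ≠ 0)
    (h : iceSigma (a * (x 0 * (y 0)⁻¹)) = 0)
    (ih : oddDefect' a (fun i => x i.succ) (fun j => y j.succ) u v = 0) :
    oddDefect' a x y u v = 0 := by
  rw [oddDefect'] at ih ⊢
  rw [zHTOddTurn_of_corner _ _ _ h, zDW_of_corner h,
    sigmaVandermonde_snoc_of_corner ha hx hy hu hv h, htDet_snoc_of_corner h, prod_iceProd,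
    prod_iceProd, iceProd, iceProd]
  set A := ∏ j : Fin m, iceSigma (a * (x 0 * (y j.succ)⁻¹)⁻¹)
  set B := ∏ i : Fin m, iceSigma (a * (x i.succ * (y 0)⁻¹)⁻¹)
  set C := ∏ i : Fin m, iceSigma (a * (x i.succ * (y 0)⁻¹))
  set D := ∏ j : Fin m, iceSigma (a * (x 0 * (y j.succ)⁻¹))
  linear_combination iceSigma (a ^ 2) * iceSigma (a * (x 0 * (y 0)⁻¹)⁻¹) * A ^ 2 * B ^ 2 *
    C * D * iceSigma (a * (x 0 * v⁻¹)⁻¹) * iceSigma (a * (u * (y 0)⁻¹)⁻¹) *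
    iceSigma (a * (x 0 * v⁻¹)) * iceSigma (a * (u * (y 0)⁻¹)) * ih

section Line

variable {m : ℕ} {x y : Fin m → K} {u v : K}

/-- The turn weights become a + a⁻¹ and ε (a + a⁻¹), and the central line splits off. With σ(a) (a +
a⁻¹) = σ(a²) the identity reduces to the factorization for even order. -/
theorem oddDefect_of_line [CharZero K] (ha : a ≠ 0) (ha4 : a ^ 4 ≠ 1) (hx : ∀ i, x i ≠ 0)
    (hy : ∀ j, y j ≠ 0) (hu : u ≠ 0) (hv : v ≠ 0) {ε : K} (hε : ε ^ 2 = 1)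
    (huv : u = ε * (a * v)) : oddDefect a x y u v = 0 := by
  have h := zHTEven_mul_sigmaVandermonde ha ha4 m x y hx hy
  have hs := iceSigma_mul_add_inv ha
  rw [oddDefect, ratio_add_inv_of_line ha hv hε huv, zHTOddTurn_of_line ha hx hy hv hε huv _ rfl,
    zDW_snoc_of_line ha hx hy hu hv hε huv, cond_true]
  set P := ∏ i, iceSigma (a * (x i * v⁻¹))
  set Q := ∏ j, iceSigma (a * (u * (y j)⁻¹))
  linear_combination iceSigma (a ^ 2) * P * Q * h +
    P * Q * zHTEven a m x y * sigmaVandermonde x y * hs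

theorem oddDefect'_of_line [CharZero K] (ha : a ≠ 0) (ha4 : a ^ 4 ≠ 1) (hx : ∀ i, x i ≠ 0)
    (hy : ∀ j, y j ≠ 0) (hu : u ≠ 0) (hv : v ≠ 0) {ε : K} (hε : ε ^ 2 = 1)
    (huv : u = ε * (a * v)) : oddDefect' a x y u v = 0 := by
  have h := zHTEven_mul_sigmaVandermonde ha ha4 m x y hx hy
  have hs := iceSigma_mul_add_inv ha
  rw [oddDefect', ratio_add_inv_of_line ha hv hε huv,
    zHTOddTurn_of_line ha hx hy hv hε huv _ (by
      rw [cond_true, cond_false, ← mul_assoc, ← sq, hε, one_mul]),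
    sigmaVandermonde_snoc_of_line ha hx hy hu hv hε huv, htDet_snoc_of_line ha hv hε huv,
    prod_iceProd, prod_iceProd, cond_true]
  set P := ∏ i, iceSigma (a * (x i * v⁻¹))
  set Q := ∏ j, iceSigma (a * (u * (y j)⁻¹))
  set P' := ∏ i, iceSigma (a * (x i * v⁻¹)⁻¹)
  set Q' := ∏ j, iceSigma (a * (u * (y j)⁻¹)⁻¹)
  linear_combination ε * iceSigma (a ^ 2) * P * Q * P' * Q' * h +
    ε * P * Q * P' * Q' * zHTEven a m x y * sigmaVandermonde x y * hs

end Line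

theorem isLaurent_turnWeight (a u v : K) (k l : ℤ) (c : Bool) : IsLaurent (k - l).natAbs fun t =>
    cond c (a + a⁻¹) (u * t ^ k * (v * t ^ l)⁻¹ + (u * t ^ k)⁻¹ * (v * t ^ l)) := by
  cases c
  · exact isLaurent_ratio_add_inv u v k l
  · exact (IsLaurent.const _).mono (Nat.zero_le _)

theorem isLaurent_turnWeight' (a u v : K) (k l : ℤ) (c : Bool) : IsLaurent (k - l).natAbs fun t =>
    cond c (u * t ^ k * (v * t ^ l)⁻¹ + (u * t ^ k)⁻¹ * (v * t ^ l)) (a + a⁻¹) := by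
  cases c
  · exact (IsLaurent.const _).mono (Nat.zero_le _)
  · exact isLaurent_ratio_add_inv u v k l

theorem isLaurent_zDW_snocFun (a : K) {m : ℕ} (x y : Fin m → K) (u v : K) (e f : Fin m → ℤ)
    (k l : ℤ) : ∃ W, IsLaurent W fun t => zDW a (m + 1)
      (snocFun (fun i => x i * t ^ e i) (u * t ^ k))
      (snocFun (fun j => y j * t ^ f j) (v * t ^ l)) := by
  have h := isLaurent_zDW a (m + 1) (snocFun x u) (snocFun y v) (Fin.snoc e k) (Fin.snoc f l)
  simp only [snocFun_mul_zpow] at h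
  exact ⟨_, h⟩

theorem isLaurent_htDet_snocFun (a : K) {m : ℕ} (x y : Fin m → K) (u v : K) (e f : Fin m → ℤ)
    (k l : ℤ) : ∃ W, IsLaurent W fun t => htDet a
      (snocFun (fun i => x i * t ^ e i) (u * t ^ k))
      (snocFun (fun j => y j * t ^ f j) (v * t ^ l)) := by
  have h := isLaurent_htDet a (snocFun x u) (snocFun y v) (Fin.snoc e k) (Fin.snoc f l)
  simpa only [snocFun_mul_zpow] using h

theorem isLaurent_sigmaVandermonde_snocFun {m : ℕ} (x y : Fin m → K) (u v : K)
    (e f : Fin m → ℤ) (k l : ℤ) : ∃ W, IsLaurent W fun t => sigmaVandermonde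
      (snocFun (fun i => x i * t ^ e i) (u * t ^ k))
      (snocFun (fun j => y j * t ^ f j) (v * t ^ l)) := by
  have h := isLaurent_sigmaVandermonde (snocFun x u) (snocFun y v) (Fin.snoc e k) (Fin.snoc f l)
  simpa only [snocFun_mul_zpow] using h

/-- The turn weight has width 1 and Z⁺, Z⁻ have width 2m²; on the other side the widths are m² + 1
and m². So 2m² + 2 triples suffice, and they come from corners and from the central line. -/
theorem oddDefect_eq_zero_of_corner [CharZero K] (ha : a ≠ 0) (ha4 : a ^ 4 ≠ 1) (m : ℕ)
    (hcorner : ∀ (x y : Fin m → K) (u v : K), (∀ i, x i ≠ 0) → (∀ j, y j ≠ 0) → u ≠ 0 → v ≠ 0 →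
      ∀ h : m ≠ 0, iceSigma (a * (x ⟨0, Nat.pos_of_ne_zero h⟩ *
        (y ⟨0, Nat.pos_of_ne_zero h⟩)⁻¹)) = 0 → oddDefect a x y u v = 0)
    (x y : Fin m → K) (u v : K)
    (hx : ∀ i, x i ≠ 0) (hy : ∀ j, y j ≠ 0) (hu : u ≠ 0) (hv : v ≠ 0) :
    oddDefect a x y u v = 0 := by
  -- The parameters are regrouped as p = (x, v) and q = (y, u), so that the common scale of p
  -- multiplies the x_i and v.
  have key := eq_zero_of_laurent_of_zeros ha ha4 (fun p q : Fin (m + 1) → K =>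
    oddDefect a (fun i => p i.castSucc) (fun j => q j.castSucc) (q (Fin.last m)) (p (Fin.last m)))
    (fun p q _ _ e f => ?_) (W := 2 * m ^ 2 + 1) (fun p q hp hq => ?_) (((Finset.univ :
      Finset (Fin (m + 1))) ×ˢ (Finset.univ : Finset (Fin (m + 1))) ×ˢ
      ({-1, 0, 1} : Finset ℤ)).filter fun s => 
      s.2.2 ≠ 0 ∧ (s.1 = Fin.last m ↔ s.2.1 = Fin.last m))
    (fun s hs => ?_) (by rw [card_filter_corner]; omega) (fun s hs p q hp hq h => ?_)
    (snocFun x v) (snocFun y u) (snocFun_ne_zero hx hv) (snocFun_ne_zero hy hu)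
  · simpa [snocFun] using key
  · obtain ⟨W₁, h₁⟩ := isLaurent_zHTOddTurn a (isLaurent_turnWeight a (q (Fin.last m))
      (p (Fin.last m)) (f (Fin.last m)) (e (Fin.last m))) (fun i => p i.castSucc)
      (fun j => q j.castSucc) (q (Fin.last m)) (p (Fin.last m)) (fun i => e i.castSucc)
      (fun j => f j.castSucc) (f (Fin.last m)) (e (Fin.last m))
    obtain ⟨W₂, h₂⟩ := isLaurent_sigmaVandermonde (fun i => p i.castSucc)
      (fun j => q j.castSucc) (fun i => e i.castSucc) (fun j => f j.castSucc)
    obtain ⟨W₃, h₃⟩ := isLaurent_zDW_snocFun a (fun i => p i.castSucc)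
      (fun j => q j.castSucc) (q (Fin.last m)) (p (Fin.last m)) (fun i => e i.castSucc)
      (fun j => f j.castSucc) (f (Fin.last m)) (e (Fin.last m))
    obtain ⟨W₄, h₄⟩ := isLaurent_htDet a (fun i => p i.castSucc)
      (fun j => q j.castSucc) (fun i => e i.castSucc) (fun j => f j.castSucc)
    exact ⟨_, (((h₁.const_mul _).mul h₂).mono (le_max_left _ _)).sub
      ((h₃.mul h₄).mono (le_max_right _ _))⟩
  · have hκ := isLaurent_turnWeight a (q (Fin.last m)) (p (Fin.last m)) 0 1
    simp only [zpow_zero, zpow_one, mul_one] at hκ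
    have h₁ := ((isLaurent_zHTOddTurn_scale a hκ (fun i => p i.castSucc) (fun j => q j.castSucc)
      (q (Fin.last m)) (p (Fin.last m))).const_mul (iceSigma a)).mul_const
      (sigmaVandermonde (fun i => p i.castSucc) fun j => q j.castSucc)
    have h₂ := (isLaurent_zDW_snoc a (fun i => p i.castSucc) (fun j => q j.castSucc)
      (q (Fin.last m)) (p (Fin.last m))).mul (isLaurent_htDet_scale a (fun i => p i.castSucc)
      (fun j => q j.castSucc) fun i => hp _)
    refine ((h₁.mono (W' := 2 * m ^ 2 + 1) (by simp; omega)).sub (h₂.mono (by omega))).congr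
      fun t ht => ?_
    rw [oddDefect, sigmaVandermonde_scale _ _ ht]
  · simp only [Finset.mem_filter, Finset.mem_product, Finset.mem_insert,
      Finset.mem_singleton] at hs
    exact hs.1.2.2
  · simp only [Finset.mem_filter, Finset.mem_product, Finset.mem_univ, Finset.mem_insert,
      Finset.mem_singleton, true_and] at hs
    obtain ⟨i, j, d⟩ := s
    simp only at hs h
    have hline : d = -1 ∨ d = 1 → (i = Fin.last m ↔ j = Fin.last m) →
        oddDefect a (fun i => p i.castSucc) (fun j => q j.castSucc) (q (Fin.last m))
          (p (Fin.last m)) = 0 := fun hd hij =>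
      eq_zero_of_corner_of_line ha (oddDefect a)
        (fun x y u v hx hy hu hv => oddDefect_comp_perm ha hx hy hu hv)
        (fun x y u v hx hy hu hv => oddDefect_inv ha hx hy hu hv) hcorner
        (fun x y u v hx hy hu hv ε hε huv => oddDefect_of_line ha ha4 hx hy hu hv hε huv)
        hp hq hij hd h
    exact hline (by omega) hs.2.2

theorem oddDefect_eq_zero [CharZero K] (ha : a ≠ 0) (ha4 : a ^ 4 ≠ 1) (m : ℕ)
    (x y : Fin m → K) (u v : K) (hx : ∀ i, x i ≠ 0) (hy : ∀ j, y j ≠ 0) (hu : u ≠ 0) (hv : v ≠ 0) :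
    oddDefect a x y u v = 0 := by
  induction m generalizing u v with
  | zero =>
    exact oddDefect_eq_zero_of_corner ha ha4 0 (fun _ _ _ _ _ _ _ _ h => absurd rfl h)
      x y u v hx hy hu hv
  | succ m ih =>
    exact oddDefect_eq_zero_of_corner ha ha4 (m + 1) (fun x y u v hx hy hu hv _ h =>
      oddDefect_of_corner ha hx hy h (ih _ _ u v (fun _ => hx _) (fun _ => hy _) hu hv))
      x y u v hx hy hu hv

/-- The widths are (2m² + 1) + 2m on one side and m² + (m + 1)² on the other, both equal to 2m² + 2m
+ 1. -/
theorem oddDefect'_eq_zero_of_corner [CharZero K] (ha : a ≠ 0) (ha4 : a ^ 4 ≠ 1) (m : ℕ)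
    (hcorner : ∀ (x y : Fin m → K) (u v : K), (∀ i, x i ≠ 0) → (∀ j, y j ≠ 0) → u ≠ 0 → v ≠ 0 →
      ∀ h : m ≠ 0, iceSigma (a * (x ⟨0, Nat.pos_of_ne_zero h⟩ *
        (y ⟨0, Nat.pos_of_ne_zero h⟩)⁻¹)) = 0 → oddDefect' a x y u v = 0)
    (x y : Fin m → K) (u v : K)
    (hx : ∀ i, x i ≠ 0) (hy : ∀ j, y j ≠ 0) (hu : u ≠ 0) (hv : v ≠ 0) :
    oddDefect' a x y u v = 0 := by
  have key := eq_zero_of_laurent_of_zeros ha ha4 (fun p q : Fin (m + 1) → K =>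
    oddDefect' a (fun i => p i.castSucc) (fun j => q j.castSucc) (q (Fin.last m)) (p (Fin.last m)))
    (fun p q _ _ e f => ?_) (W := 2 * m ^ 2 + 2 * m + 1) (fun p q hp hq => ?_) (((Finset.univ :
      Finset (Fin (m + 1))) ×ˢ (Finset.univ : Finset (Fin (m + 1))) ×ˢ
      ({-1, 0, 1} : Finset ℤ)).filter fun s => 
      (s.2.2 ≠ 0 ↔ (s.1 = Fin.last m ↔ s.2.1 = Fin.last m)))
    (fun s hs => ?_) (by rw [card_filter_corner_or_equal]; omega) (fun s hs p q hp hq h => ?_)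
    (snocFun x v) (snocFun y u) (snocFun_ne_zero hx hv) (snocFun_ne_zero hy hu)
  · simpa [snocFun] using key
  · obtain ⟨W₁, h₁⟩ := isLaurent_zHTOddTurn a (isLaurent_turnWeight' a (q (Fin.last m))
      (p (Fin.last m)) (f (Fin.last m)) (e (Fin.last m))) (fun i => p i.castSucc)
      (fun j => q j.castSucc) (q (Fin.last m)) (p (Fin.last m)) (fun i => e i.castSucc)
      (fun j => f j.castSucc) (f (Fin.last m)) (e (Fin.last m))
    obtain ⟨W₂, h₂⟩ := isLaurent_sigmaVandermonde_snocFun (fun i => p i.castSucc)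
      (fun j => q j.castSucc) (q (Fin.last m)) (p (Fin.last m)) (fun i => e i.castSucc)
      (fun j => f j.castSucc) (f (Fin.last m)) (e (Fin.last m))
    have h₃ := isLaurent_zDW a m (fun i => p i.castSucc)
      (fun j => q j.castSucc) (fun i => e i.castSucc) (fun j => f j.castSucc)
    obtain ⟨W₄, h₄⟩ := isLaurent_htDet_snocFun a (fun i => p i.castSucc)
      (fun j => q j.castSucc) (q (Fin.last m)) (p (Fin.last m)) (fun i => e i.castSucc)
      (fun j => f j.castSucc) (f (Fin.last m)) (e (Fin.last m))
    exact ⟨_, (((h₁.const_mul _).mul h₂).mono (le_max_left _ _)).sub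
      ((h₃.mul h₄).mono (le_max_right _ _))⟩
  · have hκ := isLaurent_turnWeight' a (q (Fin.last m)) (p (Fin.last m)) 0 1
    simp only [zpow_zero, zpow_one, mul_one] at hκ
    have h₁ := ((isLaurent_zHTOddTurn_scale a hκ (fun i => p i.castSucc) (fun j => q j.castSucc)
      (q (Fin.last m)) (p (Fin.last m))).const_mul (iceSigma a)).mul
      (isLaurent_sigmaVandermonde_snoc (fun i => p i.castSucc) (fun j => q j.castSucc)
      (q (Fin.last m)) (p (Fin.last m)))
    have h₂ := (isLaurent_zDW a m (fun i => p i.castSucc) (fun j => q j.castSucc) 1 0).mul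
      (isLaurent_htDet_snoc a (fun i => p i.castSucc) (fun j => q j.castSucc) (fun i => hp _)
      (q (Fin.last m)) (p (Fin.last m)))
    refine ((h₁.mono (W' := 2 * m ^ 2 + 2 * m + 1) (by simp; omega)).sub
      (h₂.mono (by simp; nlinarith))).congr fun t ht => ?_
    rw [oddDefect']
    simp
  · simp only [Finset.mem_filter, Finset.mem_product, Finset.mem_insert,
      Finset.mem_singleton] at hs
    exact hs.1.2.2
  · simp only [Finset.mem_filter, Finset.mem_product, Finset.mem_univ, Finset.mem_insert,
      Finset.mem_singleton, true_and] at hs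
    obtain ⟨i, j, d⟩ := s
    simp only at hs h
    have hline : d = -1 ∨ d = 1 → (i = Fin.last m ↔ j = Fin.last m) →
        oddDefect' a (fun i => p i.castSucc) (fun j => q j.castSucc) (q (Fin.last m))
          (p (Fin.last m)) = 0 := fun hd hij =>
      eq_zero_of_corner_of_line ha (oddDefect' a)
        (fun x y u v hx hy hu hv => oddDefect'_comp_perm ha hx hy hu hv)
        (fun x y u v hx hy hu hv => oddDefect'_inv ha hx hy) hcorner
        (fun x y u v hx hy hu hv ε hε huv => oddDefect'_of_line ha ha4 hx hy hu hv hε huv)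
        hp hq hij hd h
    -- For d = 0 the condition reads y_j = ± v or x_i = ± u, and the Vandermonde product and the
    -- determinant vanish separately.
    by_cases hd : d = 0
    · subst hd
      rw [zpow_zero, one_mul] at h
      have hij : ¬(i = Fin.last m ↔ j = Fin.last m) := fun hij => hs.2.2 hij rfl
      induction i using Fin.lastCases with
      | last =>
        induction j using Fin.lastCases with
        | last => exact absurd Iff.rfl hij
        | cast j =>
          rw [oddDefect', sigmaVandermonde_eq_zero_of_right _ (y := fun j => q j.castSucc) _ (hp _)
            (j := j) (hq _) h.symm,
            htDet_eq_zero_of_sq_eq_right a _ (i := j.castSucc) (j := Fin.last m)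
              (Fin.castSucc_ne_last j) (by simpa [snocFun] using h.symm)]
          ring
      | cast i =>
        induction j using Fin.lastCases with
        | last =>
          rw [oddDefect', sigmaVandermonde_eq_zero_of_left (x := fun i => p i.castSucc) _ _ (hq _)
            (i := i) (hp _) h,
            htDet_eq_zero_of_sq_eq_left a _ (i := i.castSucc) (j := Fin.last m)
              (Fin.castSucc_ne_last i) (by simpa [snocFun] using h)]
          ring
        | cast j => exact absurd (by simp [Fin.castSucc_ne_last]) hij
    · exact hline (by omega) (hs.2.1 hd)

theorem oddDefect'_eq_zero [CharZero K] (ha : a ≠ 0) (ha4 : a ^ 4 ≠ 1) (m : ℕ)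
    (x y : Fin m → K) (u v : K) (hx : ∀ i, x i ≠ 0) (hy : ∀ j, y j ≠ 0) (hu : u ≠ 0) (hv : v ≠ 0) :
    oddDefect' a x y u v = 0 := by
  induction m generalizing u v with
  | zero =>
    exact oddDefect'_eq_zero_of_corner ha ha4 0 (fun _ _ _ _ _ _ _ _ h => absurd rfl h)
      x y u v hx hy hu hv
  | succ m ih =>
    exact oddDefect'_eq_zero_of_corner ha ha4 (m + 1) (fun x y u v hx hy hu hv _ h =>
      oddDefect'_of_corner ha hx hy hu hv h (ih _ _ u v (fun _ => hx _) (fun _ => hy _) hu hv))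
      x y u v hx hy hu hv

end OddFactorization

/-! ### Nonvanishing of the domain wall partition function -/

section Nonvanishing

open scoped Classical

/-- The partition function of order `n` multiplied by all `x i * y j`, as a polynomial in the
spectral parameters, in `a` and in `b = a⁻¹`. -/
noncomputable def zDWPoly {R : Type*} [CommRing R] (a b : R) (n : ℕ) (x y : Fin n → R) : R :=
  ∑ c : IceConfig n with c.IsState, ∏ p : Fin n × Fin n,
    if c.left p.1 p.2 ≠ c.right p.1 p.2 then (a ^ 2 - b ^ 2) * (x p.1 * y p.2)
    else if c.left p.1 p.2 = c.top p.1 p.2 then a * x p.1 ^ 2 - b * y p.2 ^ 2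
    else a * y p.2 ^ 2 - b * x p.1 ^ 2

theorem map_zDWPoly {R S : Type*} [CommRing R] [CommRing S] (φ : R →+* S) (a b : R) (n : ℕ)
    (x y : Fin n → R) :
    φ (zDWPoly a b n x y) = zDWPoly (φ a) (φ b) n (fun i => φ (x i)) fun j => φ (y j) := by
  simp only [zDWPoly, map_sum, map_prod]
  refine Finset.sum_congr rfl fun c _ => Finset.prod_congr rfl fun p _ => ?_
  split_ifs <;> simp

theorem zDWPoly_eq {K : Type*} [Field K] (a : K) (n : ℕ) {x y : Fin n → K} (hx : ∀ i, x i ≠ 0)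
    (hy : ∀ j, y j ≠ 0) :
    zDWPoly a a⁻¹ n x y = zDW a n x y * ∏ p : Fin n × Fin n, x p.1 * y p.2 := by
  rw [zDWPoly, zDW, Finset.sum_mul]
  refine Finset.sum_congr rfl fun c _ => ?_
  rw [IceConfig.weight, ← Finset.prod_mul_distrib]
  refine Finset.prod_congr rfl fun p _ => ?_
  have h1 := hx p.1
  have h2 := hy p.2
  rw [IceConfig.vertexWeight]
  split_ifs
  · rw [iceSigma, inv_pow]
  · rw [iceSigma, mul_inv, mul_inv, inv_inv]; field_simp
  · rw [iceSigma, mul_inv, mul_inv, inv_inv]; field_simp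

/-- Prepend x_0 = a⁻¹ s and y_0 = s. The corner recursion gives the previous value times explicit
factors: σ(a²) is nonzero because a⁴ ≠ 1, and the others vanish for finitely many s only. -/
theorem exists_zDW_ne_zero {F : Type*} [Field F] [CharZero F] {a : F} (ha : a ≠ 0)
    (ha4 : a ^ 4 ≠ 1) (n : ℕ) :
    ∃ x y : Fin n → F, (∀ i, x i ≠ 0) ∧ (∀ j, y j ≠ 0) ∧ zDW a n x y ≠ 0 := by
  induction n with
  | zero => exact ⟨0, 0, fun i => i.elim0, fun i => i.elim0, by simp [zDW_eq_rowFold, dwEnd]⟩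
  | succ n ih =>
    obtain ⟨x, y, hx, hy, h⟩ := ih
    have : Infinite F := CharZero.infinite F
    have hfin : (⋃ k : Fin n, ({s : F | s ≠ 0 ∧ s ^ (2 : ℤ) = (a ^ 2 * y k) ^ 2} ∪
        {s : F | s ≠ 0 ∧ s ^ (2 : ℤ) = (a⁻¹ * x k) ^ 2})).Finite :=
      Set.finite_iUnion fun k => (finite_zpow_eq two_ne_zero _).union (finite_zpow_eq two_ne_zero _)
    obtain ⟨s, hs⟩ := (hfin.union (Set.finite_singleton 0)).exists_notMem
    simp only [Set.mem_union, Set.mem_iUnion, Set.mem_ofPred_eq, Set.mem_singleton_iff, not_or,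
      not_exists] at hs
    obtain ⟨hs1, hs0⟩ := hs
    have hx0 : a⁻¹ * s ≠ 0 := mul_ne_zero (inv_ne_zero ha) hs0
    refine ⟨Fin.cons (a⁻¹ * s) x, Fin.cons s y, cons_ne_zero hx hx0, cons_ne_zero hy hs0, ?_⟩
    rw [zDW_of_corner (by simp only [Fin.cons_zero]; field_simp; simp [iceSigma])]
    simp only [Fin.cons_zero, Fin.cons_succ]
    refine mul_ne_zero (mul_ne_zero (mul_ne_zero ?_ ?_) ?_) h
    · rw [ne_eq, iceSigma_eq_zero (pow_ne_zero 2 ha), ← pow_mul]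
      exact ha4
    · refine Finset.prod_ne_zero_iff.2 fun k _ h0 => (hs1 k).1 ⟨hs0, ?_⟩
      have := hy k
      rw [iceSigma_eq_zero (by positivity)] at h0
      rw [zpow_ofNat]
      field_simp at h0 ⊢
      exact h0.symm
    · refine Finset.prod_ne_zero_iff.2 fun k _ h0 => (hs1 k).2 ⟨hs0, ?_⟩
      have := hx k
      rw [iceSigma_eq_zero (by positivity)] at h0
      rw [zpow_ofNat]
      field_simp at h0 ⊢
      exact h0

end Nonvanishing

/-! ### Independent variables as parameters -/

section Generic

variable {F : Type*} [Field F] {k : ℕ}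

theorem xVar_ne_zero (i : Fin k) : xVar F k i ≠ 0 := by
  rw [xVar, ne_eq, FaithfulSMul.algebraMap_eq_zero_iff]
  exact MvPolynomial.X_ne_zero _

theorem yVar_ne_zero (j : Fin k) : yVar F k j ≠ 0 := by
  rw [yVar, ne_eq, FaithfulSMul.algebraMap_eq_zero_iff]
  exact MvPolynomial.X_ne_zero _

theorem constParam_ne_zero {a : F} (ha : a ≠ 0) : constParam k a ≠ 0 := by
  rw [constParam, ne_eq, FaithfulSMul.algebraMap_eq_zero_iff]
  simpa using ha

theorem constParam_inv (a : F) : constParam k a⁻¹ = (constParam k a)⁻¹ :=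
  map_inv₀ ((algebraMap (MvPolynomial (Fin k ⊕ Fin k) F) (SpectralField F k)).comp
    MvPolynomial.C) a

theorem constParam_pow_ne_one {a : F} {n : ℕ} (h : a ^ n ≠ 1) : constParam k a ^ n ≠ 1 := by
  intro h0
  refine h (((algebraMap (MvPolynomial (Fin k ⊕ Fin k) F) (SpectralField F k)).comp
    MvPolynomial.C).injective ?_)
  rw [map_pow, map_one]
  exact h0

theorem charZero_spectralField [CharZero F] : CharZero (SpectralField F k) :=
  charZero_of_injective_ringHom ((algebraMap (MvPolynomial (Fin k ⊕ Fin k) F)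
    (SpectralField F k)).comp MvPolynomial.C).injective

/-- The two polynomials are separated by the point at which the variable s is 1 and all others are
0. -/
theorem const_mul_sq_ne_sq (b : F) {r s : Fin k ⊕ Fin k} (h : r ≠ s) :
    algebraMap (MvPolynomial (Fin k ⊕ Fin k) F) (SpectralField F k)
      (MvPolynomial.C b * MvPolynomial.X r ^ 2) ≠
    algebraMap (MvPolynomial (Fin k ⊕ Fin k) F) (SpectralField F k) (MvPolynomial.X s ^ 2) := by
  intro h0
  have h1 := congrArg (MvPolynomial.eval (Pi.single s (1 : F)))
    (FaithfulSMul.algebraMap_injective _ _ h0)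
  simp [Pi.single_eq_of_ne h] at h1

theorem iceSigma_xVar_ne_zero {i j : Fin k} (h : i ≠ j) :
    iceSigma (xVar F k i * (xVar F k j)⁻¹) ≠ 0 := by
  intro h0
  have hi := xVar_ne_zero (F := F) i
  have hj := xVar_ne_zero (F := F) j
  rw [iceSigma_eq_zero (mul_ne_zero hi (inv_ne_zero hj)), mul_pow, inv_pow,
    mul_inv_eq_one₀ (pow_ne_zero 2 hj)] at h0
  refine const_mul_sq_ne_sq (1 : F) (fun h' => h (Sum.inl_injective h')) ?_
  simpa [xVar] using h0

theorem iceSigma_yVar_ne_zero {i j : Fin k} (h : i ≠ j) :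
    iceSigma (yVar F k i * (yVar F k j)⁻¹) ≠ 0 := by
  intro h0
  have hi := yVar_ne_zero (F := F) i
  have hj := yVar_ne_zero (F := F) j
  rw [iceSigma_eq_zero (mul_ne_zero hi (inv_ne_zero hj)), mul_pow, inv_pow,
    mul_inv_eq_one₀ (pow_ne_zero 2 hj)] at h0
  refine const_mul_sq_ne_sq (1 : F) (fun h' => h (Sum.inr_injective h')) ?_
  simpa [yVar] using h0

theorem iceSigma_const_mul_ne_zero {a : F} (ha : a ≠ 0) (i j : Fin k) :
    iceSigma (constParam k a * xVar F k i * (yVar F k j)⁻¹) ≠ 0 ∧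
      iceSigma (constParam k a * (xVar F k i)⁻¹ * yVar F k j) ≠ 0 := by
  have hi := xVar_ne_zero (F := F) i
  have hj := yVar_ne_zero (F := F) j
  have ha' := constParam_ne_zero (k := k) ha
  constructor <;> intro h0 <;> rw [iceSigma_eq_zero (by positivity)] at h0
  · refine const_mul_sq_ne_sq (a ^ 2) (r := Sum.inl i) (s := Sum.inr j) (by simp) ?_
    simp only [map_mul, map_pow]
    change constParam k a ^ 2 * xVar F k i ^ 2 = yVar F k j ^ 2
    field_simp at h0
    exact h0
  · refine const_mul_sq_ne_sq (a ^ 2) (r := Sum.inr j) (s := Sum.inl i) (by simp) ?_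
    simp only [map_mul, map_pow]
    change constParam k a ^ 2 * yVar F k j ^ 2 = xVar F k i ^ 2
    field_simp at h0
    exact h0

theorem sigmaVandermonde_ne_zero {n : ℕ} {φ : Fin n → Fin k} (hφ : Function.Injective φ) :
    sigmaVandermonde (fun i => xVar F k (φ i)) (fun j => yVar F k (φ j)) ≠ 0 :=
  Finset.prod_ne_zero_iff.2 fun _ _ => Finset.prod_ne_zero_iff.2 fun _ hj =>
    mul_ne_zero (iceSigma_xVar_ne_zero (hφ.ne (Finset.mem_Ioi.1 hj).ne))
      (iceSigma_yVar_ne_zero (hφ.ne (Finset.mem_Ioi.1 hj).ne'))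

/-- Vanishing in the field of fractions would be a polynomial identity after clearing denominators,
and it would persist under specialization to a point of F at which the partition function is not
zero. -/
theorem zDW_ne_zero [CharZero F] {a : F} (ha : a ≠ 0) (ha4 : a ^ 4 ≠ 1) {n : ℕ}
    {φ : Fin n → Fin k} (hφ : Function.Injective φ) :
    zDW (constParam k a) n (fun i => xVar F k (φ i)) (fun j => yVar F k (φ j)) ≠ 0 := by
  intro h0
  obtain ⟨x, y, hx, hy, h⟩ := exists_zDW_ne_zero ha ha4 n
  have h1 := zDWPoly_eq (constParam k a) n (fun i => xVar_ne_zero (F := F) (φ i))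
    (fun j => yVar_ne_zero (F := F) (φ j))
  rw [h0, zero_mul, ← constParam_inv] at h1
  have h2 : zDWPoly (MvPolynomial.C a) (MvPolynomial.C a⁻¹) n
      (fun i => (MvPolynomial.X (Sum.inl (φ i)) : MvPolynomial (Fin k ⊕ Fin k) F))
      (fun j => MvPolynomial.X (Sum.inr (φ j))) = 0 := by
    refine FaithfulSMul.algebraMap_injective _ (SpectralField F k) ?_
    rw [map_zDWPoly, map_zero]
    exact h1
  have h3 := congrArg (MvPolynomial.eval (Sum.elim
    (Function.extend φ x 0) (Function.extend φ y 0))) h2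
  rw [map_zDWPoly, map_zero] at h3
  simp only [MvPolynomial.eval_C, MvPolynomial.eval_X, Sum.elim_inl, Sum.elim_inr,
    hφ.extend_apply] at h3
  rw [zDWPoly_eq a n hx hy] at h3
  exact mul_ne_zero h (Finset.prod_ne_zero_iff.2 fun p _ => mul_ne_zero (hx _) (hy _)) h3

end Generic

/-! ### Solution of the linear system -/

theorem snocFun_castSucc_last {K : Type*} {m : ℕ} (x : Fin (m + 1) → K) :
    snocFun (fun i => x i.castSucc) (x (Fin.last m)) = x := by
  funext i
  induction i using Fin.lastCases <;> simp

theorem theorem2 {F : Type*} [Field F] [CharZero F] (m : ℕ) (a₀ : F)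
    (ha₀ : a₀ ≠ 0) (ha₀4 : a₀ ^ 4 ≠ 1) :
    let a : SpectralField F (m + 1) := constParam (m + 1) a₀
    let x : Fin (m + 1) → SpectralField F (m + 1) := xVar F (m + 1)
    let y : Fin (m + 1) → SpectralField F (m + 1) := yVar F (m + 1)
    let xₗ := x (Fin.last m)
    let yₗ := y (Fin.last m)
    let x' : Fin m → SpectralField F (m + 1) := fun i => x i.castSucc
    let y' : Fin m → SpectralField F (m + 1) := fun i => y i.castSucc
    -- the factor `Z_HT^{(2)}` is well defined by its defining equation
    zDW a m x' y' ≠ 0 ∧ zDW a (m + 1) x y ≠ 0 ∧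
    -- the two contributions exhaust the partition function
    zHTOdd a m x y = zHTOddCentral a 1 m x y + zHTOddCentral a (-1) m x y ∧
    -- the contribution of the central entry `1`
    zHTOddCentral a 1 m x y =
      1 / (iceSigma a * iceSigma (a * xₗ * yₗ⁻¹) * iceSigma (a * xₗ⁻¹ * yₗ)) *
        ((a + a⁻¹) * zDW a (m + 1) x y * zHTTwo a m x' y'
          - (xₗ * yₗ⁻¹ + xₗ⁻¹ * yₗ) * zDW a m x' y' * zHTTwo a (m + 1) x y) ∧
    -- the contribution of the central entry `-1`
    zHTOddCentral a (-1) m x y =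
      1 / (iceSigma a * iceSigma (a * xₗ * yₗ⁻¹) * iceSigma (a * xₗ⁻¹ * yₗ)) *
        (-(xₗ * yₗ⁻¹ + xₗ⁻¹ * yₗ) * zDW a (m + 1) x y * zHTTwo a m x' y'
          + (a + a⁻¹) * zDW a m x' y' * zHTTwo a (m + 1) x y) := by
  intro a x y xₗ yₗ x' y'
  have : CharZero (SpectralField F (m + 1)) := charZero_spectralField
  have ha : a ≠ 0 := constParam_ne_zero ha₀
  have ha4 : a ^ 4 ≠ 1 := constParam_pow_ne_one ha₀4
  have hx : ∀ i, x i ≠ 0 := xVar_ne_zero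
  have hy : ∀ j, y j ≠ 0 := yVar_ne_zero
  have hu : xₗ ≠ 0 := hx _
  have hv : yₗ ≠ 0 := hy _
  have hZ₀ : zDW a m x' y' ≠ 0 := zDW_ne_zero ha₀ ha₀4 (Fin.castSucc_injective m)
  have hZ₁ : zDW a (m + 1) x y ≠ 0 := zDW_ne_zero ha₀ ha₀4 Function.injective_id
  have hV₀ : sigmaVandermonde x' y' ≠ 0 := sigmaVandermonde_ne_zero (Fin.castSucc_injective m)
  have hV₁ : sigmaVandermonde x y ≠ 0 := sigmaVandermonde_ne_zero Function.injective_id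
  have hσ : iceSigma a ≠ 0 := by
    rw [ne_eq, iceSigma_eq_zero ha]
    intro h
    exact ha4 (by linear_combination (a ^ 2 + 1) * h)
  obtain ⟨hd₁, hd₂⟩ : iceSigma (a * xₗ * yₗ⁻¹) ≠ 0 ∧ iceSigma (a * xₗ⁻¹ * yₗ) ≠ 0 :=
    iceSigma_const_mul_ne_zero ha₀ _ _
  -- The determinant of the linear system for the two contributions.
  have hd : iceSigma (a * xₗ * yₗ⁻¹) * iceSigma (a * xₗ⁻¹ * yₗ) =
      (a + a⁻¹) ^ 2 - (xₗ * yₗ⁻¹ + xₗ⁻¹ * yₗ) ^ 2 := by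
    simp only [iceSigma]
    field_simp
    ring
  have hH₀ : zHTTwo a m x' y' = htDet a x' y' / sigmaVandermonde x' y' := by
    rw [zHTTwo, div_eq_div_iff hZ₀ hV₀,
      zHTEven_mul_sigmaVandermonde ha ha4 m x' y' (fun i => hx _) (fun j => hy _), mul_comm]
  have hH₁ : zHTTwo a (m + 1) x y = htDet a x y / sigmaVandermonde x y := by
    rw [zHTTwo, div_eq_div_iff hZ₁ hV₁,
      zHTEven_mul_sigmaVandermonde ha ha4 (m + 1) x y hx hy, mul_comm]
  have hA := oddDefect_eq_zero ha ha4 m x' y' xₗ yₗ (fun i => hx _) (fun j => hy _) hu hv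
  have hB := oddDefect'_eq_zero ha ha4 m x' y' xₗ yₗ (fun i => hx _) (fun j => hy _) hu hv
  rw [oddDefect, zHTOddTurn, snocFun_castSucc_last, snocFun_castSucc_last, cond_true, cond_false,
    sub_eq_zero, ← eq_div_iff hV₀, mul_div_assoc, ← hH₀] at hA
  rw [oddDefect', zHTOddTurn, snocFun_castSucc_last, snocFun_castSucc_last, cond_true, cond_false,
    sub_eq_zero, ← eq_div_iff hV₁, mul_div_assoc, ← hH₁] at hB
  refine ⟨hZ₀, hZ₁, zHTOdd_eq_add a m x y, ?_, ?_⟩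
  -- Cramer's rule: eliminating the other contribution from `hA` and `hB` leaves this one multiplied
  -- by σ(a) and the determinant.
  · rw [one_div, eq_inv_mul_iff_mul_eq₀ (by positivity)]
    linear_combination iceSigma a * zHTOddCentral a 1 m x y * hd + (a + a⁻¹) * hA -
      (xₗ * yₗ⁻¹ + xₗ⁻¹ * yₗ) * hB
  · rw [one_div, eq_inv_mul_iff_mul_eq₀ (by positivity)]
    linear_combination iceSigma a * zHTOddCentral a (-1) m x y * hd + (a + a⁻¹) * hB -
      (xₗ * yₗ⁻¹ + xₗ⁻¹ * yₗ) * hA
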